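/- A self-avoiding polygon is a simple closed lattice path (a cycle) in the square lattice $\mathbb Z^2$, considered up to translation. A polygon whose minimum bounding rectangle has width $w$ and height $h$ is called $m$-convex if its perimeter is $2(w+h)+2m$. For $m\ge 1$, call an $m$-convex polygon bimodal if its whole concavity is a single vertical indent of depth $m$ in its upper boundary. That is, if $t_i$ ($0\le i<w$) denotes the height of the topmost horizontal step of the polygon in its $i$-th column, then there are $0\le a<c<b<w$ such that $t$ is weakly increasing on $[0,a]$, weakly decreasing on $[a,c]$, weakly increasing on $[c,b]$ and weakly decreasing on $[b,w-1]$, with $\min(t_a,t_b)=t_c+m$. Let $g_{i,j}$ be the number (which is finite) of bimodal $2$-convex polygons with $2i$ horizontal and $2j$ vertical steps, let $\Delta=1-2x-2y-2xy+x^2+y^2$, and let $\Delta^{1/2}\in\mathbb Q[[x,y]]$ be the square root of $\Delta$ with constant term $1$. Then, as formal power series in $x,y$, $$ \sum_{i,j\ge 0} g_{i,j}\,x^i y^j = -\left(\frac{2x^2 A^{(2)}_c}{(1-x)^3\,((1-x)^2-y)\,\Delta^{5/2}} +\frac{x^2 B^{(2)}_c}{(1-x)^5\,((1-x)^2-y)^3\,\Delta^{3}}\right),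 $$ where $$ \begin{aligned} A^{(2)}_c ={}& -4(1-x)^{11} + 2(1-x)^9(10+9x)y - 2(1-x)^7(20+21x+15x^2)y^2\\ &+ (1-x)^5(40+17x+18x^2+21x^3)y^3\\ &- (1-x)^3(20-26x-31x^2-14x^3+3x^4)y^4\\ &+ (1-x)(2+x)(2-13x+5x^2-7x^3-3x^4)y^5\\ &+ x(4-11x-3x^2-5x^3-x^4)y^6 + x(1+x)^2y^7, \end{aligned} $$ $$ \begin{aligned} B^{(2)}_c ={}& 8(1-x)^{18} - 4(1-x)^{16}(16+11x)y + 8(1-x)^{14}(28+29x+12x^2)y^2\\ &- 2(1-x)^{12}(224+233x+158x^2+51x^3)y^3\\ &+ 2(1-x)^{10}(280+189x+144x^2+95x^3+24x^4)y^4\\ &- (1-x)^8(448-57x-56x^2+36x^4+x^5)y^5\\ &- (1-x)^6(-224+345x+182x^2+336x^3+292x^4+75x^5+6x^6)y^6\\ &+ (1-x)^4(-64+265x+30x^2+128x^3-496x^4-267x^5+66x^6+2x^7)y^7\\ &- (1-x)^2(-8+89x-132x^2-634x^3-558x^4+593x^5-248x^6-64x^7+2x^8)y^8\\ &+ x(7-236x-476x^2+962x^3-388x^4-296x^5+248x^6-78x^7+x^8)y^9\\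 &+ x(13+188x+99x^2-288x^3+247x^4-84x^5+17x^6)y^{10}\\ &- x(11+58x-28x^2+6x^3+x^4)y^{11} - (-3+x)x(1+x)y^{12}. \end{aligned} $$ -/

import Mathlib

/-- The square lattice: vertex set `ℤ × ℤ`, edges between points at distance one. -/
def squareLattice : SimpleGraph (ℤ × ℤ) where
  Adj p q := (p.2 = q.2 ∧ |p.1 - q.1| = 1) ∨ (p.1 = q.1 ∧ |p.2 - q.2| = 1)
  symm := ⟨fun p q h => by
    rcases h with ⟨h1, h2⟩ | ⟨h1, h2⟩
    · exact Or.inl ⟨h1.symm, by rw [abs_sub_comm]; exact h2⟩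
    · exact Or.inr ⟨h1.symm, by rw [abs_sub_comm]; exact h2⟩⟩
  loopless := ⟨fun p h => by
    rcases h with ⟨_, h2⟩ | ⟨_, h2⟩ <;> simp at h2⟩

/-- Self-avoiding polygons, as subgraphs of the square lattice: those traced out by a closed walk
that is a cycle (no repeated vertex). The starting point and the orientation are forgotten. -/
def IsSelfAvoidingPolygon (P : squareLattice.Subgraph) : Prop :=
  ∃ (v : ℤ × ℤ) (c : squareLattice.Walk v v), c.IsCycle ∧ c.toSubgraph = P

/-- The minimum bounding rectangle of `P` is `[0, w] × [0, h]`. In particular `P` is translated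
so that the lower left corner of its bounding rectangle is the origin. -/
def HasBoundingRectangle (P : squareLattice.Subgraph) (w h : ℕ) : Prop :=
  (∀ p ∈ P.verts, 0 ≤ p.1 ∧ p.1 ≤ w ∧ 0 ≤ p.2 ∧ p.2 ≤ h) ∧
  (∃ p ∈ P.verts, p.1 = 0) ∧ (∃ p ∈ P.verts, p.1 = w) ∧
  (∃ p ∈ P.verts, p.2 = 0) ∧ (∃ p ∈ P.verts, p.2 = h)

/-- The number of horizontal unit steps of `P`, each named by its left endpoint. -/
noncomputable def horizontalPerimeter (P : squareLattice.Subgraph) : ℕ :=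
  {p : ℤ × ℤ | P.Adj p (p.1 + 1, p.2)}.ncard

/-- The number of vertical unit steps of `P`, each named by its lower endpoint. -/
noncomputable def verticalPerimeter (P : squareLattice.Subgraph) : ℕ :=
  {p : ℤ × ℤ | P.Adj p (p.1, p.2 + 1)}.ncard

/-- `t` is the height of the topmost horizontal step of `P` in the column between the
abscissae `i` and `i + 1`. -/
def IsTopHeight (P : squareLattice.Subgraph) (i t : ℤ) : Prop :=
  P.Adj (i, t) (i + 1, t) ∧ ∀ t' : ℤ, t < t' → ¬ P.Adj (i, t') (i + 1, t')

/-- The upper boundary of the polygon `P` of width `w` has two modes, at the columns `a` and `b`,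
which are separated by a single indent, with its base at the column `c`, of depth `m` (measured
from the lower one of the two modes); apart from it the boundary is unimodal. -/
def HasSingleTopIndent (m : ℕ) (P : squareLattice.Subgraph) (w : ℕ) : Prop :=
  ∃ t : ℤ → ℤ, (∀ i : ℤ, 0 ≤ i → i < w → IsTopHeight P i (t i)) ∧
    ∃ a c b : ℤ, 0 ≤ a ∧ a < c ∧ c < b ∧ b < w ∧
      MonotoneOn t (Set.Icc 0 a) ∧ AntitoneOn t (Set.Icc a c) ∧
      MonotoneOn t (Set.Icc c b) ∧ AntitoneOn t (Set.Icc b (w - 1)) ∧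
      min (t a) (t b) = t c + m

/-- Bimodal `m`-convex polygons (for `m ≥ 1`), up to translation: self-avoiding polygons whose
perimeter exceeds that of the minimum bounding rectangle by `2 * m`, where the excess comes from
a single vertical indent of depth `m` in the upper boundary. -/
def IsBimodalConvexPolygon (m : ℕ) (P : squareLattice.Subgraph) : Prop :=
  IsSelfAvoidingPolygon P ∧ ∃ w h : ℕ, HasBoundingRectangle P w h ∧
    P.edgeSet.ncard = 2 * (w + h) + 2 * m ∧ HasSingleTopIndent m P w

/-- The bimodal `m`-convex polygons with horizontal half-perimeter `i` and vertical
half-perimeter `j`. -/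
def bimodalConvexPolygons (m i j : ℕ) : Set squareLattice.Subgraph :=
  {P | IsBimodalConvexPolygon m P ∧ horizontalPerimeter P = 2 * i ∧ verticalPerimeter P = 2 * j}

/-- The generating function of bimodal `m`-convex polygons by horizontal half-perimeter
(variable `X 0`) and vertical half-perimeter (variable `X 1`). -/
noncomputable def bimodalGF (m : ℕ) : MvPowerSeries (Fin 2) ℚ :=
  fun n => ((bimodalConvexPolygons m (n 0) (n 1)).ncard : ℚ)

/-- `Δ = 1 - 2x - 2y - 2xy + x² + y²`. -/
def discr {R : Type*} [CommRing R] (x y : R) : R :=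
  1 - 2 * x - 2 * y - 2 * x * y + x ^ 2 + y ^ 2

/-- The first numerator polynomial. -/
def polyA {R : Type*} [CommRing R] (x y : R) : R :=
  -4 * (1 - x) ^ 11 + 2 * (1 - x) ^ 9 * (10 + 9 * x) * y
    - 2 * (1 - x) ^ 7 * (20 + 21 * x + 15 * x ^ 2) * y ^ 2
    + (1 - x) ^ 5 * (40 + 17 * x + 18 * x ^ 2 + 21 * x ^ 3) * y ^ 3
    - (1 - x) ^ 3 * (20 - 26 * x - 31 * x ^ 2 - 14 * x ^ 3 + 3 * x ^ 4) * y ^ 4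
    + (1 - x) * (2 + x) * (2 - 13 * x + 5 * x ^ 2 - 7 * x ^ 3 - 3 * x ^ 4) * y ^ 5
    + x * (4 - 11 * x - 3 * x ^ 2 - 5 * x ^ 3 - x ^ 4) * y ^ 6
    + x * (1 + x) ^ 2 * y ^ 7

/-- The second numerator polynomial. -/
def polyB {R : Type*} [CommRing R] (x y : R) : R :=
  8 * (1 - x) ^ 18 - 4 * (1 - x) ^ 16 * (16 + 11 * x) * y
    + 8 * (1 - x) ^ 14 * (28 + 29 * x + 12 * x ^ 2) * y ^ 2
    - 2 * (1 - x) ^ 12 * (224 + 233 * x + 158 * x ^ 2 + 51 * x ^ 3) * y ^ 3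
    + 2 * (1 - x) ^ 10 * (280 + 189 * x + 144 * x ^ 2 + 95 * x ^ 3 + 24 * x ^ 4) * y ^ 4
    - (1 - x) ^ 8 * (448 - 57 * x - 56 * x ^ 2 + 36 * x ^ 4 + x ^ 5) * y ^ 5
    - (1 - x) ^ 6 * (-224 + 345 * x + 182 * x ^ 2 + 336 * x ^ 3 + 292 * x ^ 4 + 75 * x ^ 5
        + 6 * x ^ 6) * y ^ 6
    + (1 - x) ^ 4 * (-64 + 265 * x + 30 * x ^ 2 + 128 * x ^ 3 - 496 * x ^ 4 - 267 * x ^ 5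
        + 66 * x ^ 6 + 2 * x ^ 7) * y ^ 7
    - (1 - x) ^ 2 * (-8 + 89 * x - 132 * x ^ 2 - 634 * x ^ 3 - 558 * x ^ 4 + 593 * x ^ 5
        - 248 * x ^ 6 - 64 * x ^ 7 + 2 * x ^ 8) * y ^ 8
    + x * (7 - 236 * x - 476 * x ^ 2 + 962 * x ^ 3 - 388 * x ^ 4 - 296 * x ^ 5 + 248 * x ^ 6
        - 78 * x ^ 7 + x ^ 8) * y ^ 9
    + x * (13 + 188 * x + 99 * x ^ 2 - 288 * x ^ 3 + 247 * x ^ 4 - 84 * x ^ 5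
        + 17 * x ^ 6) * y ^ 10
    - x * (11 + 58 * x - 28 * x ^ 2 + 6 * x ^ 3 + x ^ 4) * y ^ 11
    - (-3 + x) * x * (1 + x) * y ^ 12

/-! A bimodal polygon is cut into its vertical columns. The perimeter condition is tight: every
column strip contains at least two horizontal edges, every row at least two vertical ones, and each
of the two rows of the indent at least four, so all these bounds are equalities
(`ncard_column_and_verticalPerimeter`). Hence the polygon bounds a sequence of overlapping
intervals, the columns. The total variation that is left for the lower boundary is the least
possible, which makes it a valley. Conversely, the boundary of such a sequence is a cycle
(`isSelfAvoidingPolygon_boundary`). Thus `image_polygon_fiber` and `injOn_polygon` replace polygons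
by lists of columns.

If the right mode is at least as high as the left one, the upper boundary goes down by exactly two
after its first mode and then climbs by at least `r = 2`. If the left mode is strictly higher, the
mirror image has the same shape with `r = 3`. So only lists of the first kind have to be counted,
for both values of `r` (`gf_bimodal`).

The shape of each boundary is recognised by a small automaton, which reads unit steps. Let `n` be
the height of the current column. By translation invariance the generating function of the possible
continuations depends only on the two states and on `n`. A unit step that shortens the column
changes `n` to `n - 1` at no cost, one that lengthens it changes `n` to `n + 1` and costs `y`, and
passing to the next column costs `x`. This gives linear recurrences in `n`. The states only move on
along `rise`, `dip`, `climb r`, …, `climb 0`, `fall` and along `dec`, `inc`, so the recurrences are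
solved one state at a time.

The solutions are combinations of `(1 ± √x)⁻ⁿ`, and of `λ⁻ⁿ` and `(1 - x)⁻ⁿ` times polynomials in
`n`, where `λ = (1 + y - x + √Δ) / 2`. The other root `y / λ` does not occur, as in the kernel
method. In the proof the closed forms are given explicitly. The identities `coef…_eq` say that they
satisfy the recurrences, and `eq_of_forward`, `eq_of_backward₂` and their variants say that there is
only one solution with a common denominator: the difference of two solutions is divisible by every
power of `y`.

The wanted series is read off at height one, in the states `rise` and `dec` (`rise_dec`). There the
closed forms need corrections, because they are valid only for columns that are not too short.
`total_rat` and `total_irr` evaluate the result, separated into its rational part and its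
coefficient of `√Δ`. -/

/-! ### Automata for the two boundaries and lists of columns -/

/-- The upper boundary, read from left to right: before its first mode, one step below the level of
that mode, on the way up to a second mode which is at least `k` steps higher, or after it. -/
inductive Upper
  | rise
  | dip
  | climb (k : ℕ)
  | fall
  | dead

/-- The lower boundary, read from left to right: before or after its minimum. -/
inductive Lower
  | dec
  | inc
  | dead

namespace Upper

/-- The effect of a unit step up. -/
def up : Upper → Upper
  | rise => rise
  | dip => dead
  | climb k => climb (k - 1)
  | fall => dead
  | dead => dead

/-- The effect of a unit step down, if the second mode is to be `r` steps above the indent. -/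
def down (r : ℕ) : Upper → Upper
  | rise => dip
  | dip => climb r
  | climb 0 => fall
  | climb (_ + 1) => dead
  | fall => fall
  | dead => dead

/-- The states in which the upper boundary may end. -/
def Final : Upper → Prop
  | climb 0 => True
  | fall => True
  | _ => False

end Upper

namespace Lower

/-- The effect of a unit step up. -/
def up : Lower → Lower
  | dec => inc
  | inc => inc
  | dead => dead

/-- The effect of a unit step down. -/
def down : Lower → Lower
  | dec => dec
  | inc => dead
  | dead => dead

end Lower

/-- The effect of `d` unit steps up, or of `-d` unit steps down. -/
def moveBy {S : Type*} (u v : S → S) (s : S) (d : ℤ) : S :=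
  if 0 ≤ d then u^[d.toNat] s else v^[(-d).toNat] s

section moveBy

variable {S : Type*} {u v : S → S} {s : S} {d : ℤ}

@[simp] theorem moveBy_zero : moveBy u v s 0 = s := rfl

theorem moveBy_up (h : 0 < d) : moveBy u v s d = moveBy u v (u s) (d - 1) := by
  obtain ⟨k, rfl⟩ : ∃ k : ℕ, d = k + 1 := ⟨(d - 1).toNat, by omega⟩
  have h1 : ((k : ℤ) + 1).toNat = k + 1 := by omega
  simp only [moveBy, add_sub_cancel_right, h1]
  rw [if_pos (by omega), if_pos (by omega), Function.iterate_succ_apply, Int.toNat_natCast]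

theorem moveBy_down (h : d < 0) : moveBy u v s d = moveBy u v (v s) (d + 1) := by
  obtain ⟨k, rfl⟩ : ∃ k : ℕ, d = -(k + 1 : ℤ) := ⟨(-d - 1).toNat, by omega⟩
  have h1 : (-(-((k : ℤ) + 1))).toNat = k + 1 := by omega
  rw [moveBy, if_neg (by omega), h1, Function.iterate_succ_apply, moveBy]
  rcases k with _ | k
  · simp
  · rw [if_neg (by omega)]
    congr 2

theorem moveBy_fixed (hu : u s = s) (hv : v s = s) : moveBy u v s d = s := by
  rw [moveBy, Function.iterate_fixed hu, Function.iterate_fixed hv, ite_self]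

end moveBy

/-- The columns `L` (each given by the heights of its bottom and its top) continue a polygon whose
last column is `(b, t)`. -/
def Valid (r : ℕ) : Upper → Lower → ℤ → ℤ → List (ℤ × ℤ) → Prop
  | q, σ, _, _, [] => q.Final ∧ σ ≠ .dead
  | q, σ, b, t, c :: L => max b c.1 < min t c.2 ∧
      Valid r (moveBy Upper.up (Upper.down r) q (c.2 - t)) (moveBy Lower.up Lower.down σ (c.1 - b))
        c.1 c.2 L

/-- The number of unit steps that the upper boundary makes up and the lower boundary makes down. -/
def ups : ℤ → ℤ → List (ℤ × ℤ) → ℕ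
  | _, _, [] => 0
  | b, t, c :: L => (c.2 - t).toNat + (b - c.1).toNat + ups c.1 c.2 L

theorem not_valid_dead_top {r σ b t} {L : List (ℤ × ℤ)} : ¬ Valid r .dead σ b t L := by
  induction L generalizing σ b t with
  | nil => rintro ⟨h, -⟩; exact h
  | cons c L ih =>
    rintro ⟨-, h⟩
    rw [moveBy_fixed rfl rfl] at h
    exact ih h

theorem not_valid_dead_bottom {r q b t} {L : List (ℤ × ℤ)} : ¬ Valid r q .dead b t L := by
  induction L generalizing q b t with
  | nil => rintro ⟨-, h⟩; exact h rfl
  | cons c L ih =>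
    rintro ⟨-, h⟩
    rw [moveBy_fixed (s := Lower.dead) rfl rfl] at h
    exact ih h

/-! ### Reading one unit step of a boundary -/

/-- The valid non-empty lists of columns such that the step of the upper boundary at the first
column is in `cT`, and that of the lower boundary is in `cB`. -/
def steps (r : ℕ) (q : Upper) (σ : Lower) (b t : ℤ) (cT cB : Set ℤ) : Set (List (ℤ × ℤ))
  | [] => False
  | c :: L => c.2 - t ∈ cT ∧ c.1 - b ∈ cB ∧ Valid r q σ b t (c :: L)

section steps

variable {r : ℕ} {q : Upper} {σ : Lower} {b t : ℤ} {cT cB : Set ℤ}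

theorem cons_mem_steps {c : ℤ × ℤ} {L : List (ℤ × ℤ)} : c :: L ∈ steps r q σ b t cT cB ↔
    c.2 - t ∈ cT ∧ c.1 - b ∈ cB ∧ max b c.1 < min t c.2 ∧
      Valid r (moveBy Upper.up (Upper.down r) q (c.2 - t)) (moveBy Lower.up Lower.down σ (c.1 - b))
        c.1 c.2 L := Iff.rfl

theorem nil_notMem_steps : [] ∉ steps r q σ b t cT cB := id

theorem steps_congr {q' σ' b' t' cT' cB'}
    (h : ∀ c : ℤ × ℤ, (c.2 - t ∈ cT ∧ c.1 - b ∈ cB ∧ max b c.1 < min t c.2 ↔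
      c.2 - t' ∈ cT' ∧ c.1 - b' ∈ cB' ∧ max b' c.1 < min t' c.2))
    (hT : ∀ c : ℤ × ℤ, c.2 - t ∈ cT → moveBy Upper.up (Upper.down r) q (c.2 - t) =
      moveBy Upper.up (Upper.down r) q' (c.2 - t'))
    (hB : ∀ c : ℤ × ℤ, c.1 - b ∈ cB → moveBy Lower.up Lower.down σ (c.1 - b) =
      moveBy Lower.up Lower.down σ' (c.1 - b')) :
    steps r q σ b t cT cB = steps r q' σ' b' t' cT' cB' := by
  ext L
  rcases L with _ | ⟨c, L⟩
  · exact Iff.rfl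
  · rw [cons_mem_steps, cons_mem_steps]
    constructor
    · rintro ⟨h1, h2, h3, h4⟩
      obtain ⟨h5, h6, h7⟩ := (h c).1 ⟨h1, h2, h3⟩
      exact ⟨h5, h6, h7, by rw [← hT c h1, ← hB c h2]; exact h4⟩
    · rintro ⟨h1, h2, h3, h4⟩
      obtain ⟨h5, h6, h7⟩ := (h c).2 ⟨h1, h2, h3⟩
      exact ⟨h5, h6, h7, by rw [hT c h5, hB c h6]; exact h4⟩

/-- If the next top is below `t`, its overlap with the current column is the same for `t` and for `t
- 1`. So a unit step down can be carried out on the current column, which gets one cell shorter. -/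
theorem steps_top_down :
    steps r q σ b t (Set.Iio 0) cB = steps r (q.down r) σ b (t - 1) (Set.Iic 0) cB := by
  refine steps_congr (fun c => ?_) (fun c hc => ?_) (fun c _ => rfl)
  · simp only [Set.mem_Iio, Set.mem_Iic]
    constructor <;> rintro ⟨h1, h2, h3⟩ <;> exact ⟨by omega, h2, by omega⟩
  · rw [moveBy_down hc]
    congr 1
    ring

/-- Raising `t` weakens the overlap condition: a next column with its bottom at height `t` would
become admissible. Fixing the bottom step to `0` rules this out. -/
theorem steps_top_up (hbt : b < t) :
    steps r q σ b t (Set.Ioi 0) {0} = steps r q.up σ b (t + 1) (Set.Ici 0) {0} := by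
  refine steps_congr (fun c => ?_) (fun c hc => ?_) (fun c _ => rfl)
  · simp only [Set.mem_Ioi, Set.mem_Ici, Set.mem_singleton_iff]
    constructor <;> rintro ⟨h1, h2, h3⟩ <;> exact ⟨by omega, h2, by omega⟩
  · rw [moveBy_up hc]
    congr 1
    ring

theorem steps_bottom_up :
    steps r q σ b t cT (Set.Ioi 0) = steps r q σ.up (b + 1) t cT (Set.Ici 0) := by
  refine steps_congr (fun c => ?_) (fun c _ => rfl) (fun c hc => ?_)
  · simp only [Set.mem_Ioi, Set.mem_Ici]
    constructor <;> rintro ⟨h1, h2, h3⟩ <;> exact ⟨h1, by omega, by omega⟩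
  · rw [moveBy_up hc]
    congr 1
    ring

theorem steps_bottom_down (hT : cT ⊆ Set.Ici 0) (hbt : b < t) :
    steps r q σ b t cT (Set.Iio 0) = steps r q σ.down (b - 1) t cT (Set.Iic 0) := by
  refine steps_congr (fun c => ?_) (fun c _ => rfl) (fun c hc => ?_)
  · simp only [Set.mem_Iio, Set.mem_Iic]
    constructor <;> rintro ⟨h1, h2, h3⟩ <;> have := hT h1 <;> rw [Set.mem_Ici] at this <;>
      exact ⟨h1, by omega, by omega⟩
  · rw [moveBy_down hc]
    congr 1
    ring

end steps

/-! ### Generating functions of sets of lists by length and weight -/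

section gf

/-- The lists in `A` of length `i` and weight `j`. -/
def fiber (A : Set (List (ℤ × ℤ))) (wt : List (ℤ × ℤ) → ℕ) (i j : ℕ) : Set (List (ℤ × ℤ)) :=
  {L | L ∈ A ∧ L.length = i ∧ wt L = j}

/-- The generating function of the lists in `A` by length and weight. -/
noncomputable def gf (A : Set (List (ℤ × ℤ))) (wt : List (ℤ × ℤ) → ℕ) :
    MvPowerSeries (Fin 2) ℚ :=
  fun n => ((fiber A wt (n 0) (n 1)).ncard : ℚ)

variable {A B : Set (List (ℤ × ℤ))} {wt wt' : List (ℤ × ℤ) → ℕ}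

theorem coeff_gf (n : Fin 2 →₀ ℕ) :
    MvPowerSeries.coeff n (gf A wt) = ((fiber A wt (n 0) (n 1)).ncard : ℚ) := rfl

theorem fiber_congr (h : ∀ L ∈ A, wt L = wt' L) (i j : ℕ) : fiber A wt i j = fiber A wt' i j := by
  ext L
  constructor <;> rintro ⟨h1, h2, h3⟩ <;> exact ⟨h1, h2, by rw [← h3, h L h1]⟩

theorem gf_congr (h : ∀ L ∈ A, wt L = wt' L) : gf A wt = gf A wt' := by
  ext n
  rw [coeff_gf, coeff_gf, fiber_congr h]

theorem gf_empty : gf ∅ wt = 0 := by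
  ext n
  rw [coeff_gf, show fiber ∅ wt (n 0) (n 1) = ∅ from Set.eq_empty_of_forall_notMem fun L h => h.1]
  simp

theorem gf_union (hA : ∀ i j, (fiber A wt i j).Finite) (hB : ∀ i j, (fiber B wt i j).Finite)
    (h : Disjoint A B) : gf (A ∪ B) wt = gf A wt + gf B wt := by
  ext n
  rw [map_add, coeff_gf, coeff_gf, coeff_gf, ← Nat.cast_add,
    ← Set.ncard_union_eq (h.mono (fun L h => h.1) (fun L h => h.1)) (hA _ _) (hB _ _)]
  congr 2
  ext L
  simp only [fiber, Set.mem_union, Set.mem_ofPred_eq]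
  tauto

theorem fiber_image {f : List (ℤ × ℤ) → List (ℤ × ℤ)}
    (hl : ∀ L, (f L).length = L.length) (hw : ∀ L ∈ A, wt (f L) = wt' L) (i j : ℕ) :
    fiber (f '' A) wt i j = f '' fiber A wt' i j := by
  ext L
  constructor
  · rintro ⟨⟨L, h1, rfl⟩, h2, h3⟩
    exact ⟨L, ⟨h1, by rw [← hl, h2], by rw [← hw L h1, h3]⟩, rfl⟩
  · rintro ⟨L, ⟨h1, h2, h3⟩, rfl⟩
    exact ⟨⟨L, h1, rfl⟩, by rw [hl, h2], by rw [hw L h1, h3]⟩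

theorem gf_image {f : List (ℤ × ℤ) → List (ℤ × ℤ)} (hf : Set.InjOn f A)
    (hl : ∀ L, (f L).length = L.length) (hw : ∀ L ∈ A, wt (f L) = wt' L) :
    gf (f '' A) wt = gf A wt' := by
  ext n
  rw [coeff_gf, coeff_gf, fiber_image hl hw,
    Set.InjOn.ncard_image (hf.mono fun L h => h.1)]

theorem coeff_X_mul_of_lt (s : Fin 2) (n : Fin 2 →₀ ℕ) (hn : 0 < n s)
    (f : MvPowerSeries (Fin 2) ℚ) : MvPowerSeries.coeff n (MvPowerSeries.X s * f) =
      MvPowerSeries.coeff (n - Finsupp.single s 1) f := by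
  rw [MvPowerSeries.X, MvPowerSeries.coeff_monomial_mul, if_pos, one_mul]
  rw [Finsupp.single_le_iff]
  omega

theorem coeff_X_mul_of_eq (s : Fin 2) (n : Fin 2 →₀ ℕ) (hn : n s = 0)
    (f : MvPowerSeries (Fin 2) ℚ) : MvPowerSeries.coeff n (MvPowerSeries.X s * f) = 0 := by
  rw [MvPowerSeries.X, MvPowerSeries.coeff_monomial_mul, if_neg]
  rw [Finsupp.single_le_iff]
  omega

theorem gf_add_one (h : ∀ L ∈ A, wt L = wt' L + 1) : gf A wt = MvPowerSeries.X 1 * gf A wt' := by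
  ext n
  rcases Nat.eq_zero_or_pos (n 1) with hn | hn
  · rw [coeff_X_mul_of_eq _ _ hn, coeff_gf, hn,
      show fiber A wt (n 0) 0 = ∅ from Set.eq_empty_of_forall_notMem fun L ⟨h1, _, h3⟩ => by
        rw [h L h1] at h3; omega]
    simp
  · rw [coeff_X_mul_of_lt _ _ hn, coeff_gf, coeff_gf]
    congr 2
    ext L
    simp only [fiber, Set.mem_ofPred_eq, Finsupp.tsub_apply]
    rw [Finsupp.single_eq_same, Finsupp.single_eq_of_ne (by decide), Nat.sub_zero]
    refine and_congr_right fun h1 => and_congr_right fun _ => ?_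
    rw [h L h1]
    omega

theorem gf_cons {c : ℤ × ℤ} (h : ∀ L ∈ A, wt (c :: L) = wt' L) :
    gf (List.cons c '' A) wt = MvPowerSeries.X 0 * gf A wt' := by
  ext n
  rcases Nat.eq_zero_or_pos (n 0) with hn | hn
  · rw [coeff_X_mul_of_eq _ _ hn, coeff_gf, hn,
      show fiber (List.cons c '' A) wt 0 (n 1) = ∅ from
        Set.eq_empty_of_forall_notMem fun L ⟨⟨L', _, h1⟩, h2, _⟩ => by simp [← h1] at h2]
    simp
  · rw [coeff_X_mul_of_lt _ _ hn, coeff_gf, coeff_gf,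
      ← Set.ncard_image_of_injective (fiber A wt' _ _) (List.cons_injective (a := c))]
    congr 2
    ext L
    simp only [fiber, Set.mem_ofPred_eq, Finsupp.tsub_apply]
    rw [Finsupp.single_eq_same, Finsupp.single_eq_of_ne (by decide), Nat.sub_zero]
    constructor
    · rintro ⟨⟨L, h1, rfl⟩, h2, h3⟩
      rw [List.length_cons] at h2
      exact ⟨L, ⟨h1, by omega, by rw [← h L h1, h3]⟩, rfl⟩
    · rintro ⟨L, ⟨h1, h2, h3⟩, rfl⟩
      exact ⟨⟨L, h1, rfl⟩, by rw [List.length_cons]; omega, by rw [h L h1, h3]⟩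

end gf

/-! ### Finiteness and translation invariance -/

/-- The weight bounds how far the top goes up and the bottom goes down, and the overlap bounds the
opposite movements. So the next column lies in a finite box. -/
theorem finite_fiber_valid (r : ℕ) (i j : ℕ) (q : Upper) (σ : Lower) (b t : ℤ) :
    (fiber {L | Valid r q σ b t L} (ups b t) i j).Finite := by
  induction i generalizing j q σ b t with
  | zero =>
    refine (Set.finite_singleton []).subset fun L h => ?_
    exact List.length_eq_zero_iff.1 h.2.1
  | succ i ih =>
    have hfin : (⋃ c ∈ Set.Icc (b - j) t ×ˢ Set.Icc b (t + j), ⋃ k ∈ Set.Iic j,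
        List.cons c '' fiber {L | Valid r (moveBy Upper.up (Upper.down r) q (c.2 - t))
          (moveBy Lower.up Lower.down σ (c.1 - b)) c.1 c.2 L} (ups c.1 c.2) i k).Finite :=
      ((Set.finite_Icc _ _).prod (Set.finite_Icc _ _)).biUnion fun c _ =>
        (Set.finite_Iic j).biUnion fun k _ => (ih k _ _ _ _).image _
    refine hfin.subset ?_
    rintro L ⟨h1, h2, h3⟩
    rcases L with _ | ⟨c, L⟩
    · simp at h2
    · have h4 := h1.1
      simp only [ups] at h3
      simp only [Set.mem_iUnion]
      refine ⟨c, ⟨⟨?_, ?_⟩, ?_, ?_⟩, ups c.1 c.2 L, ?_, L, ⟨h1.2, ?_, rfl⟩, rfl⟩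
      · omega
      · omega
      · omega
      · omega
      · simp only [Set.mem_Iic]; omega
      · simpa using h2

theorem steps_subset {r q σ b t cT cB} : steps r q σ b t cT cB ⊆ {L | Valid r q σ b t L} := by
  rintro (_ | ⟨c, L⟩) h
  · exact h.elim
  · exact h.2.2

theorem finite_fiber_steps (r q σ b t cT cB) (i j : ℕ) :
    (fiber (steps r q σ b t cT cB) (ups b t) i j).Finite :=
  (finite_fiber_valid r i j q σ b t).subset fun _ h => ⟨steps_subset h.1, h.2⟩

/-- The translation of a list of columns by `k` upwards. -/
def shift (k : ℤ) (L : List (ℤ × ℤ)) : List (ℤ × ℤ) := L.map fun c => (c.1 + k, c.2 + k)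

theorem shift_injective (k : ℤ) : (shift k).Injective :=
  List.map_injective_iff.2 fun c d h => by
    simp only [Prod.mk.injEq, add_left_inj] at h
    exact Prod.ext h.1 h.2

theorem shift_shift (k l : ℤ) (L : List (ℤ × ℤ)) : shift k (shift l L) = shift (l + k) L := by
  simp [shift, add_assoc]

theorem shift_zero (L : List (ℤ × ℤ)) : shift 0 L = L := by
  simp [shift]

theorem valid_shift {r q σ b t} (k : ℤ) (L : List (ℤ × ℤ)) :
    Valid r q σ (b + k) (t + k) (shift k L) ↔ Valid r q σ b t L := by
  induction L generalizing q σ b t with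
  | nil => exact Iff.rfl
  | cons c L ih =>
    simp only [shift, List.map_cons, Valid] at ih ⊢
    rw [ih, add_sub_add_right_eq_sub, add_sub_add_right_eq_sub]
    refine and_congr_left' ?_
    rw [max_add_add_right, min_add_add_right, add_lt_add_iff_right]

theorem ups_shift {b t} (k : ℤ) (L : List (ℤ × ℤ)) :
    ups (b + k) (t + k) (shift k L) = ups b t L := by
  induction L generalizing b t with
  | nil => rfl
  | cons c L ih =>
    simp only [shift, List.map_cons, ups] at ih ⊢
    rw [ih, add_sub_add_right_eq_sub, add_sub_add_right_eq_sub]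

theorem steps_shift {r q σ b t cT cB} (k : ℤ) :
    steps r q σ (b + k) (t + k) cT cB = shift k '' steps r q σ b t cT cB := by
  ext L
  constructor
  · intro h
    refine ⟨shift (-k) L, ?_, by rw [shift_shift]; simp [shift_zero]⟩
    rcases L with _ | ⟨c, L⟩
    · exact h.elim
    · refine ⟨?_, ?_, ?_⟩
      · rw [show c.2 + -k - t = c.2 - (t + k) by ring]
        exact h.1
      · rw [show c.1 + -k - b = c.1 - (b + k) by ring]
        exact h.2.1
      · have := (valid_shift (-k) (c :: L)).2 h.2.2
        simpa [shift] using this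
  · rintro ⟨L, h, rfl⟩
    rcases L with _ | ⟨c, L⟩
    · exact h.elim
    · refine ⟨?_, ?_, (valid_shift k (c :: L)).2 h.2.2⟩
      · simpa using h.1
      · simpa using h.2.1

/-! ### The height of the current column as a parameter -/

/-- The generating function of the valid lists that follow a column of height `n`. -/
noncomputable def contGF (r : ℕ) (q : Upper) (σ : Lower) (n : ℕ) : MvPowerSeries (Fin 2) ℚ :=
  gf {L | Valid r q σ 0 n L} (ups 0 n)

/-- The generating function of the non-empty valid lists that follow a column of height `n`, with
the first steps of the boundaries in `cT` and `cB`. -/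
noncomputable def stepGF (r : ℕ) (q : Upper) (σ : Lower) (cT cB : Set ℤ) (n : ℕ) :
    MvPowerSeries (Fin 2) ℚ :=
  gf (steps r q σ 0 n cT cB) (ups 0 n)

/-- By translation only the difference of `t` and `b` matters, which leaves a single integer
parameter. -/
theorem gf_steps {r q σ} {b t : ℤ} {cT cB} (n : ℕ) (h : t = b + n) :
    gf (steps r q σ b t cT cB) (ups b t) = stepGF r q σ cT cB n := by
  obtain rfl : t = n + b := by rw [h]; ring
  have h1 := steps_shift (r := r) (q := q) (σ := σ) (b := 0) (t := n) (cT := cT) (cB := cB) b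
  have h2 := ups_shift (b := 0) (t := n) b
  rw [zero_add] at h1
  rw [stepGF, h1, gf_image (shift_injective b).injOn (fun L => by simp [shift])
    (wt' := ups 0 n) (fun L _ => by simpa using h2 L)]

section stepGF

variable {r : ℕ} {q : Upper} {σ : Lower} {cT cB : Set ℤ} {n : ℕ}

/-- Nothing overlaps an empty column. This is the initial value for the recurrences that shorten the
column. -/
theorem stepGF_zero : stepGF r q σ cT cB 0 = 0 := by
  rw [stepGF, show steps r q σ 0 (0 : ℕ) cT cB = ∅ from Set.eq_empty_of_forall_notMem ?_, gf_empty]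
  rintro (_ | ⟨c, L⟩) h
  · exact h
  · have := h.2.2.1
    omega

theorem stepGF_dead_top : stepGF r .dead σ cT cB n = 0 := by
  rw [stepGF, ← gf_empty]
  congr 1
  exact Set.eq_empty_of_forall_notMem fun L h => not_valid_dead_top (steps_subset h)

theorem stepGF_dead_bottom : stepGF r q .dead cT cB n = 0 := by
  rw [stepGF, ← gf_empty]
  congr 1
  exact Set.eq_empty_of_forall_notMem fun L h => not_valid_dead_bottom (steps_subset h)

theorem stepGF_union_top {cT' : Set ℤ} (h : Disjoint cT cT') :
    stepGF r q σ (cT ∪ cT') cB n = stepGF r q σ cT cB n + stepGF r q σ cT' cB n := by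
  rw [stepGF, stepGF, stepGF, ← gf_union (finite_fiber_steps _ _ _ _ _ _ _)
    (finite_fiber_steps _ _ _ _ _ _ _)]
  · congr 1
    ext (_ | ⟨c, L⟩)
    · simp [nil_notMem_steps]
    · simp only [Set.mem_union, cons_mem_steps]
      tauto
  · rw [Set.disjoint_left]
    rintro (_ | ⟨c, L⟩) h1 h2
    · exact h1
    · exact Set.disjoint_left.1 h h1.1 h2.1

theorem stepGF_union_bottom {cB' : Set ℤ} (h : Disjoint cB cB') :
    stepGF r q σ cT (cB ∪ cB') n = stepGF r q σ cT cB n + stepGF r q σ cT cB' n := by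
  rw [stepGF, stepGF, stepGF, ← gf_union (finite_fiber_steps _ _ _ _ _ _ _)
    (finite_fiber_steps _ _ _ _ _ _ _)]
  · congr 1
    ext (_ | ⟨c, L⟩)
    · simp [nil_notMem_steps]
    · simp only [Set.mem_union, cons_mem_steps]
      tauto
  · rw [Set.disjoint_left]
    rintro (_ | ⟨c, L⟩) h1 h2
    · exact h1
    · exact Set.disjoint_left.1 h h1.2.1 h2.2.1

/-- Only upward steps of the top and downward steps of the bottom carry weight. So shortening the
column is free, and lengthening it costs a factor `X 1`. -/
theorem stepGF_top_down : stepGF r q σ (Set.Iio 0) cB (n + 1) =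
    stepGF r (q.down r) σ (Set.Iic 0) cB n := by
  rw [← gf_steps (b := 0) (t := ((n + 1 : ℕ) : ℤ) - 1) n (by push_cast; ring), stepGF,
    steps_top_down]
  refine gf_congr ?_
  rintro (_ | ⟨c, L⟩) h
  · exact h.elim
  · have := h.1
    simp only [Set.mem_Iic] at this
    simp only [ups]
    omega

theorem stepGF_top_up : stepGF r q σ (Set.Ioi 0) {0} (n + 1) =
    MvPowerSeries.X 1 * stepGF r q.up σ (Set.Ici 0) {0} (n + 2) := by
  rw [← gf_steps (b := 0) (t := ((n + 1 : ℕ) : ℤ) + 1) (n + 2) (by push_cast; ring), stepGF,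
    steps_top_up (by omega)]
  refine gf_add_one ?_
  rintro (_ | ⟨c, L⟩) h
  · exact h.elim
  · have := h.1
    simp only [Set.mem_Ici] at this
    simp only [ups]
    omega

theorem stepGF_bottom_up : stepGF r q σ cT (Set.Ioi 0) (n + 1) =
    stepGF r q σ.up cT (Set.Ici 0) n := by
  rw [← gf_steps (b := 0 + 1) (t := ((n + 1 : ℕ) : ℤ)) n (by push_cast; ring), stepGF,
    steps_bottom_up]
  refine gf_congr ?_
  rintro (_ | ⟨c, L⟩) h
  · exact h.elim
  · have := h.2.1
    simp only [Set.mem_Ici] at this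
    simp only [ups]
    omega

theorem stepGF_bottom_down (hT : cT ⊆ Set.Ici 0) : stepGF r q σ cT (Set.Iio 0) (n + 1) =
    MvPowerSeries.X 1 * stepGF r q σ.down cT (Set.Iic 0) (n + 2) := by
  rw [← gf_steps (b := 0 - 1) (t := ((n + 1 : ℕ) : ℤ)) (n + 2) (by push_cast; ring), stepGF,
    steps_bottom_down hT (by omega)]
  refine gf_add_one ?_
  rintro (_ | ⟨c, L⟩) h
  · exact h.elim
  · have := h.2.1
    simp only [Set.mem_Iic] at this
    simp only [ups]
    omega

/-- When no step is left to be read, the next column is the current one. It is put into the list,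
which costs `X 0`, and the states do not change. -/
theorem stepGF_stay : stepGF r q σ {0} {0} (n + 1) =
    MvPowerSeries.X 0 * contGF r q σ (n + 1) := by
  rw [stepGF, show steps r q σ 0 ((n + 1 : ℕ) : ℤ) {0} {0} = List.cons (0, ((n + 1 : ℕ) : ℤ)) ''
    {L | Valid r q σ 0 ((n + 1 : ℕ) : ℤ) L} from ?_, gf_cons (fun L _ => ?_), contGF]
  · simp [ups]
  · ext (_ | ⟨c, L⟩)
    · simp [nil_notMem_steps]
    · rw [cons_mem_steps]
      simp only [Set.mem_singleton_iff, Set.mem_image, List.cons.injEq, Set.mem_ofPred_eq]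
      constructor
      · rintro ⟨h1, h2, -, h3⟩
        rw [h1, h2, moveBy_zero, moveBy_zero] at h3
        obtain ⟨c1, c2⟩ := c
        obtain rfl : c1 = 0 := by simpa using h2
        obtain rfl : c2 = ((n + 1 : ℕ) : ℤ) := by simp only at h1; omega
        exact ⟨L, h3, rfl, rfl⟩
      · rintro ⟨L, h3, rfl, rfl⟩
        simp only [sub_self, moveBy_zero, true_and]
        exact ⟨by omega, h3⟩

-- The empty continuation is allowed exactly if both automata may stop.
open Classical in
theorem contGF_eq : contGF r q σ n = (if q.Final ∧ σ ≠ .dead then 1 else 0) +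
    stepGF r q σ Set.univ Set.univ n := by
  have h1 : {L | Valid r q σ 0 n L} = {L | L = [] ∧ q.Final ∧ σ ≠ .dead} ∪
      steps r q σ 0 n Set.univ Set.univ := by
    ext (_ | ⟨c, L⟩)
    · simp [Valid, nil_notMem_steps]
    · simp [Valid, cons_mem_steps]
  rw [contGF, h1, gf_union]
  · rw [stepGF]
    congr 1
    split_ifs with h
    · ext m
      rw [coeff_gf, MvPowerSeries.coeff_one]
      split_ifs with hm
      · subst hm
        rw [show fiber _ _ _ _ = {[]} from ?_]
        · simp
        · ext L
          simp only [fiber, h, Set.mem_ofPred_eq, Set.mem_singleton_iff]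
          constructor
          · exact fun h => h.1.1
          · rintro rfl
            simp [ups, h.2]
      · rw [show fiber _ _ _ _ = ∅ from ?_]
        · simp
        · refine Set.eq_empty_of_forall_notMem ?_
          rintro L ⟨⟨rfl, -⟩, h2, h3⟩
          refine hm (Finsupp.ext fun i => ?_)
          fin_cases i
          · exact h2.symm
          · exact h3.symm
    · rw [← gf_empty (wt := ups 0 n)]
      congr 1
      exact Set.eq_empty_of_forall_notMem fun L hL => h hL.2
  · exact fun i j => (Set.finite_singleton []).subset fun L h => h.1.1
  · exact finite_fiber_steps _ _ _ _ _ _ _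
  · rw [Set.disjoint_left]
    rintro L ⟨rfl, -⟩ h
    exact h

end stepGF

/-! ### Recurrences in the height of the column -/

section recurrences

open MvPowerSeries (X)

variable {r : ℕ} {q : Upper} {σ : Lower} {cT cB : Set ℤ} {n : ℕ}

theorem stepGF_bottom_nonneg : stepGF r q σ cT (Set.Ici 0) (n + 1) =
    stepGF r q σ.up cT (Set.Ici 0) n + stepGF r q σ cT {0} (n + 1) := by
  rw [← stepGF_bottom_up, ← stepGF_union_bottom (by simp), Set.Ioi_union_left]

theorem stepGF_bottom_nonpos (hT : cT ⊆ Set.Ici 0) : stepGF r q σ cT (Set.Iic 0) (n + 1) =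
    X 1 * stepGF r q σ.down cT (Set.Iic 0) (n + 2) + stepGF r q σ cT {0} (n + 1) := by
  rw [← stepGF_bottom_down hT, ← stepGF_union_bottom (by simp), Set.Iio_union_right]

theorem stepGF_bottom_univ (hT : cT ⊆ Set.Ici 0) : stepGF r q σ cT Set.univ (n + 1) =
    stepGF r q σ.up cT (Set.Ici 0) n + X 1 * stepGF r q σ.down cT (Set.Iic 0) (n + 2) +
      stepGF r q σ cT {0} (n + 1) := by
  rw [← stepGF_bottom_up, ← stepGF_bottom_down hT, ← stepGF_union_bottom, ← stepGF_union_bottom]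
  · congr 1
    ext d
    simp only [Set.mem_univ, Set.mem_union, Set.mem_Ioi, Set.mem_Iio, Set.mem_singleton_iff,
      true_iff]
    omega
  · simp
  · rw [Set.disjoint_left]
    intro d h1 h2
    rw [Set.mem_Ioi] at h1
    rw [Set.mem_Iio] at h2
    omega

theorem stepGF_top_nonpos : stepGF r q σ (Set.Iic 0) cB (n + 1) =
    stepGF r (q.down r) σ (Set.Iic 0) cB n + stepGF r q σ {0} cB (n + 1) := by
  rw [← stepGF_top_down, ← stepGF_union_top (by simp), Set.Iio_union_right]

/-- The unit steps are read in the order top down, bottom, top up: `stepGF_bottom_down` needs that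
the top does not fall any more, and `stepGF_top_up` needs that the bottom is at rest. -/
theorem stepGF_top_univ : stepGF r q σ Set.univ cB (n + 1) =
    stepGF r (q.down r) σ (Set.Iic 0) cB n + stepGF r q σ (Set.Ici 0) cB (n + 1) := by
  rw [← stepGF_top_down, ← stepGF_union_top (by simp), Set.Iio_union_Ici]

theorem stepGF_top_nonneg : stepGF r q σ (Set.Ici 0) {0} (n + 1) =
    X 1 * stepGF r q.up σ (Set.Ici 0) {0} (n + 2) + X 0 * contGF r q σ (n + 1) := by
  rw [← stepGF_top_up, ← stepGF_stay, ← stepGF_union_top (by simp), Set.Ioi_union_left]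

/-- A top that must not rise can only stay. This concerns the states `dip` and `fall`. -/
theorem stepGF_of_up_dead (h : q.up = .dead) : stepGF r q σ (Set.Ici 0) cB n =
    stepGF r q σ {0} cB n := by
  rw [← Set.Ioi_union_left, stepGF_union_top (by simp), add_eq_right, stepGF, ← gf_empty]
  congr 1
  refine Set.eq_empty_of_forall_notMem ?_
  rintro (_ | ⟨c, L⟩) hL
  · exact hL
  · have h1 := hL.1
    rw [cons_mem_steps, moveBy_up h1, h, moveBy_fixed rfl rfl] at hL
    exact not_valid_dead_top hL.2.2.2

theorem zero_subset : ({0} : Set ℤ) ⊆ Set.Ici 0 := by simp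

theorem contGF_succ_of_not_final (h : ¬ q.Final) : contGF r q σ (n + 1) =
    stepGF r (q.down r) σ (Set.Iic 0) Set.univ n + stepGF r q σ (Set.Ici 0) Set.univ (n + 1) := by
  rw [contGF_eq, if_neg (fun h' => h h'.1), zero_add, stepGF_top_univ]

theorem contGF_succ_of_final (h : q.Final) (hσ : σ ≠ .dead) : contGF r q σ (n + 1) =
    1 + stepGF r (q.down r) σ (Set.Iic 0) Set.univ n +
      stepGF r q σ (Set.Ici 0) Set.univ (n + 1) := by
  rw [contGF_eq, if_pos ⟨h, hσ⟩, stepGF_top_univ, add_assoc]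

end recurrences

/-! ### Coefficient vectors with respect to the basis sequences -/

/-- `D = Δ(x, y)` has the square root `s`, and the denominators that occur below do not vanish. -/
structure SqrtDiscr {K : Type*} [Field K] (x y s D : K) : Prop where
  discr_eq : D = discr x y
  sq_eq : s ^ 2 = D
  y_ne : y ≠ 0
  discr_ne : D ≠ 0
  one_sub_x : 1 - x ≠ 0
  sq_sub_y : (1 - x) ^ 2 - y ≠ 0

/-- Coefficient vectors of linear combinations of seven basis sequences: the rational part `p` and
the irrational part `q` of `(1 - √x)⁻ⁿ`, and `λ⁻ⁿ` and `(1 - x)⁻ⁿ` times polynomials, where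
`λ = (1 + y - x + s) / 2`. The coefficients of the latter are `l₀ + m₀ * s`, `l₁ + m₁ * s`, and
`j₀ + k₀ * s`, `j₁`, `j₂`. -/
@[ext]
structure Coef (K : Type*) where
  p : K
  q : K
  l₀ : K
  m₀ : K
  l₁ : K
  m₁ : K
  j₀ : K
  k₀ : K
  j₁ : K
  j₂ : K

namespace Coef

variable {K : Type*} [Field K]

instance : Add (Coef K) :=
  ⟨fun c d => ⟨c.p + d.p, c.q + d.q, c.l₀ + d.l₀, c.m₀ + d.m₀, c.l₁ + d.l₁, c.m₁ + d.m₁,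
    c.j₀ + d.j₀, c.k₀ + d.k₀, c.j₁ + d.j₁, c.j₂ + d.j₂⟩⟩

instance : Sub (Coef K) :=
  ⟨fun c d => ⟨c.p - d.p, c.q - d.q, c.l₀ - d.l₀, c.m₀ - d.m₀, c.l₁ - d.l₁, c.m₁ - d.m₁,
    c.j₀ - d.j₀, c.k₀ - d.k₀, c.j₁ - d.j₁, c.j₂ - d.j₂⟩⟩

instance : SMul K (Coef K) :=
  ⟨fun r c => ⟨r * c.p, r * c.q, r * c.l₀, r * c.m₀, r * c.l₁, r * c.m₁, r * c.j₀, r * c.k₀,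
    r * c.j₁, r * c.j₂⟩⟩

theorem add_def (c d : Coef K) : c + d = ⟨c.p + d.p, c.q + d.q, c.l₀ + d.l₀, c.m₀ + d.m₀,
    c.l₁ + d.l₁, c.m₁ + d.m₁, c.j₀ + d.j₀, c.k₀ + d.k₀, c.j₁ + d.j₁, c.j₂ + d.j₂⟩ := rfl

theorem sub_def (c d : Coef K) : c - d = ⟨c.p - d.p, c.q - d.q, c.l₀ - d.l₀, c.m₀ - d.m₀,
    c.l₁ - d.l₁, c.m₁ - d.m₁, c.j₀ - d.j₀, c.k₀ - d.k₀, c.j₁ - d.j₁, c.j₂ - d.j₂⟩ := rfl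

theorem smul_def (r : K) (c : Coef K) : r • c = ⟨r * c.p, r * c.q, r * c.l₀, r * c.m₀,
    r * c.l₁, r * c.m₁, r * c.j₀, r * c.k₀, r * c.j₁, r * c.j₂⟩ := rfl

/-- The effect of the shift `n ↦ n - 1` on coefficient vectors. -/
def back (x y D : K) (c : Coef K) : Coef K where
  p := c.p - x * c.q
  q := c.q - c.p
  l₀ := ((1 + y - x) * (c.l₀ - c.l₁) + D * (c.m₀ - c.m₁)) / 2
  m₀ := ((1 + y - x) * (c.m₀ - c.m₁) + (c.l₀ - c.l₁)) / 2
  l₁ := ((1 + y - x) * c.l₁ + D * c.m₁) / 2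
  m₁ := ((1 + y - x) * c.m₁ + c.l₁) / 2
  j₀ := (1 - x) * (c.j₀ - c.j₁)
  k₀ := (1 - x) * c.k₀
  j₁ := (1 - x) * (c.j₁ - c.j₂)
  j₂ := (1 - x) * c.j₂

/-- The coefficients of the rational part of `(1 - √x)⁻ⁿ`. -/
def ratl : Coef K := ⟨1, 0, 0, 0, 0, 0, 0, 0, 0, 0⟩

/-- The coefficients of the irrational part of `(1 - √x)⁻ⁿ`. -/
def irratl : Coef K := ⟨0, 1, 0, 0, 0, 0, 0, 0, 0, 0⟩

/-- The rational part of the value at `0` of a linear combination of the basis sequences. -/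
def zeroRat (c : Coef K) : K := c.p + c.l₀ + c.l₁ + c.j₀ + c.j₁ + c.j₂

/-- The coefficient of `s` in the value at `0` of a linear combination of the basis sequences. -/
def zeroIrr (c : Coef K) : K := c.m₀ + c.m₁ + c.k₀

end Coef

/-! ### The coefficient vectors of the closed forms -/

section
variable {K : Type*} [Field K]

/-- Numerator of the coefficient `p` of `coefFall`. -/
def numFallP (x y : K) : K :=
  1 + y * (-2 + y) + x * (-2 + x)

/-- Top falling, bottom falling. -/
def coefFall (x y D : K) : Coef K where
  p := numFallP x y / D
  q := y * (1 - y + x) / D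
  l₀ := (-2) * x * y / D
  m₀ := 0
  l₁ := 0
  m₁ := 0
  j₀ := 0
  k₀ := 0
  j₁ := 0
  j₂ := 0

/-- Numerator of the coefficient `p` of `coefFallDown`. -/
def numFallDownP (x y : K) : K :=
  1 - y + x * (-2 - y + x)

/-- Top falling, the bottom moves down or stays. -/
def coefFallDown (x y D : K) : Coef K where
  p := x * numFallDownP x y / D
  q := 2 * x * y / D
  l₀ := x * y * (-1 + y - x) / D
  m₀ := x * y / D
  l₁ := 0
  m₁ := 0
  j₀ := 0
  k₀ := 0
  j₁ := 0
  j₂ := 0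

/-- Top free to climb or fall, bottom rising, top does not move down. -/
def coefRise0 (x y D : K) : Coef K where
  p := 2 * x * y / D
  q := numFallDownP x y / D
  l₀ := (-2) * x * y / D
  m₀ := 0
  l₁ := 0
  m₁ := 0
  j₀ := 0
  k₀ := 0
  j₁ := 0
  j₂ := 0

/-- Top free to climb or fall, bottom rising, only the top moves, and not down. -/
def coefRise0Stay (x y D : K) : Coef K where
  p := x * numFallDownP x y / D
  q := 2 * x * y / D
  l₀ := x * y * (-1 + y - x) / D
  m₀ := x * y / D
  l₁ := 0
  m₁ := 0
  j₀ := 0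
  k₀ := 0
  j₁ := 0
  j₂ := 0

/-- Numerator of the coefficient `p` of `coefClimb0`. -/
def numClimb0P (x y : K) : K :=
  1 + y * (-4 + y * (6 + y * (-4 + y))) + x * (-4 + y * (8 + y * (-3 + y * (-2 + y))) + x * (6 +
    y * (-4 + y * (4 - 2 * y)) + x * (-4 + y * y + x)))

/-- Numerator of the coefficient `q` of `coefClimb0`. -/
def numClimb0Q (x y : K) : K :=
  1 + y * (-3 + y * (3 - y)) + x * (-1 + y * y + x * (-1 - y + x))

/-- Top free to climb or fall, bottom falling. -/
def coefClimb0 (x y D : K) : Coef K where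
  p := numClimb0P x y / D ^ 2
  q := 2 * y * numClimb0Q x y / D ^ 2
  l₀ := (-2) * x * y / D
  m₀ := 2 * x * y * (-1 + y + x) / D ^ 2
  l₁ := 0
  m₁ := 0
  j₀ := 0
  k₀ := 0
  j₁ := 0
  j₂ := 0

/-- Numerator of the coefficient `p` of `coefClimb0Down`. -/
def numClimb0DownP (x y : K) : K :=
  1 + y * (-2 + y) + x * (-4 + y * (2 + 6 * y) + x * (6 + y * (2 + y) + x * (-4 - 2 * y + x)))

/-- Numerator of the coefficient `m₀` of `coefClimb0Down`. -/
def numClimb0DownM₀ (x y : K) : K :=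
  y * (-1 + y) + x * (-1 - 2 * y + x)

/-- The same, top does not move down, bottom does not move up. -/
def coefClimb0Down (x y D : K) : Coef K where
  p := x * numClimb0DownP x y / D ^ 2
  q := 4 * x * y * numFallDownP x y / D ^ 2
  l₀ := 2 * x * y * (y - x) / D
  m₀ := 2 * x * y * numClimb0DownM₀ x y / D ^ 2
  l₁ := 0
  m₁ := 0
  j₀ := 0
  k₀ := 0
  j₁ := 0
  j₂ := 0

/-- Numerator of the coefficient `p` of `coefClimb0Stay`. -/
def numClimb0StayP (x y : K) : K :=
  1 + y * (-3 + y * (3 - y)) + x * (-4 + y * (5 + y * (2 - 3 * y)) + x * (6 + y * (-1 + 3 * y) +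
    x * (-4 - y + x)))

/-- Numerator of the coefficient `q` of `coefClimb0Stay`. -/
def numClimb0StayQ (x y : K) : K :=
  3 + y * (-6 + 3 * y) + x * (-5 + y * y + x * (1 - 2 * y + x))

/-- The same, only the top moves, and not down. -/
def coefClimb0Stay (x y D : K) : Coef K where
  p := x * numClimb0StayP x y / D ^ 2
  q := x * y * numClimb0StayQ x y / D ^ 2
  l₀ := (-2) * x ^ 2 * y / D
  m₀ := 2 * x ^ 2 * y * (-1 - y + x) / D ^ 2
  l₁ := 0
  m₁ := 0
  j₀ := 0
  k₀ := 0
  j₁ := 0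
  j₂ := 0

/-- Top one step short of its goal, bottom rising. -/
def coefRise1 (x y D : K) : Coef K where
  p := 2 * x * y / D
  q := y * (1 - y + x) / D
  l₀ := (-2) * x * y / D
  m₀ := 0
  l₁ := 0
  m₁ := 0
  j₀ := 0
  k₀ := 0
  j₁ := 0
  j₂ := 0

/-- The same, only the top moves. -/
def coefRise1Stay (x y D : K) : Coef K where
  p := x * y * (1 - y + x) / D
  q := 2 * x * y / D
  l₀ := x * y * (-1 + y - x) / D
  m₀ := x * y / D
  l₁ := 0
  m₁ := 0
  j₀ := 0
  k₀ := 0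
  j₁ := 0
  j₂ := 0

/-- Numerator of the coefficient `p` of `coefClimb1`. -/
def numClimb1P (x y : K) : K :=
  2 + y * (-3 + y * y) + x * (-4 + y * (2 - 2 * y) + x * (2 + y))

/-- Numerator of the coefficient `q` of `coefClimb1`. -/
def numClimb1Q (x y : K) : K :=
  1 + y * (-3 + y * (3 - y)) + x * (-1 + y * (2 - y) + x * (-1 + y + x))

/-- Top one step short of its goal, bottom falling. -/
def coefClimb1 (x y D : K) : Coef K where
  p := x * y * numClimb1P x y / D ^ 2
  q := y * numClimb1Q x y / D ^ 2
  l₀ := 0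
  m₀ := 2 * x * y * (-1 + y + x) / D ^ 2
  l₁ := 0
  m₁ := 0
  j₀ := 0
  k₀ := 0
  j₁ := 0
  j₂ := 0

/-- Numerator of the coefficient `p` of `coefClimb1Down`. -/
def numClimb1DownP (x y : K) : K :=
  1 + y * (-2 + y) + x * (-1 + y * (4 + y) + x * (-1 - 2 * y + x))

/-- Numerator of the coefficient `q` of `coefClimb1Down`. -/
def numClimb1DownQ (x y : K) : K :=
  1 - y * y + x * (-2 + x)

/-- Numerator of the coefficient `m₀` of `coefClimb1Down`. -/
def numClimb1DownM₀ (x y : K) : K :=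
  -1 + y * y + x * (-2 * y + x)

/-- The same, bottom does not move up. -/
def coefClimb1Down (x y D : K) : Coef K where
  p := x * y * numClimb1DownP x y / D ^ 2
  q := 2 * x * y * numClimb1DownQ x y / D ^ 2
  l₀ := x * y * (1 + y - x) / D
  m₀ := x * y * numClimb1DownM₀ x y / D ^ 2
  l₁ := 0
  m₁ := 0
  j₀ := 0
  k₀ := 0
  j₁ := 0
  j₂ := 0

/-- The same, only the top moves. -/
def coefClimb1Stay (x y D : K) : Coef K where
  p := x * y * numClimb1Q x y / D ^ 2
  q := x * y * numClimb1P x y / D ^ 2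
  l₀ := 0
  m₀ := 2 * x ^ 2 * y * (-1 - y + x) / D ^ 2
  l₁ := 0
  m₁ := 0
  j₀ := 0
  k₀ := 0
  j₁ := 0
  j₂ := 0

/-- Numerator of the coefficient `q` of `coefRise2`. -/
def numRise2Q (x y : K) : K :=
  1 - y + x * (6 - y + x)

/-- Top two steps short of its goal, bottom rising. -/
def coefRise2 (x y D : K) : Coef K where
  p := 2 * x * y ^ 2 * (2 - y + 2 * x) / ((1 - x) ^ 2 * D)
  q := y ^ 2 * numRise2Q x y / ((1 - x) ^ 2 * D)
  l₀ := (-2) * x * y / D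
  m₀ := 0
  l₁ := 0
  m₁ := 0
  j₀ := 2 * x * y / (1 - x) ^ 2
  k₀ := 0
  j₁ := 0
  j₂ := 0

/-- The same, only the top moves. -/
def coefRise2Stay (x y D : K) : Coef K where
  p := x * y ^ 2 * numRise2Q x y / ((1 - x) ^ 2 * D)
  q := 2 * x * y ^ 2 * (2 - y + 2 * x) / ((1 - x) ^ 2 * D)
  l₀ := x * y * (-1 + y - x) / D
  m₀ := x * y / D
  l₁ := 0
  m₁ := 0
  j₀ := 2 * x ^ 2 * y / (1 - x) ^ 2
  k₀ := 0
  j₁ := 0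
  j₂ := 0

/-- Numerator of the coefficient `p` of `coefClimb2`. -/
def numClimb2P (x y : K) : K :=
  4 + y * (-9 + y * (6 - y)) + x * (y * (-6 + 2 * y) + x * (-4 - y))

/-- Numerator of the coefficient `q` of `coefClimb2`. -/
def numClimb2Q (x y : K) : K :=
  1 + y * (-3 + y * (3 - y)) + x * (5 + y * (-10 + 5 * y) + x * (-5 - 3 * y - x))

/-- Numerator of the coefficient `m₀` of `coefClimb2`. -/
def numClimb2M₀ (x y : K) : K :=
  -1 + y * y + x * (3 + y * (2 + y) + x * (-3 - 2 * y + x))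

/-- Top two steps short of its goal, bottom falling. -/
def coefClimb2 (x y D : K) : Coef K where
  p := x * y ^ 2 * numClimb2P x y / ((1 - x) * D ^ 2)
  q := y ^ 2 * numClimb2Q x y / ((1 - x) * D ^ 2)
  l₀ := x * numFallDownP x y / D
  m₀ := x * numClimb2M₀ x y / D ^ 2
  l₁ := 0
  m₁ := 0
  j₀ := 2 * x * y * (1 - y - x) / ((1 - x) * ((1 - x) ^ 2 - y))
  k₀ := 0
  j₁ := 0
  j₂ := 0

/-- Numerator of the coefficient `p` of `coefClimb2Down`. -/
def numClimb2DownP (x y : K) : K :=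
  1 + y * (-2 + y) + x * (6 - 2 * y + x)

/-- Numerator of the coefficient `l₀` of `coefClimb2Down`. -/
def numClimb2DownL₀ (x y : K) : K :=
  1 + y * y + x * (-2 - 2 * y + x)

/-- Numerator of the coefficient `m₀` of `coefClimb2Down`. -/
def numClimb2DownM₀ (x y : K) : K :=
  -1 + y * (1 + y * (-1 + y)) + x * (3 - y * y + x * (-3 - y + x))

/-- The same, bottom does not move up. -/
def coefClimb2Down (x y D : K) : Coef K where
  p := x * y ^ 2 * numClimb2DownP x y / D ^ 2
  q := 4 * x * y ^ 2 * (1 - y + x) / D ^ 2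
  l₀ := x * numClimb2DownL₀ x y / D
  m₀ := x * numClimb2DownM₀ x y / D ^ 2
  l₁ := 0
  m₁ := 0
  j₀ := 2 * x ^ 2 * y / ((1 - x) ^ 2 - y)
  k₀ := 0
  j₁ := 0
  j₂ := 0

/-- Numerator of the coefficient `m₀` of `coefClimb2Stay`. -/
def numClimb2StayM₀ (x y : K) : K :=
  -1 + y * (-1 + y * (-1 - y)) + x * (3 + y * (4 + 3 * y) + x * (-3 - 3 * y + x))

/-- The same, only the top moves. -/
def coefClimb2Stay (x y D : K) : Coef K where
  p := x * y ^ 2 * numClimb2Q x y / ((1 - x) * D ^ 2)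
  q := x * y ^ 2 * numClimb2P x y / ((1 - x) * D ^ 2)
  l₀ := x ^ 2 * numClimb2DownL₀ x y / D
  m₀ := x ^ 2 * numClimb2StayM₀ x y / D ^ 2
  l₁ := 0
  m₁ := 0
  j₀ := 2 * x ^ 2 * y * (1 - y - x) / ((1 - x) * ((1 - x) ^ 2 - y))
  k₀ := 0
  j₁ := 0
  j₂ := 0

/-- Numerator of the coefficient `p` of `coefRise3`. -/
def numRise3P (x y : K) : K :=
  3 - 2 * y + x * (10 - 2 * y + 3 * x)

/-- Numerator of the coefficient `q` of `coefRise3`. -/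
def numRise3Q (x y : K) : K :=
  1 - y + x * (15 - 6 * y + x * (15 - y + x))

/-- Numerator of the coefficient `j₀` of `coefRise3`. -/
def numRise3J₀ (x y : K) : K :=
  1 + 2 * y + x * (-2 + y + x)

/-- Top three steps short of its goal, bottom rising. -/
def coefRise3 (x y D : K) : Coef K where
  p := 2 * x * y ^ 3 * numRise3P x y / ((1 - x) ^ 4 * D)
  q := y ^ 3 * numRise3Q x y / ((1 - x) ^ 4 * D)
  l₀ := (-2) * x * y / D
  m₀ := 0
  l₁ := 0
  m₁ := 0
  j₀ := 2 * x * y * numRise3J₀ x y / (1 - x) ^ 4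
  k₀ := 0
  j₁ := 2 * x ^ 2 * y ^ 2 / (1 - x) ^ 4
  j₂ := 0

/-- Numerator of the coefficient `j₀` of `coefRise3Stay`. -/
def numRise3StayJ₀ (x y : K) : K :=
  1 + 3 * y + x * (-2 + x)

/-- The same, only the top moves. -/
def coefRise3Stay (x y D : K) : Coef K where
  p := x * y ^ 3 * numRise3Q x y / ((1 - x) ^ 4 * D)
  q := 2 * x * y ^ 3 * numRise3P x y / ((1 - x) ^ 4 * D)
  l₀ := x * y * (-1 + y - x) / D
  m₀ := x * y / D
  l₁ := 0
  m₁ := 0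
  j₀ := 2 * x ^ 2 * y * numRise3StayJ₀ x y / (1 - x) ^ 4
  k₀ := 0
  j₁ := 2 * x ^ 3 * y ^ 2 / (1 - x) ^ 4
  j₂ := 0

/-- Numerator of the coefficient `p` of `coefClimb3`. -/
def numClimb3P (x y : K) : K :=
  6 + y * (-15 + y * (12 - 3 * y)) + x * (14 + y * (-35 + y * (18 - y)) + x * (-14 + y * (-13 +
    2 * y) + x * (-6 - y)))

/-- Numerator of the coefficient `q` of `coefClimb3`. -/
def numClimb3Q (x y : K) : K :=
  1 + y * (-3 + y * (3 - y)) + x * (14 + y * (-31 + y * (20 - 3 * y)) + x * (y * (-25 + 9 * y) +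
    x * (-14 - 5 * y - x)))

/-- Numerator of the coefficient `l₀` of `coefClimb3`. -/
def numClimb3L₀ (x y : K) : K :=
  1 - y * y + x * (-4 + y * (-3 + y * (-2 - y)) + x * (6 + y * (6 + 3 * y) + x * (-4 - 3 * y +
    x)))

/-- Numerator of the coefficient `m₀` of `coefClimb3`. -/
def numClimb3M₀ (x y : K) : K :=
  -1 + y * (1 + y * (-1 + y)) + x * (5 + y * (1 + y * (2 + y * (1 + y))) + x * (-10 + y * (-9 +
    y * (-7 - 4 * y)) + x * (10 + y * (11 + 6 * y) + x * (-5 - 4 * y + x))))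

/-- Numerator of the coefficient `j₀` of `coefClimb3`. -/
def numClimb3J₀ (x y : K) : K :=
  1 + y * y * (-3 + 2 * y) + x * (-5 + y * (2 + 3 * y) + x * (10 + y * (-6 + 2 * y) + x * (-10 +
    y * (6 - 2 * y) + x * (5 - 2 * y - x))))

/-- Top three steps short of its goal, bottom falling. -/
def coefClimb3 (x y D : K) : Coef K where
  p := x * y ^ 3 * numClimb3P x y / ((1 - x) ^ 3 * D ^ 2)
  q := y ^ 3 * numClimb3Q x y / ((1 - x) ^ 3 * D ^ 2)
  l₀ := x * numClimb3L₀ x y / (y * D)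
  m₀ := x * numClimb3M₀ x y / (y * D ^ 2)
  l₁ := 0
  m₁ := 0
  j₀ := 2 * x * y * numClimb3J₀ x y / ((1 - x) ^ 3 * ((1 - x) ^ 2 - y) ^ 2)
  k₀ := 0
  j₁ := 2 * x ^ 2 * y ^ 2 * (1 - y - x) / ((1 - x) ^ 3 * ((1 - x) ^ 2 - y))
  j₂ := 0

/-- Numerator of the coefficient `p` of `coefClimb3Down`. -/
def numClimb3DownP (x y : K) : K :=
  1 + y * (-2 + y) + x * (15 + y * (-12 + y) + x * (15 - 2 * y + x))

/-- Numerator of the coefficient `q` of `coefClimb3Down`. -/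
def numClimb3DownQ (x y : K) : K :=
  3 + y * (-4 + y) + x * (10 - 4 * y + 3 * x)

/-- Numerator of the coefficient `l₀` of `coefClimb3Down`. -/
def numClimb3DownL₀ (x y : K) : K :=
  1 + y * y * y + x * (-3 + y * (-3 - 3 * y) + x * (3 + 3 * y - x))

/-- Numerator of the coefficient `m₀` of `coefClimb3Down`. -/
def numClimb3DownM₀ (x y : K) : K :=
  -1 + y * (1 + y * y * (-1 + y)) + x * (5 + y * (1 + y * y * (-1 + y)) + x * (-10 + y * (-9 + y
    * (-6 - 4 * y)) + x * (10 + y * (11 + 6 * y) + x * (-5 - 4 * y + x))))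

/-- Numerator of the coefficient `j₀` of `coefClimb3Down`. -/
def numClimb3DownJ₀ (x y : K) : K :=
  1 + y * (2 - 3 * y) + x * (-4 + y * (-4 + 2 * y) + x * (6 + 2 * y + x * (-4 + x)))

/-- The same, bottom does not move up. -/
def coefClimb3Down (x y D : K) : Coef K where
  p := x * y ^ 3 * numClimb3DownP x y / ((1 - x) ^ 2 * D ^ 2)
  q := 2 * x * y ^ 3 * numClimb3DownQ x y / ((1 - x) ^ 2 * D ^ 2)
  l₀ := x * (1 - x) * numClimb3DownL₀ x y / (y * D)
  m₀ := x * numClimb3DownM₀ x y / (y * D ^ 2)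
  l₁ := 0
  m₁ := 0
  j₀ := 2 * x ^ 2 * y * numClimb3DownJ₀ x y / ((1 - x) ^ 2 * ((1 - x) ^ 2 - y) ^ 2)
  k₀ := 0
  j₁ := 2 * x ^ 3 * y ^ 2 / ((1 - x) ^ 2 * ((1 - x) ^ 2 - y))
  j₂ := 0

/-- Numerator of the coefficient `l₀` of `coefClimb3Stay`. -/
def numClimb3StayL₀ (x y : K) : K :=
  1 + y * (1 + y * y * (1 + y)) + x * (-4 + y * (-6 + y * (-6 - 4 * y)) + x * (6 + y * (9 + 6 *
    y) + x * (-4 - 4 * y + x)))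

/-- Numerator of the coefficient `m₀` of `coefClimb3Stay`. -/
def numClimb3StayM₀ (x y : K) : K :=
  -1 + y * y * (-1 + y * (-1 - y * y)) + x * (5 + y * (5 + y * (6 + y * (5 + 5 * y))) + x * (-10
    + y * (-15 + y * (-15 - 10 * y)) + x * (10 + y * (15 + 10 * y) + x * (-5 - 5 * y + x))))

/-- Numerator of the coefficient `j₀` of `coefClimb3Stay`. -/
def numClimb3StayJ₀ (x y : K) : K :=
  1 + y * (1 + y * (-5 + 3 * y)) + x * (-5 + y * (-2 + y * (8 - y)) + x * (10 - 2 * y * y + x *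
    (-10 + y * (2 - y) + x * (5 - y - x))))

/-- The same, only the top moves. -/
def coefClimb3Stay (x y D : K) : Coef K where
  p := x * y ^ 3 * numClimb3Q x y / ((1 - x) ^ 3 * D ^ 2)
  q := x * y ^ 3 * numClimb3P x y / ((1 - x) ^ 3 * D ^ 2)
  l₀ := x ^ 2 * numClimb3StayL₀ x y / (y * D)
  m₀ := x ^ 2 * numClimb3StayM₀ x y / (y * D ^ 2)
  l₁ := 0
  m₁ := 0
  j₀ := 2 * x ^ 2 * y * numClimb3StayJ₀ x y / ((1 - x) ^ 3 * ((1 - x) ^ 2 - y) ^ 2)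
  k₀ := 0
  j₁ := 2 * x ^ 3 * y ^ 2 * (1 - y - x) / ((1 - x) ^ 3 * ((1 - x) ^ 2 - y))
  j₂ := 0

/-- Numerator of the coefficient `p` of `coefDip`. -/
def numDipP (x y : K) : K :=
  1 - y * y + x * (4 + y * (16 - 6 * y) + x * (-10 + y * (16 - y) + x * (4 + x)))

/-- Numerator of the coefficient `q` of `coefDip`. -/
def numDipQ (x y : K) : K :=
  1 + y * (1 - y) + x * (-1 + y * (6 - y) + x * (-1 + y + x))

/-- Numerator of the coefficient `l₀` of `coefDip`. -/
def numDipL₀ (x y : K) : K :=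
  -1 + y + x * (2 + y - x)

/-- Numerator of the coefficient `j₀` of `coefDip`. -/
def numDipJ₀ (x y : K) : K :=
  2 + y * (2 + y) + x * (-8 + y * (-6 + 2 * y) + x * (12 + y * (6 - y) + x * (-8 - 2 * y + 2 *
    x)))

/-- Numerator of the coefficient `j₁` of `coefDip`. -/
def numDipJ₁ (x y : K) : K :=
  1 + y + x * (-2 + x)

/-- Top one step down into the indent, bottom rising. -/
def coefDip (x y D : K) : Coef K where
  p := x * y ^ 2 * numDipP x y / ((1 - x) ^ 4 * D)
  q := 4 * x * y ^ 2 * numDipQ x y / ((1 - x) ^ 4 * D)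
  l₀ := 2 * x * numDipL₀ x y / D
  m₀ := (-2) * x * (1 - x) / D
  l₁ := 0
  m₁ := 0
  j₀ := x * numDipJ₀ x y / (1 - x) ^ 4
  k₀ := 2 * x * (1 - x) / D
  j₁ := 4 * x ^ 2 * y * numDipJ₁ x y / (1 - x) ^ 4
  j₂ := 2 * x ^ 3 * y ^ 2 / (1 - x) ^ 4

/-- Numerator of the coefficient `p` of `coefLand`. -/
def numLandP (x y : K) : K :=
  2 + y * (1 + y * (-4 + y)) + x * (-2 + y * (14 - 4 * y) + x * (-2 + y + 2 * x))

/-- Numerator of the coefficient `q` of `coefLand`. -/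
def numLandQ (x y : K) : K :=
  1 + y * (-1 + y * (-1 + y)) + x * (4 + y * (17 + y * (-14 + y)) + x * (-10 + y * (17 - y) + x
    * (4 - y + x)))

/-- Numerator of the coefficient `l₀` of `coefLand`. -/
def numLandL₀ (x y : K) : K :=
  1 - y * y + x * (-4 + y * (-2 - 2 * y) + x * (6 + y * (4 + y) + x * (-4 - 2 * y + x)))

/-- Numerator of the coefficient `m₀` of `coefLand`. -/
def numLandM₀ (x y : K) : K :=
  -1 + y * (1 + y * (1 - y)) + x * (5 + y * y * (-3 - 2 * y) + x * (-10 + y * (-6 + y * (-1 -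
    y)) + x * (10 + y * (8 + 3 * y) + x * (-5 - 3 * y + x))))

/-- Numerator of the coefficient `j₀` of `coefLand`. -/
def numLandJ₀ (x y : K) : K :=
  2 - 2 * y * y + x * (-8 + y * (1 + y) + x * (12 - 2 * y + x * (-8 + y + 2 * x)))

/-- Top reaching the base of the indent, bottom does not move up. -/
def coefLand (x y D : K) : Coef K where
  p := 2 * x ^ 2 * y ^ 2 * numLandP x y / ((1 - x) ^ 2 * D ^ 2)
  q := x * y ^ 2 * numLandQ x y / ((1 - x) ^ 2 * D ^ 2)
  l₀ := x * numLandL₀ x y / (y * D)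
  m₀ := x * numLandM₀ x y / (y * D ^ 2)
  l₁ := 0
  m₁ := 0
  j₀ := 2 * x ^ 2 * y * numLandJ₀ x y / ((1 - x) ^ 2 * ((1 - x) ^ 2 - y) ^ 2)
  k₀ := 0
  j₁ := 2 * x ^ 3 * y ^ 2 / ((1 - x) ^ 2 * ((1 - x) ^ 2 - y))
  j₂ := 0

/-- Numerator of the coefficient `p` of `coefDipFall`. -/
def numDipFallP (x y : K) : K :=
  1 + y * (-2 + y * y * (2 - y)) + x * (3 + y * (10 + y * (-32 + y * (22 - 3 * y))) + x * (-14 +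
    y * (14 + y * (-32 + 8 * y)) + x * (14 - 18 * y + x * (-3 - 4 * y - x))))

/-- Numerator of the coefficient `q` of `coefDipFall`. -/
def numDipFallQ (x y : K) : K :=
  4 + y * (-3 + y * (-9 + y * (11 - 3 * y))) + x * (-8 + y * (26 + y * (-45 + y * (20 - y))) + x
    * (y * (-12 + y * (-11 + y)) + x * (8 + y * (-10 + y) + x * (-4 - y))))

/-- Numerator of the coefficient `l₀` of `coefDipFall`. -/
def numDipFallL₀ (x y : K) : K :=
  1 + y * (-2 + y) + x * (-4 + 2 * y + x * (6 + y * (2 + y) + x * (-4 - 2 * y + x)))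

/-- Numerator of the coefficient `m₀` of `coefDipFall`. -/
def numDipFallM₀ (x y : K) : K :=
  -1 + y * (-1 + y * (5 - 3 * y)) + x * (5 + y * (6 - 3 * y) + x * (-10 + y * (-12 + y * (-5 -
    y)) + x * (10 + y * (10 + 3 * y) + x * (-5 - 3 * y + x))))

/-- Numerator of the coefficient `j₀` of `coefDipFall`. -/
def numDipFallJ₀ (x y : K) : K :=
  2 + y * (-4 + y * (1 + y * (1 + y * (1 - y)))) + x * (-18 + y * (28 + y * (5 + y * (-20 + y *
    (3 + 2 * y)))) + x * (72 + y * (-84 + y * (-39 + y * (71 + y * (-21 + y)))) + x * (-168 + y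
    * (140 + y * (85 + y * (-102 + 25 * y))) + x * (252 + y * (-140 + y * (-85 + y * (65 - 8 *
    y))) + x * (-252 + y * (84 + y * (39 - 14 * y)) + x * (168 + y * (-28 + y * (-5 - y)) + x *
    (-72 + y * (4 - y) + x * (18 + x * (-2)))))))))

/-- Numerator of the coefficient `j₁` of `coefDipFall`. -/
def numDipFallJ₁ (x y : K) : K :=
  2 + y * (-2 + y * (-2 + 2 * y)) + x * (-10 + y * (8 + y * (3 - y)) + x * (20 - 12 * y + x *
    (-20 + y * (8 - y) + x * (10 - 2 * y + x * (-2)))))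

/-- Top one step down into the indent, bottom falling. -/
def coefDipFall (x y D : K) : Coef K where
  p := x * y ^ 2 * numDipFallP x y / ((1 - x) ^ 3 * D ^ 2)
  q := x * y ^ 2 * numDipFallQ x y / ((1 - x) ^ 3 * D ^ 2)
  l₀ := x * numDipFallL₀ x y / (y * D)
  m₀ := x * numDipFallM₀ x y / (y * D ^ 2)
  l₁ := 0
  m₁ := 0
  j₀ := x * numDipFallJ₀ x y / ((1 - x) ^ 3 * ((1 - x) ^ 2 - y) ^ 3)
  k₀ := 2 * x * (1 - x) ^ 2 * (1 - y - x) / (((1 - x) ^ 2 - y) * D)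
  j₁ := 2 * x ^ 2 * y * numDipFallJ₁ x y / ((1 - x) ^ 3 * ((1 - x) ^ 2 - y) ^ 2)
  j₂ := 2 * x ^ 3 * y ^ 2 * (1 - y - x) / ((1 - x) ^ 3 * ((1 - x) ^ 2 - y))

/-- Numerator of the coefficient `l₀` of `coefDipFallDown`. -/
def numDipFallDownL₀ (x y : K) : K :=
  1 + y * (-1 + y * (-1 + y)) + x * (-4 + y * (-1 + y) + x * (6 + y * (5 + 2 * y) + x * (-4 - 3
    * y + x)))

/-- Numerator of the coefficient `m₀` of `coefDipFallDown`. -/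
def numDipFallDownM₀ (x y : K) : K :=
  -1 + y * (2 + y * y * (-2 + y)) + x * (5 + y * (-6 + y) + x * (-10 + y * (6 + y * (2 + 2 * y))
    + x * (10 + y * (-2 - 3 * y) + x * (-5 + x))))

/-- Numerator of the coefficient `j₀` of `coefDipFallDown`. -/
def numDipFallDownJ₀ (x y : K) : K :=
  2 + y * (-2 + y * (-1 + y * y)) + x * (-16 + y * (10 + y * (18 + y * (-6 - 6 * y))) + x * (56
    + y * (-18 + y * (-63 + y * (20 + y))) + x * (-112 + y * (10 + y * (92 - 22 * y)) + x * (140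
    + y * (10 + y * (-63 + 8 * y)) + x * (-112 + y * (-18 + 18 * y) + x * (56 + y * (10 - y) + x
    * (-16 - 2 * y + 2 * x)))))))

/-- Numerator of the coefficient `j₁` of `coefDipFallDown`. -/
def numDipFallDownJ₁ (x y : K) : K :=
  1 - y * y + x * (-3 + x * (3 - x))

/-- The same, top does not move, bottom does not move up. -/
def coefDipFallDown (x y D : K) : Coef K where
  p := x ^ 2 * y ^ 2 * numLandQ x y / ((1 - x) ^ 2 * D ^ 2)
  q := 2 * x ^ 2 * y ^ 2 * numLandP x y / ((1 - x) ^ 2 * D ^ 2)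
  l₀ := x * numDipFallDownL₀ x y / (y * D)
  m₀ := x * numDipFallDownM₀ x y / (y * D ^ 2)
  l₁ := 0
  m₁ := 0
  j₀ := x ^ 2 * numDipFallDownJ₀ x y / ((1 - x) ^ 2 * ((1 - x) ^ 2 - y) ^ 3)
  k₀ := 2 * x ^ 2 * (1 - x) ^ 3 / (((1 - x) ^ 2 - y) * D)
  j₁ := 4 * x ^ 3 * y * numDipFallDownJ₁ x y / ((1 - x) * ((1 - x) ^ 2 - y) ^ 2)
  j₂ := 2 * x ^ 4 * y ^ 2 / ((1 - x) ^ 2 * ((1 - x) ^ 2 - y))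

/-- Numerator of the coefficient `l₀` of `coefPeak`. -/
def numPeakL₀ (x y : K) : K :=
  8 + y * (-36 + y * (61 + y * (-46 + y * (12 + y * (2 - y))))) + x * (-64 + y * (186 + y *
    (-198 + y * (106 + y * (-44 + y * (16 - 2 * y))))) + x * (224 + y * (-360 + y * (223 + y *
    (-68 + y * (-12 + y * (10 - y))))) + x * (-448 + y * (270 + y * (-132 + y * (-20 + y * (-20
    + 4 * y)))) + x * (560 + y * (60 + y * (123 + 50 * y)) + x * (-448 + y * (-234 + y * (-118 -
    22 * y)) + x * (224 + y * (144 + 41 * y) + x * (-64 - 30 * y + 8 * x)))))))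

/-- Numerator of the coefficient `m₀` of `coefPeak`. -/
def numPeakM₀ (x y : K) : K :=
  1 + y * (-3 + y * (3 - y)) + x * (-5 + y * (9 + y * (-5 + y * y)) + x * (10 + y * (-9 + y *
    (-2 - 4 * y)) + x * (-10 + y * (3 + 4 * y) + x * (5 - x))))

/-- Numerator of the coefficient `l₁` of `coefPeak`. -/
def numPeakL₁ (x y : K) : K :=
  -1 + x * (2 + y - x)

/-- Numerator of the coefficient `m₁` of `coefPeak`. -/
def numPeakM₁ (x y : K) : K :=
  -1 + y + x * (3 + y * (1 + y) + x * (-3 - 2 * y + x))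

/-- Numerator of the coefficient `j₀` of `coefPeak`. -/
def numPeakJ₀ (x y : K) : K :=
  -8 + y * (4 + y * (3 + y)) + x * (40 + y * (-6 + y * (-9 - 2 * y)) + x * (-80 + y * (-6 + y *
    (13 - y)) + x * (80 + y * (14 - 7 * y) + x * (-40 - 6 * y + 8 * x))))

/-- Numerator of the coefficient `j₁` of `coefPeak`. -/
def numPeakJ₁ (x y : K) : K :=
  -3 + y * (1 + 2 * y) + x * (9 + y * (-2 - y) + x * (-9 + y + 3 * x))

/-- Top before its first mode, bottom rising. -/
def coefPeak (x y D : K) : Coef K where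
  p := x * y ^ 2 * numDipFallP x y / ((1 - x) ^ 3 * D ^ 2)
  q := x * y ^ 2 * numDipFallQ x y / ((1 - x) ^ 3 * D ^ 2)
  l₀ := x * numPeakL₀ x y / (y * (1 - x) ^ 2 * D ^ 2)
  m₀ := 2 * x * numPeakM₀ x y / (y * D ^ 2)
  l₁ := 2 * x ^ 2 * numPeakL₁ x y / D
  m₁ := 2 * x ^ 2 * numPeakM₁ x y / D ^ 2
  j₀ := x * numPeakJ₀ x y / (y * (1 - x) ^ 3)
  k₀ := 2 * x * (1 - x) ^ 2 * (-1 + y + x) / (y * D)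
  j₁ := 2 * x ^ 2 * numPeakJ₁ x y / (1 - x) ^ 3
  j₂ := 2 * x ^ 3 * y * (-1 + y + x) / (1 - x) ^ 3

/-- Numerator of the coefficient `l₀` of `coefPeakUp`. -/
def numPeakUpL₀ (x y : K) : K :=
  8 + y * (-34 + y * (55 + y * (-40 + y * (10 + y * (2 - y))))) + x * (-64 + y * (172 + y *
    (-176 + y * (94 + y * (-38 + y * (14 - 2 * y))))) + x * (224 + y * (-318 + y * (203 + y *
    (-56 + y * (-10 + y * (14 - y))))) + x * (-448 + y * (200 + y * (-152 + y * (-44 + y * (-34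
    + 2 * y)))) + x * (560 + y * (130 + y * (173 + y * (80 + 8 * y))) + x * (-448 + y * (-276 +
    y * (-152 - 34 * y)) + x * (224 + y * (158 + 49 * y) + x * (-64 - 32 * y + 8 * x)))))))

/-- Numerator of the coefficient `m₀` of `coefPeakUp`. -/
def numPeakUpM₀ (x y : K) : K :=
  1 + y * (-2 + y) + x * (-5 + y * (5 - 4 * y) + x * (10 + y * (-3 + y * (2 - y)) + x * (-10 + y
    * (-1 + y) + x * (5 + y - x))))

/-- Numerator of the coefficient `j₀` of `coefPeakUp`. -/
def numPeakUpJ₀ (x y : K) : K :=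
  -8 + y * (2 + y) + x * (32 + y * (4 + 2 * y) + x * (-48 + y * (-14 + y) + x * (32 + 8 * y + x
    * (-8))))

/-- The same, top does not move down. -/
def coefPeakUp (x y D : K) : Coef K where
  p := 2 * x ^ 2 * y ^ 2 * numLandP x y / ((1 - x) ^ 2 * D ^ 2)
  q := x * y ^ 2 * numLandQ x y / ((1 - x) ^ 2 * D ^ 2)
  l₀ := x * numPeakUpL₀ x y / (y * (1 - x) ^ 2 * D ^ 2)
  m₀ := 2 * x * numPeakUpM₀ x y / (y * D ^ 2)
  l₁ := 2 * x ^ 2 * numPeakL₁ x y / D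
  m₁ := 2 * x ^ 2 * numPeakM₁ x y / D ^ 2
  j₀ := x * numPeakUpJ₀ x y / (y * (1 - x) ^ 2)
  k₀ := (-2) * x * (1 - x) ^ 3 / (y * D)
  j₁ := 2 * x ^ 2 * (-3 - y + 3 * x) / (1 - x)
  j₂ := (-2) * x ^ 3 * y / (1 - x) ^ 2

/-- Numerator of the coefficient `l₀` of `coefPeakStay`. -/
def numPeakStayL₀ (x y : K) : K :=
  6 + y * (-34 + y * (77 + y * (-87 + y * (48 + y * (-8 + y * (-3 + y)))))) + x * (-38 + y *
    (148 + y * (-227 + y * (188 + y * (-110 + y * (54 + y * (-17 + 2 * y)))))) + x * (88 + y *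
    (-216 + y * (207 + y * (-105 + y * (-18 + y * (44 + y * (-17 + y)))))) + x * (-56 + y * (92
    + y * (-29 + y * (16 + y * (2 + y * (38 - 3 * y))))) + x * (-140 + y * (-20 + y * (-109 + y
    * (-89 - 70 * y))) + x * (364 + y * (204 + y * (219 + y * (132 + 20 * y))) + x * (-392 + y *
    (-328 + y * (-207 - 55 * y)) + x * (232 + y * (196 + 69 * y) + x * (-74 - 42 * y + 10 *
    x))))))))

/-- Numerator of the coefficient `m₀` of `coefPeakStay`. -/
def numPeakStayM₀ (x y : K) : K :=
  -6 + y * (28 + y * (-49 + y * (38 + y * (-10 + y * (-2 + y))))) + x * (52 + y * (-148 + y *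
    (152 + y * (-82 + y * (38 + y * (-14 + 2 * y))))) + x * (-196 + y * (288 + y * (-167 + y *
    (36 + y * (16 + y * (-14 + y))))) + x * (420 + y * (-200 + y * (116 + y * (40 + y * (22 - 2
    * y)))) + x * (-560 + y * (-100 + y * (-131 + y * (-50 - 2 * y))) + x * (476 + y * (252 + y
    * (116 + 18 * y)) + x * (-252 + y * (-152 - 37 * y) + x * (76 + 32 * y + x * (-10))))))))

/-- Numerator of the coefficient `l₁` of `coefPeakStay`. -/
def numPeakStayL₁ (x y : K) : K :=
  -1 + y * (-1 - y) + x * (2 + 2 * y - x)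

/-- Numerator of the coefficient `m₁` of `coefPeakStay`. -/
def numPeakStayM₁ (x y : K) : K :=
  -1 - y * y * y + x * (3 + y * (3 + 3 * y) + x * (-3 - 3 * y + x))

/-- Numerator of the coefficient `j₀` of `coefPeakStay`. -/
def numPeakStayJ₀ (x y : K) : K :=
  -8 + y * (-4 - y) + x * (32 + y * (22 + 6 * y) + x * (-48 + y * (-32 - y) + x * (32 + 14 * y +
    x * (-8))))

/-- The same, only the top moves, and not down. -/
def coefPeakStay (x y D : K) : Coef K where
  p := x ^ 2 * y ^ 2 * numLandQ x y / ((1 - x) ^ 2 * D ^ 2)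
  q := 2 * x ^ 2 * y ^ 2 * numLandP x y / ((1 - x) ^ 2 * D ^ 2)
  l₀ := x * numPeakStayL₀ x y / (2 * y * (1 - x) ^ 2 * D ^ 2)
  m₀ := x * numPeakStayM₀ x y / (2 * y * (1 - x) ^ 2 * D ^ 2)
  l₁ := 2 * x ^ 3 * numPeakStayL₁ x y / D
  m₁ := 2 * x ^ 3 * numPeakStayM₁ x y / D ^ 2
  j₀ := x ^ 2 * numPeakStayJ₀ x y / (y * (1 - x) ^ 2)
  k₀ := (-2) * x ^ 2 * (1 - x) ^ 3 / (y * D)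
  j₁ := 2 * x ^ 3 * (-3 - 2 * y + 3 * x) / (1 - x)
  j₂ := (-2) * x ^ 4 * y / (1 - x) ^ 2

/-- Numerator of the coefficient `p` of `coefPeakFall`. -/
def numPeakFallP (x y : K) : K :=
  1 + y * (-4 + y * (5 + y * y * (-5 + y * (4 - y)))) + x * (2 + y * (8 + y * (-51 + y * (86 + y
    * (-62 + y * (18 - y))))) + x * (-17 + y * (24 + y * (-30 + y * (50 + y * (-29 + 2 * y)))) +
    x * (28 + y * (-48 + y * (66 - 6 * y)) + x * (-17 + y * (12 + y * (9 - 2 * y)) + x * (2 + y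
    * (8 + y) + x)))))

/-- Numerator of the coefficient `q` of `coefPeakFall`. -/
def numPeakFallQ (x y : K) : K :=
  2 + y * (-5 + y * (-1 + y * (14 + y * (-16 + y * (7 - y))))) + x * (-6 + y * (21 + y * (-42 +
    y * (50 + y * (-28 + 5 * y)))) + x * (4 + y * (-18 + y * (24 + y * (2 - 4 * y))) + x * (4 +
    y * (-6 + y * (18 - 2 * y)) + x * (-6 + y * (7 + y) + x * (2 + y)))))

/-- Numerator of the coefficient `l₀` of `coefPeakFall`. -/
def numPeakFallL₀ (x y : K) : K :=
  10 + y * (-44 + y * (73 + y * (-54 + y * (14 + y * (2 - y))))) + x * (-80 + y * (234 + y *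
    (-260 + y * (140 + y * (-46 + y * (14 - 2 * y))))) + x * (280 + y * (-480 + y * (345 + y *
    (-116 + y * (-10 + y * (14 - y))))) + x * (-560 + y * (430 + y * (-240 + y * (8 + y * (-26 +
    2 * y)))) + x * (700 + y * (-60 + y * (155 + y * (42 + 4 * y))) + x * (-560 + y * (-186 + y
    * (-108 - 20 * y)) + x * (280 + y * (136 + 35 * y) + x * (-80 - 30 * y + 10 * x)))))))

/-- Numerator of the coefficient `m₀` of `coefPeakFall`. -/
def numPeakFallM₀ (x y : K) : K :=
  10 + y * (-54 + y * (117 + y * (-127 + y * (68 + y * (-12 + y * (-3 + y)))))) + x * (-90 + y *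
    (354 + y * (-547 + y * (426 + y * (-188 + y * (58 + y * (-15 + 2 * y)))))) + x * (360 + y *
    (-966 + y * (973 + y * (-493 + y * (128 + y * (-6 + y * (-13 + y)))))) + x * (-840 + y *
    (1386 + y * (-755 + y * (260 + y * (40 + y * (46 - y))))) + x * (1260 + y * (-1050 + y *
    (135 + y * (-177 + y * (-116 - 22 * y)))) + x * (-1260 + y * (294 + y * (143 + y * (178 + 68
    * y))) + x * (840 + y * (126 + y * (-73 - 67 * y)) + x * (-360 + y * (-114 + 7 * y) + x *
    (90 + 24 * y + x * (-10)))))))))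

/-- Numerator of the coefficient `l₁` of `coefPeakFall`. -/
def numPeakFallL₁ (x y : K) : K :=
  -1 + y * (2 - y) + x * (4 - 2 * y + x * (-6 + y * (-2 - y) + x * (4 + 2 * y - x)))

/-- Numerator of the coefficient `j₀` of `coefPeakFall`. -/
def numPeakFallJ₀ (x y : K) : K :=
  -8 + y * (28 + y * (-33 + y * (12 + y * (2 - y * y)))) + x * (80 + y * (-226 + y * (188 + y *
    (-14 + y * (-26 + y * (-8 + 6 * y))))) + x * (-360 + y * (800 + y * (-428 + y * (-106 + y *
    (95 - y * y)))) + x * (960 + y * (-1624 + y * (468 + y * (328 + y * (-148 + 16 * y)))) + x *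
    (-1680 + y * (2072 + y * (-190 + y * (-392 + y * (106 - 8 * y)))) + x * (2016 + y * (-1708 +
    y * (-92 + y * (226 - 30 * y))) + x * (-1680 + y * (896 + y * (132 + y * (-58 + y))) + x *
    (960 + y * (-280 + y * (-52 + 4 * y)) + x * (-360 + y * (44 + 7 * y) + x * (80 - 2 * y + x *
    (-8))))))))))

/-- Numerator of the coefficient `k₀` of `coefPeakFall`. -/
def numPeakFallK₀ (x y : K) : K :=
  -1 + y * (2 - y) + x * (2 - 2 * y - x)

/-- Numerator of the coefficient `j₁` of `coefPeakFall`. -/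
def numPeakFallJ₁ (x y : K) : K :=
  -3 + y * (7 + y * (-3 + y * (-3 + 2 * y))) + x * (15 + y * (-25 + y * (5 + 5 * y)) + x * (-30
    + y * (33 - 3 * y) + x * (30 + y * (-19 + y) + x * (-15 + 4 * y + 3 * x))))

/-- Top before its first mode, bottom falling. -/
def coefPeakFall (x y D : K) : Coef K where
  p := x * y ^ 2 * numPeakFallP x y / ((1 - x) ^ 2 * D ^ 3)
  q := 2 * x * y ^ 2 * numPeakFallQ x y / ((1 - x) ^ 2 * D ^ 3)
  l₀ := x * numPeakFallL₀ x y / (2 * y * (1 - x) ^ 2 * D ^ 2)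
  m₀ := x * numPeakFallM₀ x y / (2 * y * (1 - x) ^ 2 * D ^ 3)
  l₁ := 2 * x ^ 2 * numPeakFallL₁ x y / D ^ 2
  m₁ := 2 * x ^ 2 * (1 - x) * numDipL₀ x y / D ^ 2
  j₀ := x * numPeakFallJ₀ x y / (y * (1 - x) ^ 2 * ((1 - x) ^ 2 - y) ^ 3)
  k₀ := 2 * x * (1 - x) ^ 3 * numPeakFallK₀ x y / (y * ((1 - x) ^ 2 - y) * D)
  j₁ := 2 * x ^ 2 * numPeakFallJ₁ x y / ((1 - x) * ((1 - x) ^ 2 - y) ^ 2)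
  j₂ := 2 * x ^ 3 * y * numPeakFallK₀ x y / ((1 - x) ^ 2 * ((1 - x) ^ 2 - y))

/-- Numerator of the coefficient `p` of `coefPeakFallDown`. -/
def numPeakFallDownP (x y : K) : K :=
  1 + y * (-2 + y * y * (2 - y)) + x * (4 + y * (18 + y * (-24 + 2 * y)) + x * (-10 + 18 * y + x
    * (4 - 2 * y + x)))

/-- Numerator of the coefficient `q` of `coefPeakFallDown`. -/
def numPeakFallDownQ (x y : K) : K :=
  1 + y * y * (-3 + 2 * y) + x * (-1 + y * (8 - 3 * y) + x * (-1 + x))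

/-- Numerator of the coefficient `l₀` of `coefPeakFallDown`. -/
def numPeakFallDownL₀ (x y : K) : K :=
  y * (-8 + y * (32 + y * (-49 + y * (34 + y * (-8 + y * (-2 + y)))))) + x * (10 + y * (24 + y *
    (-101 + y * (110 + y * (-66 + y * (36 + y * (-15 + 2 * y)))))) + x * (-80 + y * (-18 + y *
    (96 + y * (-85 + y * (-10 + y * (32 + y * (-16 + y)))))) + x * (280 + y * (52 + y * (55 + y
    * (100 + y * (38 + y * (36 - 3 * y))))) + x * (-560 + y * (-270 + y * (-280 + y * (-195 - 80
    * y))) + x * (700 + y * (528 + y * (393 + y * (174 + 20 * y))) + x * (-560 + y * (-494 + y *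
    (-264 - 55 * y)) + x * (280 + y * (228 + 69 * y) + x * (-80 - 42 * y + 10 * x))))))))

/-- Numerator of the coefficient `m₀` of `coefPeakFallDown`. -/
def numPeakFallDownM₀ (x y : K) : K :=
  y * (8 + y * (-40 + y * (81 + y * (-83 + y * (42 + y * (-6 + y * (-3 + y))))))) + x * (10 + y
    * (-90 + y * (219 + y * (-242 + y * (158 + y * (-90 + y * (51 + y * (-18 + 2 * y))))))) + x
    * (-90 + y * (354 + y * (-437 + y * (243 + y * (-77 + y * (-50 + y * (59 + y * (-19 +
    y))))))) + x * (360 + y * (-630 + y * (411 + y * (-40 + y * (36 + y * (-2 + y * (53 - 4 *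
    y)))))) + x * (-840 + y * (378 + y * (-365 + y * (-257 + y * (-197 + y * (-112 + 3 * y)))))
    + x * (1260 + y * (462 + y * (665 + y * (510 + y * (238 + 20 * y)))) + x * (-1260 + y *
    (-1050 + y * (-839 + y * (-419 - 75 * y))) + x * (840 + y * (846 + y * (497 + 124 * y)) + x
    * (-360 + y * (-330 - 111 * y) + x * (90 + 52 * y + x * (-10))))))))))

/-- Numerator of the coefficient `l₁` of `coefPeakFallDown`. -/
def numPeakFallDownL₁ (x y : K) : K :=
  -1 - y * y * y * y + x * (4 + y * (4 + y * (4 + 4 * y)) + x * (-6 + y * (-8 - 6 * y) + x * (4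
    + 4 * y - x)))

/-- Numerator of the coefficient `j₀` of `coefPeakFallDown`. -/
def numPeakFallDownJ₀ (x y : K) : K :=
  -8 + y * (12 + y * (-1 + y * (-2 - y))) + x * (64 + y * (-58 + y * (-30 + y * (10 + 14 * y)))
    + x * (-224 + y * (96 + y * (129 + y * (-10 - 11 * y))) + x * (448 + y * (-30 + y * (-196 -
    2 * y)) + x * (-560 + y * (-100 + y * (129 + 4 * y)) + x * (448 + y * (138 - 30 * y) + x *
    (-224 + y * (-72 - y) + x * (64 + 14 * y + x * (-8))))))))

/-- Numerator of the coefficient `j₁` of `coefPeakFallDown`. -/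
def numPeakFallDownJ₁ (x y : K) : K :=
  -3 + y * (1 + 2 * y) + x * (12 - 4 * y * y + x * (-18 - 3 * y + x * (12 + 2 * y + x * (-3))))

/-- The same, top does not move down, bottom does not move up. -/
def coefPeakFallDown (x y D : K) : Coef K where
  p := x ^ 2 * y ^ 2 * numPeakFallDownP x y / D ^ 3
  q := 4 * x ^ 2 * y ^ 2 * numPeakFallDownQ x y / D ^ 3
  l₀ := x * numPeakFallDownL₀ x y / (2 * y * (1 - x) ^ 2 * D ^ 2)
  m₀ := x * numPeakFallDownM₀ x y / (2 * y * (1 - x) ^ 2 * D ^ 3)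
  l₁ := 2 * x ^ 3 * numPeakFallDownL₁ x y / D ^ 2
  m₁ := 2 * x ^ 3 * numClimb2StayM₀ x y / D ^ 2
  j₀ := x ^ 2 * numPeakFallDownJ₀ x y / (y * ((1 - x) ^ 2 - y) ^ 3)
  k₀ := (-2) * x ^ 2 * (1 - x) ^ 5 / (y * ((1 - x) ^ 2 - y) * D)
  j₁ := 2 * x ^ 3 * numPeakFallDownJ₁ x y / ((1 - x) ^ 2 - y) ^ 2
  j₂ := (-2) * x ^ 4 * y / ((1 - x) ^ 2 - y)

/-- Numerator of the coefficient `p` of `coefPeakFallStay`. -/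
def numPeakFallStayP (x y : K) : K :=
  1 + y * (-3 + y * (2 + y * (2 + y * (-3 + y)))) + x * (3 + y * (12 + y * (-42 + y * (36 - 9 *
    y))) + x * (-14 + y * (14 + y * (-26 + 10 * y)) + x * (14 + y * (-20 + 2 * y) + x * (-3 - 3
    * y - x))))

/-- Numerator of the coefficient `q` of `coefPeakFallStay`. -/
def numPeakFallStayQ (x y : K) : K :=
  4 + y * (-5 + y * (-10 + y * (20 + y * (-10 + y)))) + x * (-8 + y * (32 + y * (-50 + y * (28 -
    2 * y))) + x * (y * (-18 - 6 * y) + x * (8 + y * (-8 + 2 * y) + x * (-4 - y))))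

/-- Numerator of the coefficient `l₀` of `coefPeakFallStay`. -/
def numPeakFallStayL₀ (x y : K) : K :=
  10 + y * (-42 + y * (63 + y * (-40 + y * (8 + y * (2 - y))))) + x * (-80 + y * (220 + y *
    (-208 + y * (86 + y * (-34 + y * (18 - 2 * y))))) + x * (280 + y * (-438 + y * (235 + y *
    (-52 + y * (-30 + y * (6 - y))))) + x * (-560 + y * (360 + y * (-120 + y * y * (2 + 6 * y)))
    + x * (700 + y * (10 + y * (85 + y * (12 - 10 * y))) + x * (-560 + y * (-228 + y * (-88 - 6
    * y)) + x * (280 + y * (150 + 33 * y) + x * (-80 - 32 * y + 10 * x)))))))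

/-- Numerator of the coefficient `m₀` of `coefPeakFallStay`. -/
def numPeakFallStayM₀ (x y : K) : K :=
  10 + y * (-36 + y * (41 + y * (-5 + y * (-20 + y * (10 + y * (1 - y)))))) + x * (-90 + y *
    (210 + y * (-163 + y * (34 + y * (20 + y * (-26 + y * (17 - 2 * y)))))) + x * (360 + y *
    (-462 + y * (265 + y * (-39 + y * y * (-26 + y * (7 - y))))) + x * (-840 + y * (378 + y *
    (-315 + y * (-76 + y * (-40 + y * (-6 + 7 * y))))) + x * (1260 + y * (210 + y * (435 + y *
    (197 + y * (36 - 16 * y)))) + x * (-1260 + y * (-714 + y * (-481 + y * (-150 + 4 * y))) + x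
    * (840 + y * (630 + y * (283 + 39 * y)) + x * (-360 + y * (-258 - 65 * y) + x * (90 + 42 * y
    + x * (-10)))))))))

/-- Numerator of the coefficient `l₁` of `coefPeakFallStay`. -/
def numPeakFallStayL₁ (x y : K) : K :=
  -1 + y + x * (4 + y * (1 + y * (1 + y)) + x * (-6 + y * (-5 - 3 * y) + x * (4 + 3 * y - x)))

/-- Numerator of the coefficient `m₁` of `coefPeakFallStay`. -/
def numPeakFallStayM₁ (x y : K) : K :=
  -1 + x * (3 + y * (2 + y) + x * (-3 - 2 * y + x))

/-- Numerator of the coefficient `j₀` of `coefPeakFallStay`. -/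
def numPeakFallStayJ₀ (x y : K) : K :=
  -8 + y * (20 + y * (-13 + y * (-1 + y * (1 + y)))) + x * (72 + y * (-134 + y * (35 + y * (34 +
    y * (3 - 10 * y)))) + x * (-288 + y * (378 + y * (27 + y * (-119 + y * (-3 + 5 * y)))) + x *
    (672 + y * (-574 + y * (-205 + y * (164 - 5 * y))) + x * (-1008 + y * (490 + y * (305 + y *
    (-103 + 4 * y))) + x * (1008 + y * (-210 + y * (-207 + 26 * y)) + x * (-672 + y * (14 + y *
    (65 - y)) + x * (288 + y * (22 - 7 * y) + x * (-72 - 6 * y + 8 * x))))))))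

/-- Numerator of the coefficient `j₁` of `coefPeakFallStay`. -/
def numPeakFallStayJ₁ (x y : K) : K :=
  -3 + y * (4 + y * (1 - 2 * y)) + x * (15 + y * (-13 + y * (-5 + 3 * y)) + x * (-30 + y * (15 +
    5 * y) + x * (30 + y * (-7 - y) + x * (-15 + y + 3 * x))))

/-- The same, only the top moves, and not down. -/
def coefPeakFallStay (x y D : K) : Coef K where
  p := x ^ 2 * y ^ 2 * numPeakFallStayP x y / ((1 - x) * D ^ 3)
  q := x ^ 2 * y ^ 2 * numPeakFallStayQ x y / ((1 - x) * D ^ 3)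
  l₀ := x ^ 2 * numPeakFallStayL₀ x y / (2 * y * (1 - x) ^ 2 * D ^ 2)
  m₀ := x ^ 2 * numPeakFallStayM₀ x y / (2 * y * (1 - x) ^ 2 * D ^ 3)
  l₁ := 2 * x ^ 3 * numPeakFallStayL₁ x y / D ^ 2
  m₁ := 2 * x ^ 3 * numPeakFallStayM₁ x y / D ^ 2
  j₀ := x ^ 2 * numPeakFallStayJ₀ x y / (y * (1 - x) * ((1 - x) ^ 2 - y) ^ 3)
  k₀ := 2 * x ^ 2 * (1 - x) ^ 4 * (-1 + y + x) / (y * ((1 - x) ^ 2 - y) * D)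
  j₁ := 2 * x ^ 3 * numPeakFallStayJ₁ x y / ((1 - x) * ((1 - x) ^ 2 - y) ^ 2)
  j₂ := 2 * x ^ 4 * y * (-1 + y + x) / ((1 - x) * ((1 - x) ^ 2 - y))

end

/-! ### The closed forms satisfy the recurrences -/

section
open Coef
set_option linter.unusedSectionVars false
set_option linter.unusedSimpArgs false

variable {K : Type*} [Field K] [CharZero K] {x y s D : K}

/-- This and the following identities transcribe the recurrences of the series to coefficient
vectors, where `back` stands for the value at the height below. Each of them is an identity of
rational functions in `x` and `y` for every coordinate, once `D` is replaced by `Δ`. -/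
theorem coefFall_eq (h : SqrtDiscr x y s D) :
    coefFall x y D - back x y D (coefFall x y D) = back x y D irratl + coefFallDown x y D := by
  obtain ⟨hD, -, h1, h2, h3, h4⟩ := h
  ext <;> simp only [back, coefFall, coefFallDown, ratl, irratl, add_def, sub_def,
    smul_def, sub_self, mul_zero, add_zero, zero_add, sub_zero, zero_div, mul_one] <;>
    field_simp <;> (try simp only [hD, discr, numFallP, numFallDownP]) <;> ring

/-- A recurrence that refers to the height above is written one step later, because `back` only goes
down: here `e n - y * e (n + 1)` equals `x` times the value of `coefFall` at `n`, where `e` is the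
sequence of `coefFallDown`. -/
theorem coefFallDown_eq (h : SqrtDiscr x y s D) :
    back x y D (coefFallDown x y D) - y • coefFallDown x y D = x • back x y D (coefFall x y D) := by
  obtain ⟨hD, -, h1, h2, h3, h4⟩ := h
  ext <;> simp only [back, coefFallDown, coefFall, ratl, irratl, add_def, sub_def,
    smul_def, sub_self, mul_zero, add_zero, zero_add, sub_zero, zero_div, mul_one] <;>
    field_simp <;> (try simp only [hD, discr, numFallDownP, numFallP]) <;> ring

theorem coefRise0_eq (h : SqrtDiscr x y s D) :
    coefFall x y D = back x y D ratl + coefRise0 x y D := by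
  obtain ⟨hD, -, h1, h2, h3, h4⟩ := h
  ext <;> simp only [back, coefFall, coefRise0, ratl, irratl, add_def, sub_def,
    smul_def, sub_self, mul_zero, add_zero, zero_add, sub_zero, zero_div, mul_one] <;>
    field_simp <;> (try simp only [hD, discr, numFallP, numFallDownP]) <;> ring

theorem coefRise0Stay_eq (h : SqrtDiscr x y s D) :
    coefRise0 x y D - back x y D (coefRise0 x y D) = coefRise0Stay x y D := by
  obtain ⟨hD, -, h1, h2, h3, h4⟩ := h
  ext <;> simp only [back, coefRise0, coefRise0Stay, ratl, irratl, add_def, sub_def,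
    smul_def, sub_self, mul_zero, add_zero, zero_add, sub_zero, zero_div, mul_one] <;>
    field_simp <;> (try simp only [hD, discr, numFallDownP]) <;> ring

theorem coefRise0Stay_eq' (h : SqrtDiscr x y s D) :
    back x y D (coefRise0Stay x y D) - y • coefRise0Stay x y D = x • back x y D (coefFall x y D) := by
  obtain ⟨hD, -, h1, h2, h3, h4⟩ := h
  ext <;> simp only [back, coefRise0Stay, coefFall, ratl, irratl, add_def, sub_def,
    smul_def, sub_self, mul_zero, add_zero, zero_add, sub_zero, zero_div, mul_one] <;>
    field_simp <;> (try simp only [hD, discr, numFallDownP, numFallP]) <;> ring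

theorem coefClimb0_eq (h : SqrtDiscr x y s D) :
    coefClimb0 x y D = back x y D (coefFall x y D) + back x y D (coefRise0 x y D) + coefClimb0Down x y D := by
  obtain ⟨hD, -, h1, h2, h3, h4⟩ := h
  ext <;> simp only [back, coefClimb0, coefFall, coefRise0, coefClimb0Down, ratl, irratl, add_def, sub_def,
    smul_def, sub_self, mul_zero, add_zero, zero_add, sub_zero, zero_div, mul_one] <;>
    field_simp <;> (try simp only [hD, discr, numClimb0P, numClimb0Q, numFallP, numFallDownP, numClimb0DownP, numClimb0DownM₀]) <;> ring

theorem coefClimb0Down_eq (h : SqrtDiscr x y s D) :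
    back x y D (coefClimb0Down x y D) - y • coefClimb0Down x y D = back x y D (coefClimb0Stay x y D) := by
  obtain ⟨hD, -, h1, h2, h3, h4⟩ := h
  ext <;> simp only [back, coefClimb0Down, coefClimb0Stay, ratl, irratl, add_def, sub_def,
    smul_def, sub_self, mul_zero, add_zero, zero_add, sub_zero, zero_div, mul_one] <;>
    field_simp <;> (try simp only [hD, discr, numClimb0DownP, numFallDownP, numClimb0DownM₀, numClimb0StayP, numClimb0StayQ]) <;> ring

theorem coefClimb0Stay_eq (h : SqrtDiscr x y s D) :
    back x y D (coefClimb0Stay x y D) - y • coefClimb0Stay x y D = x • back x y D (coefClimb0 x y D) := by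
  obtain ⟨hD, -, h1, h2, h3, h4⟩ := h
  ext <;> simp only [back, coefClimb0Stay, coefClimb0, ratl, irratl, add_def, sub_def,
    smul_def, sub_self, mul_zero, add_zero, zero_add, sub_zero, zero_div, mul_one] <;>
    field_simp <;> (try simp only [hD, discr, numClimb0StayP, numClimb0StayQ, numClimb0P, numClimb0Q]) <;> ring

theorem coefRise1_eq (h : SqrtDiscr x y s D) :
    coefRise1 x y D - back x y D (coefRise1 x y D) = coefRise1Stay x y D := by
  obtain ⟨hD, -, h1, h2, h3, h4⟩ := h
  ext <;> simp only [back, coefRise1, coefRise1Stay, ratl, irratl, add_def, sub_def,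
    smul_def, sub_self, mul_zero, add_zero, zero_add, sub_zero, zero_div, mul_one] <;>
    field_simp <;> (try simp only [hD, discr]) <;> ring

theorem coefRise1Stay_eq (h : SqrtDiscr x y s D) :
    back x y D (coefRise1Stay x y D) - y • coefRise0Stay x y D = x • back x y D (coefRise1 x y D) := by
  obtain ⟨hD, -, h1, h2, h3, h4⟩ := h
  ext <;> simp only [back, coefRise1Stay, coefRise0Stay, coefRise1, ratl, irratl, add_def, sub_def,
    smul_def, sub_self, mul_zero, add_zero, zero_add, sub_zero, zero_div, mul_one] <;>
    field_simp <;> (try simp only [hD, discr, numFallDownP]) <;> ring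

theorem coefClimb1_eq (h : SqrtDiscr x y s D) :
    coefClimb1 x y D = back x y D (coefRise1 x y D) + coefClimb1Down x y D := by
  obtain ⟨hD, -, h1, h2, h3, h4⟩ := h
  ext <;> simp only [back, coefClimb1, coefRise1, coefClimb1Down, ratl, irratl, add_def, sub_def,
    smul_def, sub_self, mul_zero, add_zero, zero_add, sub_zero, zero_div, mul_one] <;>
    field_simp <;> (try simp only [hD, discr, numClimb1P, numClimb1Q, numClimb1DownP, numClimb1DownQ, numClimb1DownM₀]) <;> ring

theorem coefClimb1Down_eq (h : SqrtDiscr x y s D) :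
    back x y D (coefClimb1Down x y D) - y • coefClimb1Down x y D = back x y D (coefClimb1Stay x y D) := by
  obtain ⟨hD, -, h1, h2, h3, h4⟩ := h
  ext <;> simp only [back, coefClimb1Down, coefClimb1Stay, ratl, irratl, add_def, sub_def,
    smul_def, sub_self, mul_zero, add_zero, zero_add, sub_zero, zero_div, mul_one] <;>
    field_simp <;> (try simp only [hD, discr, numClimb1DownP, numClimb1DownQ, numClimb1DownM₀, numClimb1Q, numClimb1P]) <;> ring

theorem coefClimb1Stay_eq (h : SqrtDiscr x y s D) :
    back x y D (coefClimb1Stay x y D) - y • coefClimb0Stay x y D = x • back x y D (coefClimb1 x y D) := by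
  obtain ⟨hD, -, h1, h2, h3, h4⟩ := h
  ext <;> simp only [back, coefClimb1Stay, coefClimb0Stay, coefClimb1, ratl, irratl, add_def, sub_def,
    smul_def, sub_self, mul_zero, add_zero, zero_add, sub_zero, zero_div, mul_one] <;>
    field_simp <;> (try simp only [hD, discr, numClimb1Q, numClimb1P, numClimb0StayP, numClimb0StayQ]) <;> ring

theorem coefRise2_eq (h : SqrtDiscr x y s D) :
    coefRise2 x y D - back x y D (coefRise2 x y D) = coefRise2Stay x y D := by
  obtain ⟨hD, -, h1, h2, h3, h4⟩ := h
  ext <;> simp only [back, coefRise2, coefRise2Stay, ratl, irratl, add_def, sub_def,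
    smul_def, sub_self, mul_zero, add_zero, zero_add, sub_zero, zero_div, mul_one] <;>
    field_simp <;> (try simp only [hD, discr, numRise2Q]) <;> ring

theorem coefRise2Stay_eq (h : SqrtDiscr x y s D) :
    back x y D (coefRise2Stay x y D) - y • coefRise1Stay x y D = x • back x y D (coefRise2 x y D) := by
  obtain ⟨hD, -, h1, h2, h3, h4⟩ := h
  ext <;> simp only [back, coefRise2Stay, coefRise1Stay, coefRise2, ratl, irratl, add_def, sub_def,
    smul_def, sub_self, mul_zero, add_zero, zero_add, sub_zero, zero_div, mul_one] <;>
    field_simp <;> (try simp only [hD, discr, numRise2Q]) <;> ring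

theorem coefClimb2_eq (h : SqrtDiscr x y s D) :
    coefClimb2 x y D = back x y D (coefRise2 x y D) + coefClimb2Down x y D := by
  obtain ⟨hD, -, h1, h2, h3, h4⟩ := h
  ext <;> simp only [back, coefClimb2, coefRise2, coefClimb2Down, ratl, irratl, add_def, sub_def,
    smul_def, sub_self, mul_zero, add_zero, zero_add, sub_zero, zero_div, mul_one] <;>
    field_simp <;> (try simp only [hD, discr, numClimb2P, numClimb2Q, numFallDownP, numClimb2M₀, numRise2Q, numClimb2DownP, numClimb2DownL₀, numClimb2DownM₀]) <;> ring

theorem coefClimb2Down_eq (h : SqrtDiscr x y s D) :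
    back x y D (coefClimb2Down x y D) - y • coefClimb2Down x y D = back x y D (coefClimb2Stay x y D) := by
  obtain ⟨hD, -, h1, h2, h3, h4⟩ := h
  ext <;> simp only [back, coefClimb2Down, coefClimb2Stay, ratl, irratl, add_def, sub_def,
    smul_def, sub_self, mul_zero, add_zero, zero_add, sub_zero, zero_div, mul_one] <;>
    field_simp <;> (try simp only [hD, discr, numClimb2DownP, numClimb2DownL₀, numClimb2DownM₀, numClimb2Q, numClimb2P, numClimb2StayM₀]) <;> ring

theorem coefClimb2Stay_eq (h : SqrtDiscr x y s D) :
    back x y D (coefClimb2Stay x y D) - y • coefClimb1Stay x y D = x • back x y D (coefClimb2 x y D) := by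
  obtain ⟨hD, -, h1, h2, h3, h4⟩ := h
  ext <;> simp only [back, coefClimb2Stay, coefClimb1Stay, coefClimb2, ratl, irratl, add_def, sub_def,
    smul_def, sub_self, mul_zero, add_zero, zero_add, sub_zero, zero_div, mul_one] <;>
    field_simp <;> (try simp only [hD, discr, numClimb2Q, numClimb2P, numClimb2DownL₀, numClimb2StayM₀, numClimb1Q, numClimb1P, numFallDownP, numClimb2M₀]) <;> ring

theorem coefRise3_eq (h : SqrtDiscr x y s D) :
    coefRise3 x y D - back x y D (coefRise3 x y D) = coefRise3Stay x y D := by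
  obtain ⟨hD, -, h1, h2, h3, h4⟩ := h
  ext <;> simp only [back, coefRise3, coefRise3Stay, ratl, irratl, add_def, sub_def,
    smul_def, sub_self, mul_zero, add_zero, zero_add, sub_zero, zero_div, mul_one] <;>
    field_simp <;> (try simp only [hD, discr, numRise3P, numRise3Q, numRise3J₀, numRise3StayJ₀]) <;> ring

theorem coefRise3Stay_eq (h : SqrtDiscr x y s D) :
    back x y D (coefRise3Stay x y D) - y • coefRise2Stay x y D = x • back x y D (coefRise3 x y D) := by
  obtain ⟨hD, -, h1, h2, h3, h4⟩ := h
  ext <;> simp only [back, coefRise3Stay, coefRise2Stay, coefRise3, ratl, irratl, add_def, sub_def,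
    smul_def, sub_self, mul_zero, add_zero, zero_add, sub_zero, zero_div, mul_one] <;>
    field_simp <;> (try simp only [hD, discr, numRise3Q, numRise3P, numRise3StayJ₀, numRise2Q, numRise3J₀]) <;> ring

theorem coefClimb3_eq (h : SqrtDiscr x y s D) :
    coefClimb3 x y D = back x y D (coefRise3 x y D) + coefClimb3Down x y D := by
  obtain ⟨hD, -, h1, h2, h3, h4⟩ := h
  ext <;> simp only [back, coefClimb3, coefRise3, coefClimb3Down, ratl, irratl, add_def, sub_def,
    smul_def, sub_self, mul_zero, add_zero, zero_add, sub_zero, zero_div, mul_one] <;>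
    field_simp <;> (try simp only [hD, discr, numClimb3P, numClimb3Q, numClimb3L₀, numClimb3M₀, numClimb3J₀, numRise3P, numRise3Q, numRise3J₀, numClimb3DownP, numClimb3DownQ, numClimb3DownL₀, numClimb3DownM₀, numClimb3DownJ₀]) <;> ring

theorem coefClimb3Down_eq (h : SqrtDiscr x y s D) :
    back x y D (coefClimb3Down x y D) - y • coefClimb3Down x y D = back x y D (coefClimb3Stay x y D) := by
  obtain ⟨hD, -, h1, h2, h3, h4⟩ := h
  ext <;> simp only [back, coefClimb3Down, coefClimb3Stay, ratl, irratl, add_def, sub_def,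
    smul_def, sub_self, mul_zero, add_zero, zero_add, sub_zero, zero_div, mul_one] <;>
    field_simp <;> (try simp only [hD, discr, numClimb3DownP, numClimb3DownQ, numClimb3DownL₀, numClimb3DownM₀, numClimb3DownJ₀, numClimb3Q, numClimb3P, numClimb3StayL₀, numClimb3StayM₀, numClimb3StayJ₀]) <;> ring

theorem coefClimb3Stay_eq (h : SqrtDiscr x y s D) :
    back x y D (coefClimb3Stay x y D) - y • coefClimb2Stay x y D = x • back x y D (coefClimb3 x y D) := by
  obtain ⟨hD, -, h1, h2, h3, h4⟩ := h
  ext <;> simp only [back, coefClimb3Stay, coefClimb2Stay, coefClimb3, ratl, irratl, add_def, sub_def,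
    smul_def, sub_self, mul_zero, add_zero, zero_add, sub_zero, zero_div, mul_one] <;>
    field_simp <;> (try simp only [hD, discr, numClimb3Q, numClimb3P, numClimb3StayL₀, numClimb3StayM₀, numClimb3StayJ₀, numClimb2Q, numClimb2P, numClimb2DownL₀, numClimb2StayM₀, numClimb3L₀, numClimb3M₀, numClimb3J₀]) <;> ring

/-- From here on a vector describes the sum of the sequences for `r = 2` and `r = 3`. Only this sum
is needed, and the climbs by two and by three enter together. -/
theorem coefDip_eq (h : SqrtDiscr x y s D) :
    (1 - x) • coefDip x y D - back x y D (coefDip x y D) = x • (back x y D (coefRise2 x y D) + back x y D (coefRise3 x y D)) := by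
  obtain ⟨hD, -, h1, h2, h3, h4⟩ := h
  ext <;> simp only [back, coefDip, coefRise2, coefRise3, ratl, irratl, add_def, sub_def,
    smul_def, sub_self, mul_zero, add_zero, zero_add, sub_zero, zero_div, mul_one] <;>
    field_simp <;> (try simp only [hD, discr, numDipP, numDipQ, numDipL₀, numDipJ₀, numDipJ₁, numRise2Q, numRise3P, numRise3Q, numRise3J₀]) <;> ring

theorem coefLand_eq (h : SqrtDiscr x y s D) :
    back x y D (coefLand x y D) - y • coefLand x y D = x • (back x y D (coefClimb2 x y D) + back x y D (coefClimb3 x y D)) := by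
  obtain ⟨hD, -, h1, h2, h3, h4⟩ := h
  ext <;> simp only [back, coefLand, coefClimb2, coefClimb3, ratl, irratl, add_def, sub_def,
    smul_def, sub_self, mul_zero, add_zero, zero_add, sub_zero, zero_div, mul_one] <;>
    field_simp <;> (try simp only [hD, discr, numLandP, numLandQ, numLandL₀, numLandM₀, numLandJ₀, numClimb2P, numClimb2Q, numFallDownP, numClimb2M₀, numClimb3P, numClimb3Q, numClimb3L₀, numClimb3M₀, numClimb3J₀]) <;> ring

theorem coefDipFall_eq (h : SqrtDiscr x y s D) :
    coefDipFall x y D = back x y D (coefDip x y D) + back x y D (coefLand x y D) + coefDipFallDown x y D := by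
  obtain ⟨hD, -, h1, h2, h3, h4⟩ := h
  ext <;> simp only [back, coefDipFall, coefDip, coefLand, coefDipFallDown, ratl, irratl, add_def, sub_def,
    smul_def, sub_self, mul_zero, add_zero, zero_add, sub_zero, zero_div, mul_one] <;>
    field_simp <;> (try simp only [hD, discr, numDipFallP, numDipFallQ, numDipFallL₀, numDipFallM₀, numDipFallJ₀, numDipFallJ₁, numDipP, numDipQ, numDipL₀, numDipJ₀, numDipJ₁, numLandP, numLandQ, numLandL₀, numLandM₀, numLandJ₀, numDipFallDownL₀, numDipFallDownM₀, numDipFallDownJ₀, numDipFallDownJ₁]) <;> ring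

theorem coefDipFallDown_eq (h : SqrtDiscr x y s D) :
    back x y D (coefDipFallDown x y D) - y • coefDipFallDown x y D = x • back x y D (coefDipFall x y D) := by
  obtain ⟨hD, -, h1, h2, h3, h4⟩ := h
  ext <;> simp only [back, coefDipFallDown, coefDipFall, ratl, irratl, add_def, sub_def,
    smul_def, sub_self, mul_zero, add_zero, zero_add, sub_zero, zero_div, mul_one] <;>
    field_simp <;> (try simp only [hD, discr, numLandQ, numLandP, numDipFallDownL₀, numDipFallDownM₀, numDipFallDownJ₀, numDipFallDownJ₁, numDipFallP, numDipFallQ, numDipFallL₀, numDipFallM₀, numDipFallJ₀, numDipFallJ₁]) <;> ring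

theorem coefPeak_eq (h : SqrtDiscr x y s D) :
    coefPeak x y D = back x y D (coefDip x y D) + coefPeakUp x y D := by
  obtain ⟨hD, -, h1, h2, h3, h4⟩ := h
  ext <;> simp only [back, coefPeak, coefDip, coefPeakUp, ratl, irratl, add_def, sub_def,
    smul_def, sub_self, mul_zero, add_zero, zero_add, sub_zero, zero_div, mul_one] <;>
    field_simp <;> (try simp only [hD, discr, numDipFallP, numDipFallQ, numPeakL₀, numPeakM₀, numPeakL₁, numPeakM₁, numPeakJ₀, numPeakJ₁, numDipP, numDipQ, numDipL₀, numDipJ₀, numDipJ₁, numLandP, numLandQ, numPeakUpL₀, numPeakUpM₀, numPeakUpJ₀]) <;> ring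

theorem coefPeakUp_eq (h : SqrtDiscr x y s D) :
    coefPeakUp x y D - back x y D (coefPeakUp x y D) = coefPeakStay x y D := by
  obtain ⟨hD, -, h1, h2, h3, h4⟩ := h
  ext <;> simp only [back, coefPeakUp, coefPeakStay, ratl, irratl, add_def, sub_def,
    smul_def, sub_self, mul_zero, add_zero, zero_add, sub_zero, zero_div, mul_one] <;>
    field_simp <;> (try simp only [hD, discr, numLandP, numLandQ, numPeakUpL₀, numPeakUpM₀, numPeakL₁, numPeakM₁, numPeakUpJ₀, numPeakStayL₀, numPeakStayM₀, numPeakStayL₁, numPeakStayM₁, numPeakStayJ₀]) <;> ring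

theorem coefPeakStay_eq (h : SqrtDiscr x y s D) :
    back x y D (coefPeakStay x y D) - y • coefPeakStay x y D = x • back x y D (coefPeak x y D) := by
  obtain ⟨hD, -, h1, h2, h3, h4⟩ := h
  ext <;> simp only [back, coefPeakStay, coefPeak, ratl, irratl, add_def, sub_def,
    smul_def, sub_self, mul_zero, add_zero, zero_add, sub_zero, zero_div, mul_one] <;>
    field_simp <;> (try simp only [hD, discr, numLandQ, numLandP, numPeakStayL₀, numPeakStayM₀, numPeakStayL₁, numPeakStayM₁, numPeakStayJ₀, numDipFallP, numDipFallQ, numPeakL₀, numPeakM₀, numPeakL₁, numPeakM₁, numPeakJ₀, numPeakJ₁]) <;> ring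

theorem coefPeakFall_eq (h : SqrtDiscr x y s D) :
    coefPeakFall x y D = back x y D (coefDipFall x y D) + back x y D (coefPeakUp x y D) + coefPeakFallDown x y D := by
  obtain ⟨hD, -, h1, h2, h3, h4⟩ := h
  ext <;> simp only [back, coefPeakFall, coefDipFall, coefPeakUp, coefPeakFallDown, ratl, irratl, add_def, sub_def,
    smul_def, sub_self, mul_zero, add_zero, zero_add, sub_zero, zero_div, mul_one] <;>
    field_simp <;> (try simp only [hD, discr, numPeakFallP, numPeakFallQ, numPeakFallL₀, numPeakFallM₀, numPeakFallL₁, numDipL₀, numPeakFallJ₀, numPeakFallK₀, numPeakFallJ₁, numDipFallP, numDipFallQ, numDipFallL₀, numDipFallM₀, numDipFallJ₀, numDipFallJ₁, numLandP, numLandQ, numPeakUpL₀, numPeakUpM₀, numPeakL₁, numPeakM₁, numPeakUpJ₀, numPeakFallDownP, numPeakFallDownQ, numPeakFallDownL₀, numPeakFallDownM₀, numPeakFallDownL₁, numClimb2StayM₀, numPeakFallDownJ₀, numPeakFallDownJ₁]) <;> ring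

theorem coefPeakFallDown_eq (h : SqrtDiscr x y s D) :
    back x y D (coefPeakFallDown x y D) - y • coefPeakFallDown x y D = back x y D (coefPeakFallStay x y D) := by
  obtain ⟨hD, -, h1, h2, h3, h4⟩ := h
  ext <;> simp only [back, coefPeakFallDown, coefPeakFallStay, ratl, irratl, add_def, sub_def,
    smul_def, sub_self, mul_zero, add_zero, zero_add, sub_zero, zero_div, mul_one] <;>
    field_simp <;> (try simp only [hD, discr, numPeakFallDownP, numPeakFallDownQ, numPeakFallDownL₀, numPeakFallDownM₀, numPeakFallDownL₁, numClimb2StayM₀, numPeakFallDownJ₀, numPeakFallDownJ₁, numPeakFallStayP, numPeakFallStayQ, numPeakFallStayL₀, numPeakFallStayM₀, numPeakFallStayL₁, numPeakFallStayM₁, numPeakFallStayJ₀, numPeakFallStayJ₁]) <;> ring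

theorem coefPeakFallStay_eq (h : SqrtDiscr x y s D) :
    back x y D (coefPeakFallStay x y D) - y • coefPeakFallStay x y D = x • back x y D (coefPeakFall x y D) := by
  obtain ⟨hD, -, h1, h2, h3, h4⟩ := h
  ext <;> simp only [back, coefPeakFallStay, coefPeakFall, ratl, irratl, add_def, sub_def,
    smul_def, sub_self, mul_zero, add_zero, zero_add, sub_zero, zero_div, mul_one] <;>
    field_simp <;> (try simp only [hD, discr, numPeakFallStayP, numPeakFallStayQ, numPeakFallStayL₀, numPeakFallStayM₀, numPeakFallStayL₁, numPeakFallStayM₁, numPeakFallStayJ₀, numPeakFallStayJ₁, numPeakFallP, numPeakFallQ, numPeakFallL₀, numPeakFallM₀, numPeakFallL₁, numDipL₀, numPeakFallJ₀, numPeakFallK₀, numPeakFallJ₁]) <;> ring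

/-- The values at height zero serve as initial values of the forward recurrences. Here the value is
`1` because the closed form belongs to `1 + fallT`. -/
theorem coefFall_zeroRat (h : SqrtDiscr x y s D) : zeroRat (coefFall x y D) = 1 := by
  obtain ⟨hD, -, h1, h2, h3, h4⟩ := h
  simp only [zeroRat, coefFall]
  field_simp
  simp only [hD, discr, numFallP]
  ring

theorem coefFall_zeroIrr (h : SqrtDiscr x y s D) : zeroIrr (coefFall x y D) = 0 := by
  obtain ⟨hD, -, h1, h2, h3, h4⟩ := h
  simp only [zeroIrr, coefFall]
  field_simp
  try simp only [hD, discr, numFallP]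
  ring

theorem coefRise1_zeroRat (h : SqrtDiscr x y s D) : zeroRat (coefRise1 x y D) = 0 := by
  obtain ⟨hD, -, h1, h2, h3, h4⟩ := h
  simp only [zeroRat, coefRise1]
  field_simp
  simp only [hD, discr]
  ring

theorem coefRise1_zeroIrr (h : SqrtDiscr x y s D) : zeroIrr (coefRise1 x y D) = 0 := by
  obtain ⟨hD, -, h1, h2, h3, h4⟩ := h
  simp only [zeroIrr, coefRise1]
  field_simp
  try simp only [hD, discr]
  ring

theorem coefRise2_zeroRat (h : SqrtDiscr x y s D) : zeroRat (coefRise2 x y D) = 0 := by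
  obtain ⟨hD, -, h1, h2, h3, h4⟩ := h
  simp only [zeroRat, coefRise2]
  field_simp
  simp only [hD, discr, numRise2Q]
  ring

theorem coefRise2_zeroIrr (h : SqrtDiscr x y s D) : zeroIrr (coefRise2 x y D) = 0 := by
  obtain ⟨hD, -, h1, h2, h3, h4⟩ := h
  simp only [zeroIrr, coefRise2]
  field_simp
  try simp only [hD, discr, numRise2Q]
  ring

theorem coefRise3_zeroRat (h : SqrtDiscr x y s D) : zeroRat (coefRise3 x y D) = 0 := by
  obtain ⟨hD, -, h1, h2, h3, h4⟩ := h
  simp only [zeroRat, coefRise3]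
  field_simp
  simp only [hD, discr, numRise3P, numRise3Q, numRise3J₀]
  ring

theorem coefRise3_zeroIrr (h : SqrtDiscr x y s D) : zeroIrr (coefRise3 x y D) = 0 := by
  obtain ⟨hD, -, h1, h2, h3, h4⟩ := h
  simp only [zeroIrr, coefRise3]
  field_simp
  try simp only [hD, discr, numRise3P, numRise3Q, numRise3J₀]
  ring

theorem coefDip_zeroRat (h : SqrtDiscr x y s D) : zeroRat (coefDip x y D) = 0 := by
  obtain ⟨hD, -, h1, h2, h3, h4⟩ := h
  simp only [zeroRat, coefDip]
  field_simp
  simp only [hD, discr, numDipP, numDipQ, numDipL₀, numDipJ₀, numDipJ₁]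
  ring

theorem coefDip_zeroIrr (h : SqrtDiscr x y s D) : zeroIrr (coefDip x y D) = 0 := by
  obtain ⟨hD, -, h1, h2, h3, h4⟩ := h
  simp only [zeroIrr, coefDip]
  field_simp
  try simp only [hD, discr, numDipP, numDipQ, numDipL₀, numDipJ₀, numDipJ₁]
  ring

theorem coefPeakUp_zeroRat (h : SqrtDiscr x y s D) : zeroRat (coefPeakUp x y D) = 0 := by
  obtain ⟨hD, -, h1, h2, h3, h4⟩ := h
  simp only [zeroRat, coefPeakUp]
  field_simp
  simp only [hD, discr, numLandP, numLandQ, numPeakUpL₀, numPeakUpM₀, numPeakL₁, numPeakM₁, numPeakUpJ₀]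
  ring

theorem coefPeakUp_zeroIrr (h : SqrtDiscr x y s D) : zeroIrr (coefPeakUp x y D) = 0 := by
  obtain ⟨hD, -, h1, h2, h3, h4⟩ := h
  simp only [zeroIrr, coefPeakUp]
  field_simp
  try simp only [hD, discr, numLandP, numLandQ, numPeakUpL₀, numPeakUpM₀, numPeakL₁, numPeakM₁, numPeakUpJ₀]
  ring

end

section
open Coef
set_option linter.unusedSectionVars false
variable {K : Type*} [Field K] [CharZero K] {x y s D : K}

theorem coefRise0_zeroRat (h : SqrtDiscr x y s D) : zeroRat (coefRise0 x y D) = 0 := by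
  obtain ⟨hD, -, h1, h2, h3, h4⟩ := h
  simp only [zeroRat, coefRise0]
  field_simp
  ring

theorem coefRise0_zeroIrr (h : SqrtDiscr x y s D) : zeroIrr (coefRise0 x y D) = 0 := by
  obtain ⟨hD, -, h1, h2, h3, h4⟩ := h
  simp only [zeroIrr, coefRise0]
  ring

end

/-! ### Evaluation at height one -/

section
open Coef
set_option linter.unusedSectionVars false
set_option linter.unusedSimpArgs false

variable {K : Type*} [Field K] [CharZero K] {x y s D : K}

namespace Coef

/-- The rational part of the value at `1` of a linear combination of the basis sequences. -/
def oneRat (x y D : K) (c : Coef K) : K :=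
  (c.p + x * c.q + c.j₀ + 2 * c.j₁ + 3 * c.j₂) / (1 - x)
    + ((1 + y - x) * (c.l₀ + 2 * c.l₁) - D * (c.m₀ + 2 * c.m₁)) / (2 * y)

/-- The coefficient of `s` in the value at `1` of a linear combination of the basis sequences. -/
def oneIrr (x y : K) (c : Coef K) : K :=
  c.k₀ / (1 - x) + ((1 + y - x) * (c.m₀ + 2 * c.m₁) - (c.l₀ + 2 * c.l₁)) / (2 * y)

end Coef

/-- The bracket is the rational part of the sum of the two series `riseT` at height one: the closed
form, minus `y * B₂`, plus `B₁`. Here `B₁` and `B₂` are the corrections at heights one and two that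
are found in `rise_dec`. -/
theorem total_rat (h : SqrtDiscr x y s D) :
    y * (oneRat x y D (coefPeakFallStay x y D) + x * y * zeroRat (coefLand x y D) / (1 - x) ^ 2 +
      (2 * y * -(x * zeroRat (coefLand x y D) / (1 - x) ^ 2) -
        x * zeroRat (coefDipFall x y D)) / (1 - x)) =
      -(x ^ 2 * polyB x y / ((1 - x) ^ 5 * ((1 - x) ^ 2 - y) ^ 3 * D ^ 3)) := by
  obtain ⟨hD, -, h1, h2, h3, h4⟩ := h
  simp only [oneRat, zeroRat, coefPeakFallStay, coefLand, coefDipFall]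
  field_simp
  simp only [polyB, hD, discr, numPeakFallStayP, numPeakFallStayQ, numPeakFallStayL₀, numPeakFallStayM₀,
    numPeakFallStayL₁, numPeakFallStayM₁, numPeakFallStayJ₀, numPeakFallStayJ₁, numLandP,
    numLandQ, numLandL₀, numLandM₀, numLandJ₀, numDipFallP, numDipFallQ, numDipFallL₀,
    numDipFallM₀, numDipFallJ₀, numDipFallJ₁]
  ring

/-- The same for the coefficient of `s`. After multiplication by `s` the denominator `D ^ 3 = s ^ 6`
becomes the odd power `s ^ 5`. -/
theorem total_irr (h : SqrtDiscr x y s D) :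
    y * (oneIrr x y (coefPeakFallStay x y D) + x * y * zeroIrr (coefLand x y D) / (1 - x) ^ 2 +
      (2 * y * -(x * zeroIrr (coefLand x y D) / (1 - x) ^ 2) -
        x * zeroIrr (coefDipFall x y D)) / (1 - x)) =
      -(2 * x ^ 2 * polyA x y / ((1 - x) ^ 3 * ((1 - x) ^ 2 - y) * D ^ 3)) := by
  obtain ⟨hD, -, h1, h2, h3, h4⟩ := h
  simp only [oneIrr, zeroIrr, coefPeakFallStay, coefLand, coefDipFall]
  field_simp
  simp only [polyA, hD, discr, numPeakFallStayP, numPeakFallStayQ, numPeakFallStayL₀, numPeakFallStayM₀,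
    numPeakFallStayL₁, numPeakFallStayM₁, numPeakFallStayJ₀, numPeakFallStayJ₁, numLandP,
    numLandQ, numLandL₀, numLandM₀, numLandJ₀, numDipFallP, numDipFallQ, numDipFallL₀,
    numDipFallM₀, numDipFallJ₀, numDipFallJ₁]
  ring

end

/-! ### The basis sequences -/

section eval

variable {K : Type*} [Field K]

/-- The rational and the irrational part of `(1 - √x)⁻ⁿ`. -/
def ratIrrat (x : K) : ℕ → K × K
  | 0 => (1, 0)
  -- Multiplication by `1 / (1 - √x) = (1 + √x) / (1 - x)`. The second component is scaled by `√x`,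
  -- so the pair `(p, q)` stands for `p + q / √x`.
  | n + 1 => (((ratIrrat x n).1 + (ratIrrat x n).2) / (1 - x),
      (x * (ratIrrat x n).1 + (ratIrrat x n).2) / (1 - x))

/-- The linear combination of the basis sequences with the given coefficients. -/
def Coef.eval (x y s : K) (c : Coef K) (n : ℕ) : K :=
  c.p * (ratIrrat x n).1 + c.q * (ratIrrat x n).2 +
    (c.l₀ + c.m₀ * s + (c.l₁ + c.m₁ * s) * (n + 1)) * (((1 + y - x + s) / 2) ^ n)⁻¹ +
    (c.j₀ + c.k₀ * s + c.j₁ * (n + 1) + c.j₂ * ((n + 1) * (n + 2) / 2)) * ((1 - x) ^ n)⁻¹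

namespace Coef

variable {x y s D : K}

theorem eval_add (c d : Coef K) (n : ℕ) :
    (c + d).eval x y s n = c.eval x y s n + d.eval x y s n := by
  simp only [eval, add_def]
  ring

theorem eval_sub (c d : Coef K) (n : ℕ) :
    (c - d).eval x y s n = c.eval x y s n - d.eval x y s n := by
  simp only [eval, sub_def]
  ring

theorem eval_smul (r : K) (c : Coef K) (n : ℕ) :
    (r • c).eval x y s n = r * c.eval x y s n := by
  simp only [eval, smul_def]
  ring

theorem eval_ratl (n : ℕ) : (ratl : Coef K).eval x y s n = (ratIrrat x n).1 := by
  simp [eval, ratl]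

theorem eval_irratl (n : ℕ) : (irratl : Coef K).eval x y s n = (ratIrrat x n).2 := by
  simp [eval, irratl]

theorem eval_zero (c : Coef K) [CharZero K] : c.eval x y s 0 = zeroRat c + zeroIrr c * s := by
  simp only [eval, ratIrrat, zeroRat, zeroIrr, pow_zero, Nat.cast_zero]
  field_simp
  ring

variable [CharZero K]

/-- The two factors are the roots of `z ^ 2 - (1 + y - x) * z + y`. When `s` is a power series with
constant term `1`, the first root is a unit and the second is not. Only powers of the first occur in
the closed forms. -/
theorem rate_mul (h : SqrtDiscr x y s D) :
    ((1 + y - x + s) / 2) * ((1 + y - x - s) / 2) = y := by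
  have h1 := h.sq_eq
  rw [h.discr_eq, discr] at h1
  linear_combination (-1 / 4) * h1

theorem rate_ne (h : SqrtDiscr x y s D) : (1 + y - x + s) / 2 ≠ 0 := by
  intro h0
  have := rate_mul h
  rw [h0, zero_mul] at this
  exact h.y_ne this.symm

/-- The polynomial factors are expanded in `1`, `n + 1` and `(n + 1) * (n + 2) / 2`. In this basis
lowering the argument takes differences of neighbouring coefficients, and the exponential factor
contributes `λ` or `1 - x`. -/
theorem eval_back (h : SqrtDiscr x y s D) (c : Coef K) (n : ℕ) :
    (back x y D c).eval x y s (n + 1) = c.eval x y s n := by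
  have h1 := h.one_sub_x
  have h2 := h.sq_eq
  have h3 := rate_ne h
  have e1 : (back x y D c).p * (ratIrrat x (n + 1)).1 + (back x y D c).q * (ratIrrat x (n + 1)).2
      = c.p * (ratIrrat x n).1 + c.q * (ratIrrat x n).2 := by
    simp only [back, ratIrrat]
    field_simp
    ring
  have e2 : ((back x y D c).l₀ + (back x y D c).m₀ * s +
      ((back x y D c).l₁ + (back x y D c).m₁ * s) * ((n + 1 : ℕ) + 1)) *
        (((1 + y - x + s) / 2) ^ (n + 1))⁻¹ =
      (c.l₀ + c.m₀ * s + (c.l₁ + c.m₁ * s) * (n + 1)) * (((1 + y - x + s) / 2) ^ n)⁻¹ := by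
    have e3 : (back x y D c).l₀ + (back x y D c).m₀ * s +
        ((back x y D c).l₁ + (back x y D c).m₁ * s) * ((n + 1 : ℕ) + 1) =
        (c.l₀ + c.m₀ * s + (c.l₁ + c.m₁ * s) * (n + 1)) * ((1 + y - x + s) / 2) := by
      simp only [back]
      rw [← h2]
      push_cast
      ring
    rw [e3, pow_succ, mul_inv, mul_assoc, mul_left_comm ((1 + y - x + s) / 2),
      mul_inv_cancel₀ h3, mul_one]
  have e4 : ((back x y D c).j₀ + (back x y D c).k₀ * s + (back x y D c).j₁ * ((n + 1 : ℕ) + 1) +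
      (back x y D c).j₂ * (((n + 1 : ℕ) + 1) * ((n + 1 : ℕ) + 2) / 2)) * ((1 - x) ^ (n + 1))⁻¹ =
      (c.j₀ + c.k₀ * s + c.j₁ * (n + 1) + c.j₂ * ((n + 1) * (n + 2) / 2)) * ((1 - x) ^ n)⁻¹ := by
    have e3 : (back x y D c).j₀ + (back x y D c).k₀ * s +
        (back x y D c).j₁ * ((n + 1 : ℕ) + 1) +
        (back x y D c).j₂ * (((n + 1 : ℕ) + 1) * ((n + 1 : ℕ) + 2) / 2) =
        (c.j₀ + c.k₀ * s + c.j₁ * (n + 1) + c.j₂ * ((n + 1) * (n + 2) / 2)) * (1 - x) := by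
      simp only [back]
      push_cast
      ring
    rw [e3, pow_succ, mul_inv, mul_assoc, mul_left_comm (1 - x), mul_inv_cancel₀ h1, mul_one]
  rw [eval, eval, e1, e2, e4]

theorem eval_one (h : SqrtDiscr x y s D) (c : Coef K) :
    c.eval x y s 1 = oneRat x y D c + oneIrr x y c * s := by
  have h1 := h.one_sub_x
  have h2 := h.y_ne
  have h3 : ((1 + y - x + s) / 2)⁻¹ = (1 + y - x - s) / (2 * y) := by
    rw [inv_eq_iff_eq_inv, inv_div, eq_div_iff_mul_eq]
    · linear_combination 2 * rate_mul h
    · intro h0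
      have := rate_mul h
      rw [h0, zero_div, mul_zero] at this
      exact h2 this.symm
  simp only [eval, ratIrrat, oneRat, oneIrr, pow_one, h3, Nat.cast_one, ← h.sq_eq]
  field_simp
  ring

end Coef

end eval

/-! ### Uniqueness of solutions with a common denominator -/

section uniqueness

open MvPowerSeries (X)

/-- A power series in two variables as an element of a field of fractions. -/
abbrev emb (K : Type*) [Field K] [Algebra (MvPowerSeries (Fin 2) ℚ) K] :
    MvPowerSeries (Fin 2) ℚ →+* K :=
  algebraMap _ K

variable {K : Type*} [Field K] [Algebra (MvPowerSeries (Fin 2) ℚ) K]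

/-- The terms of the sequence have a common denominator. -/
def BoundedDenom (f : ℕ → K) : Prop :=
  ∃ d : MvPowerSeries (Fin 2) ℚ, d ≠ 0 ∧ ∀ n, emb K d * f n ∈ (emb K).range

namespace BoundedDenom

variable {f g : ℕ → K}

theorem of_mem_range (h : ∀ n, f n ∈ (emb K).range) : BoundedDenom f :=
  ⟨1, one_ne_zero, fun n => by rw [map_one, one_mul]; exact h n⟩

theorem add (hf : BoundedDenom f) (hg : BoundedDenom g) : BoundedDenom fun n => f n + g n := by
  obtain ⟨d, hd, hf⟩ := hf
  obtain ⟨e, he, hg⟩ := hg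
  refine ⟨d * e, mul_ne_zero hd he, fun n => ?_⟩
  have : emb K (d * e) * (f n + g n) = emb K e * (emb K d * f n) + emb K d * (emb K e * g n) := by
    rw [map_mul]; ring
  rw [this]
  exact add_mem (mul_mem ⟨e, rfl⟩ (hf n)) (mul_mem ⟨d, rfl⟩ (hg n))

theorem const_mul [IsFractionRing (MvPowerSeries (Fin 2) ℚ) K] (c : K) (hf : BoundedDenom f) :
    BoundedDenom fun n => c * f n := by
  obtain ⟨d, hd, hf⟩ := hf
  obtain ⟨a, b, hb, rfl⟩ := IsFractionRing.div_surjective (A := MvPowerSeries (Fin 2) ℚ) c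
  have hb0 : emb K b ≠ 0 := IsFractionRing.to_map_ne_zero_of_mem_nonZeroDivisors hb
  refine ⟨b * d, mul_ne_zero (nonZeroDivisors.ne_zero hb) hd, fun n => ?_⟩
  have : emb K (b * d) * (algebraMap _ K a / algebraMap _ K b * f n) =
      emb K a * (emb K d * f n) := by
    rw [map_mul]; field_simp
  rw [this]
  exact mul_mem ⟨a, rfl⟩ (hf n)

theorem sub [IsFractionRing (MvPowerSeries (Fin 2) ℚ) K] (hf : BoundedDenom f)
    (hg : BoundedDenom g) : BoundedDenom fun n => f n - g n := by
  simpa [sub_eq_add_neg] using hf.add (hg.const_mul (-1))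

end BoundedDenom

theorem emb_inv_mem_range {u : MvPowerSeries (Fin 2) ℚ}
    (hu : MvPowerSeries.constantCoeff u ≠ 0) : (emb K u)⁻¹ ∈ (emb K).range :=
  ⟨u⁻¹, eq_inv_of_mul_eq_one_left (by rw [← map_mul, MvPowerSeries.inv_mul_cancel _ hu, map_one])⟩

theorem eq_zero_of_forall_X_pow_dvd {f : MvPowerSeries (Fin 2) ℚ}
    (h : ∀ k, (X 1 : MvPowerSeries (Fin 2) ℚ) ^ k ∣ f) : f = 0 := by
  ext m
  rw [map_zero]
  exact MvPowerSeries.X_pow_dvd_iff.1 (h (m 1 + 1)) m (Nat.lt_succ_self _)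

theorem isUnit_of_constantCoeff_ne_zero {u : MvPowerSeries (Fin 2) ℚ}
    (hu : MvPowerSeries.constantCoeff u ≠ 0) : IsUnit u :=
  IsUnit.of_mul_eq_one _ (MvPowerSeries.mul_inv_cancel _ hu)

/-- Each use of the recurrence gains a factor `y`, so all terms are divisible by every power of `y`.
No boundary value is needed, and this is what excludes the superfluous roots of the characteristic
equation. -/
theorem eq_zero_of_backward_recurrence {u α β : MvPowerSeries (Fin 2) ℚ}
    (hu : MvPowerSeries.constantCoeff u ≠ 0) {f : ℕ → MvPowerSeries (Fin 2) ℚ} {n₀ : ℕ}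
    (h : ∀ n, n₀ ≤ n → u * f n = X 1 * (α * f (n + 1) + β * f (n + 2))) (n : ℕ) (hn : n₀ ≤ n) :
    f n = 0 := by
  refine eq_zero_of_forall_X_pow_dvd fun k => ?_
  induction k generalizing n with
  | zero => simp
  | succ k ih =>
    rw [← (isUnit_of_constantCoeff_ne_zero hu).dvd_mul_left, h n hn, pow_succ']
    exact mul_dvd_mul_left _ (dvd_add ((ih _ (by omega)).mul_left _) ((ih _ (by omega)).mul_left _))

/-- The terms ahead come with a factor `y` and are handled by induction on the power of `y`. The
term behind is handled by an inner induction on `n`, which starts from `f 0 = 0`. -/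
theorem eq_zero_of_forward_recurrence {u : MvPowerSeries (Fin 2) ℚ}
    (hu : MvPowerSeries.constantCoeff u ≠ 0) {f : ℕ → MvPowerSeries (Fin 2) ℚ} (h0 : f 0 = 0)
    (h : ∀ n, u * f (n + 1) = f n + X 1 * (f (n + 2) - f (n + 1))) (n : ℕ) : f n = 0 := by
  refine eq_zero_of_forall_X_pow_dvd fun k => ?_
  induction k generalizing n with
  | zero => simp
  | succ k ih =>
    induction n with
    | zero => simp [h0]
    | succ n ih' =>
      rw [← (isUnit_of_constantCoeff_ne_zero hu).dvd_mul_left, h n]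
      refine dvd_add ih' ?_
      rw [pow_succ']
      exact mul_dvd_mul_left _ (dvd_sub (ih _) (ih _))

variable [IsFractionRing (MvPowerSeries (Fin 2) ℚ) K]

theorem emb_injective : Function.Injective (emb K) := IsFractionRing.injective _ K

/-- The closed forms have denominators, such as `y` and `Δ`, and so they live in the field of
fractions. Multiplying by a common denominator of all terms brings back power series. -/
theorem BoundedDenom.eq_zero_of_backward {u α β : MvPowerSeries (Fin 2) ℚ}
    (hu : MvPowerSeries.constantCoeff u ≠ 0) {f : ℕ → K} (hf : BoundedDenom f) {n₀ : ℕ}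
    (h : ∀ n, n₀ ≤ n → emb K u * f n =
      emb K (X 1) * (emb K α * f (n + 1) + emb K β * f (n + 2))) (n : ℕ) (hn : n₀ ≤ n) :
    f n = 0 := by
  obtain ⟨d, hd, hf⟩ := hf
  choose g hg using hf
  have hd' : emb K d ≠ 0 := fun h => hd (emb_injective (by rw [h, map_zero]))
  have : g n = 0 := eq_zero_of_backward_recurrence (α := α) (β := β) hu (fun m hm => by
    apply emb_injective (K := K)
    simp only [map_mul, map_add, hg]
    linear_combination emb K d * h m hm) n hn
  have h1 := hg n
  rw [this, map_zero] at h1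
  exact (mul_eq_zero.1 h1.symm).resolve_left hd'

theorem BoundedDenom.eq_zero_of_forward {u : MvPowerSeries (Fin 2) ℚ}
    (hu : MvPowerSeries.constantCoeff u ≠ 0) {f : ℕ → K} (hf : BoundedDenom f) (h0 : f 0 = 0)
    (h : ∀ n, emb K u * f (n + 1) = f n + emb K (X 1) * (f (n + 2) - f (n + 1))) (n : ℕ) :
    f n = 0 := by
  obtain ⟨d, hd, hf⟩ := hf
  choose g hg using hf
  have hd' : emb K d ≠ 0 := fun h => hd (emb_injective (by rw [h, map_zero]))
  have : g n = 0 := eq_zero_of_forward_recurrence hu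
    (emb_injective (K := K) (by rw [hg, h0, mul_zero, map_zero])) (fun m => by
    apply emb_injective (K := K)
    simp only [map_mul, map_add, map_sub, hg]
    linear_combination emb K d * h m) n
  have h1 := hg n
  rw [this, map_zero] at h1
  exact (mul_eq_zero.1 h1.symm).resolve_left hd'

/-- The basis sequences consist of power series, since `1 - x` and `(1 + y - x + s) / 2` have
constant term `1`. So the denominators come only from the finitely many coefficients. The choice of
the sign of the square root matters here. -/
theorem boundedDenom_eval {s : MvPowerSeries (Fin 2) ℚ} (hs : MvPowerSeries.constantCoeff s = 1)
    (c : Coef K) : BoundedDenom (c.eval (emb K (X 0)) (emb K (X 1)) (emb K s)) := by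
  have h1 : (1 - emb K (X 0))⁻¹ ∈ (emb K).range := by
    rw [← map_one (emb K), ← map_sub]
    exact emb_inv_mem_range (by simp)
  have h2 : ((1 + emb K (X 1) - emb K (X 0) + emb K s) / 2)⁻¹ ∈ (emb K).range := by
    rw [inv_div, div_eq_mul_inv, ← map_one (emb K), ← map_add, ← map_sub, ← map_add]
    exact mul_mem ⟨2, map_ofNat _ 2⟩ (emb_inv_mem_range (by simp [hs]))
  have h3 : ∀ n, (ratIrrat (emb K (X 0)) n).1 ∈ (emb K).range ∧
      (ratIrrat (emb K (X 0)) n).2 ∈ (emb K).range := by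
    intro n
    induction n with
    | zero => exact ⟨one_mem _, zero_mem _⟩
    | succ n ih =>
      simp only [ratIrrat, div_eq_mul_inv]
      exact ⟨mul_mem (add_mem ih.1 ih.2) h1, mul_mem (add_mem (mul_mem ⟨_, rfl⟩ ih.1) ih.2) h1⟩
  have h4 : ∀ n : ℕ, (n : K) ∈ (emb K).range := fun n => ⟨n, by simp⟩
  have h5 : ∀ n : ℕ, ((n : K) + 1) * (n + 2) / 2 ∈ (emb K).range := by
    intro n
    have : (2 : K)⁻¹ ∈ (emb K).range := ⟨(2 : MvPowerSeries (Fin 2) ℚ)⁻¹, by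
      rw [← map_ofNat (emb K) 2]
      refine eq_inv_of_mul_eq_one_left ?_
      rw [← map_mul, MvPowerSeries.inv_mul_cancel _ (by rw [map_ofNat]; norm_num),
        map_one]⟩
    rw [div_eq_mul_inv]
    exact mul_mem (mul_mem (by exact_mod_cast h4 (n + 1)) (by exact_mod_cast h4 (n + 2))) this
  have hP := BoundedDenom.of_mem_range fun n => (h3 n).1
  have hQ := BoundedDenom.of_mem_range fun n => (h3 n).2
  have hL : ∀ n : ℕ, ((((1 + emb K (X 1) - emb K (X 0) + emb K s) / 2) ^ n)⁻¹) ∈ (emb K).range :=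
    fun n => by rw [← inv_pow]; exact pow_mem h2 n
  have hJ : ∀ n : ℕ, (((1 - emb K (X 0)) ^ n)⁻¹) ∈ (emb K).range :=
    fun n => by rw [← inv_pow]; exact pow_mem h1 n
  have hL0 := BoundedDenom.of_mem_range hL
  have hL1 := BoundedDenom.of_mem_range fun n =>
    mul_mem (by exact_mod_cast h4 (n + 1) : (n : K) + 1 ∈ (emb K).range) (hL n)
  have hJ0 := BoundedDenom.of_mem_range hJ
  have hJ1 := BoundedDenom.of_mem_range fun n =>
    mul_mem (by exact_mod_cast h4 (n + 1) : (n : K) + 1 ∈ (emb K).range) (hJ n)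
  have hJ2 := BoundedDenom.of_mem_range fun n => mul_mem (h5 n) (hJ n)
  have := ((hP.const_mul c.p).add (hQ.const_mul c.q)).add
    (((hL0.const_mul (c.l₀ + c.m₀ * emb K s)).add (hL1.const_mul (c.l₁ + c.m₁ * emb K s))).add
    ((hJ0.const_mul (c.j₀ + c.k₀ * emb K s)).add
      ((hJ1.const_mul c.j₁).add (hJ2.const_mul c.j₂))))
  refine Eq.subst (motive := BoundedDenom) (funext fun n => ?_) this
  rw [Coef.eval]
  ring

theorem sqrtDiscr_emb {s : MvPowerSeries (Fin 2) ℚ} (hs : s ^ 2 = discr (X 0) (X 1)) :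
    SqrtDiscr (emb K (X 0)) (emb K (X 1)) (emb K s) (emb K (discr (X 0) (X 1))) := by
  have h : ∀ u : MvPowerSeries (Fin 2) ℚ, MvPowerSeries.constantCoeff u ≠ 0 → emb K u ≠ 0 := by
    intro u hu h
    rw [map_eq_zero_iff _ emb_injective] at h
    simp [h] at hu
  refine ⟨?_, ?_, ?_, ?_, ?_, ?_⟩
  · simp only [discr, map_add, map_sub, map_mul, map_one, map_ofNat, map_pow]
  · rw [← map_pow, hs]
  · rw [Ne, map_eq_zero_iff _ emb_injective]
    intro h0
    have := MvPowerSeries.coeff_index_single_self_X (R := ℚ) (1 : Fin 2)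
    rw [h0, map_zero] at this
    exact zero_ne_one this
  · exact h _ (by simp [discr])
  · rw [← map_one (emb K), ← map_sub]
    exact h _ (by simp)
  · rw [← map_one (emb K), ← map_sub, ← map_pow, ← map_sub]
    exact h _ (by simp)

end uniqueness

/-! ### The series of continuations as sequences in the field of fractions -/

section sequences

open MvPowerSeries (X)

variable (K : Type*) [Field K] [Algebra (MvPowerSeries (Fin 2) ℚ) K]
variable (r : ℕ) (q : Upper) (σ : Lower) (n : ℕ)

/-- Anything may follow. -/
noncomputable def cont : K := emb K (contGF r q σ n)

/-- A column follows, whose top is not higher. -/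
noncomputable def fallT : K := emb K (stepGF r q σ (Set.Iic 0) Set.univ n)

/-- A column follows, whose top is not lower, with the same bottom. -/
noncomputable def riseT : K := emb K (stepGF r q σ (Set.Ici 0) {0} n)

/-- A column follows, whose top and bottom are not lower. -/
noncomputable def riseB : K := emb K (stepGF r q σ (Set.Ici 0) (Set.Ici 0) n)

/-- A column follows, whose top is not lower and whose bottom is not higher. -/
noncomputable def fallB : K := emb K (stepGF r q σ (Set.Ici 0) (Set.Iic 0) n)

/-- A column follows, with the same top, and whose bottom is not lower. -/
noncomputable def riseB₀ : K := emb K (stepGF r q σ {0} (Set.Ici 0) n)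

/-- A column follows, with the same top, and whose bottom is not higher. -/
noncomputable def fallB₀ : K := emb K (stepGF r q σ {0} (Set.Iic 0) n)

variable {K r q σ n}

theorem fallT_zero : fallT K r q σ 0 = 0 := by rw [fallT, stepGF_zero, map_zero]
theorem riseB_zero : riseB K r q σ 0 = 0 := by rw [riseB, stepGF_zero, map_zero]
theorem riseB₀_zero : riseB₀ K r q σ 0 = 0 := by rw [riseB₀, stepGF_zero, map_zero]
theorem fallT_dead_top : fallT K r .dead σ n = 0 := by rw [fallT, stepGF_dead_top, map_zero]
theorem riseT_dead_top : riseT K r .dead σ n = 0 := by rw [riseT, stepGF_dead_top, map_zero]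
theorem fallB_dead : fallB K r q .dead n = 0 := by rw [fallB, stepGF_dead_bottom, map_zero]
theorem fallB₀_dead : fallB₀ K r q .dead n = 0 := by rw [fallB₀, stepGF_dead_bottom, map_zero]

theorem fallT_succ : fallT K r q σ (n + 1) = fallT K r (q.down r) σ n + riseB₀ K r q σ.up n +
    emb K (X 1) * fallB₀ K r q σ.down (n + 2) + emb K (X 0) * cont K r q σ (n + 1) := by
  simp only [fallT, stepGF_top_nonpos, stepGF_bottom_univ zero_subset, stepGF_stay, map_add,
    map_mul, riseB₀, fallB₀, cont, add_assoc]

theorem riseB₀_succ : riseB₀ K r q σ (n + 1) = riseB₀ K r q σ.up n +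
    emb K (X 0) * cont K r q σ (n + 1) := by
  simp only [riseB₀, stepGF_bottom_nonneg, stepGF_stay, map_add, map_mul, cont]

theorem fallB₀_succ : fallB₀ K r q σ (n + 1) =
    emb K (X 1) * fallB₀ K r q σ.down (n + 2) + emb K (X 0) * cont K r q σ (n + 1) := by
  rw [fallB₀, stepGF_bottom_nonpos zero_subset, stepGF_stay, map_add, map_mul, map_mul]
  rfl

theorem riseB_succ : riseB K r q σ (n + 1) = riseB K r q σ.up n + riseT K r q σ (n + 1) := by
  simp only [riseB, stepGF_bottom_nonneg, map_add, riseT]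

theorem fallB_succ : fallB K r q σ (n + 1) =
    emb K (X 1) * fallB K r q σ.down (n + 2) + riseT K r q σ (n + 1) := by
  rw [fallB, stepGF_bottom_nonpos subset_rfl, map_add, map_mul]
  rfl

theorem riseT_succ : riseT K r q σ (n + 1) = emb K (X 1) * riseT K r q.up σ (n + 2) +
    emb K (X 0) * cont K r q σ (n + 1) := by
  rw [riseT, stepGF_top_nonneg, map_add, map_mul, map_mul]
  rfl

theorem cont_succ_of_not_final (h : ¬ q.Final) : cont K r q σ (n + 1) =
    fallT K r (q.down r) σ n + riseB K r q σ.up n +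
      emb K (X 1) * fallB K r q σ.down (n + 2) + riseT K r q σ (n + 1) := by
  simp only [cont, contGF_succ_of_not_final h, stepGF_bottom_univ subset_rfl, map_add, map_mul,
    fallT, riseB, fallB, riseT, add_assoc]

theorem cont_succ_of_final (h : q.Final) (hσ : σ ≠ .dead) : cont K r q σ (n + 1) =
    1 + fallT K r (q.down r) σ n + riseB K r q σ.up n +
      emb K (X 1) * fallB K r q σ.down (n + 2) + riseT K r q σ (n + 1) := by
  simp only [cont, contGF_succ_of_final h hσ, stepGF_bottom_univ subset_rfl, map_add, map_mul,
    map_one, fallT, riseB, fallB, riseT, add_assoc]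

theorem riseB_of_up_dead (h : q.up = .dead) : riseB K r q σ n = riseB₀ K r q σ n := by
  rw [riseB, stepGF_of_up_dead h, riseB₀]

theorem fallB_of_up_dead (h : q.up = .dead) : fallB K r q σ n = fallB₀ K r q σ n := by
  rw [fallB, stepGF_of_up_dead h, fallB₀]

theorem boundedDenom_fallT : BoundedDenom (fallT K r q σ) := .of_mem_range fun _ => ⟨_, rfl⟩
theorem boundedDenom_riseB : BoundedDenom (riseB K r q σ) := .of_mem_range fun _ => ⟨_, rfl⟩
theorem boundedDenom_fallB : BoundedDenom (fallB K r q σ) := .of_mem_range fun _ => ⟨_, rfl⟩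
theorem boundedDenom_fallB₀ : BoundedDenom (fallB₀ K r q σ) := .of_mem_range fun _ => ⟨_, rfl⟩

variable [IsFractionRing (MvPowerSeries (Fin 2) ℚ) K]

/-- Eliminating `h - h'` from the two coupled relations leaves a second order recurrence for `f -
f'`, whose characteristic roots are `1 / λ` and `λ / y`. -/
theorem eq_of_forward {f f' h h' : ℕ → K} (hf : BoundedDenom f) (hf' : BoundedDenom f')
    (h0 : f 0 = f' 0)
    (h1 : ∀ n, f (n + 1) - f' (n + 1) = f n - f' n + (h (n + 1) - h' (n + 1)))
    (h2 : ∀ n, h (n + 1) - h' (n + 1) = emb K (X 1) * (h (n + 2) - h' (n + 2)) +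
      emb K (X 0) * (f (n + 1) - f' (n + 1))) (n : ℕ) : f n = f' n := by
  refine sub_eq_zero.1 ((hf.sub hf').eq_zero_of_forward (u := 1 - X 0) (by simp)
    (by rw [h0, sub_self]) (fun n => ?_) n)
  rw [map_sub, map_one]
  linear_combination h1 n + h2 n - emb K (X 1) * h1 (n + 1)

theorem eq_of_backward₂ {f f' e e' : ℕ → K} (hf : BoundedDenom f) (hf' : BoundedDenom f') (n₀ : ℕ)
    (h1 : ∀ n, n₀ ≤ n → f n - f' n = emb K (X 1) * (f (n + 1) - f' (n + 1)) + (e n - e' n))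
    (h2 : ∀ n, n₀ ≤ n → e n - e' n = emb K (X 1) * (e (n + 1) - e' (n + 1)) +
      emb K (X 0) * (f n - f' n)) (n : ℕ) (hn : n₀ ≤ n) : f n = f' n := by
  -- With the shift `E`, the relations are `(1 - y E) f = e` and `(1 - y E) e = x f` for the
  -- differences. Hence `(1 - y E) ^ 2 f = x f`, that is, `(1 - x) f n = y (2 f (n + 1) - y f (n +
  -- 2))`.
  refine sub_eq_zero.1 ((hf.sub hf').eq_zero_of_backward (u := 1 - X 0) (α := 2) (β := -X 1)
    (by simp) (n₀ := n₀) (fun n hn => ?_) n hn)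
  rw [map_sub, map_one, map_neg, map_ofNat]
  linear_combination h1 n hn + h2 n hn - emb K (X 1) * h1 (n + 1) (by omega)

theorem eq_of_backward {f f' : ℕ → K} (hf : BoundedDenom f) (hf' : BoundedDenom f') (n₀ : ℕ)
    (h1 : ∀ n, n₀ ≤ n → f n - f' n = emb K (X 1) * (f (n + 1) - f' (n + 1)) +
      emb K (X 0) * (f n - f' n)) (n : ℕ) (hn : n₀ ≤ n) : f n = f' n := by
  refine sub_eq_zero.1 ((hf.sub hf').eq_zero_of_backward (u := 1 - X 0) (α := 1) (β := 0)
    (by simp) (n₀ := n₀) (fun n hn => ?_) n hn)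
  rw [map_sub, map_one, map_zero]
  linear_combination h1 n hn

theorem eq_of_backward₀ {f f' : ℕ → K} (hf : BoundedDenom f) (hf' : BoundedDenom f') (n₀ : ℕ)
    (h1 : ∀ n, n₀ ≤ n → f n - f' n = emb K (X 1) * (f (n + 1) - f' (n + 1))) (n : ℕ)
    (hn : n₀ ≤ n) : f n = f' n := by
  refine sub_eq_zero.1 ((hf.sub hf').eq_zero_of_backward (u := 1) (α := 1) (β := 0)
    (by simp) (n₀ := n₀) (fun n hn => ?_) n hn)
  rw [map_one, map_zero]
  linear_combination h1 n hn

theorem one_sub_X_ne_zero : (1 : K) - emb K (X 0) ≠ 0 := by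
  intro h
  rw [← map_one (emb K), ← map_sub, map_eq_zero_iff _ emb_injective] at h
  have := congrArg MvPowerSeries.constantCoeff h
  simp at this

end sequences

/-! ### The last state of the top: falling -/

section stages

open MvPowerSeries (X)
open Coef

/-- The sequence with the given coefficients, as functions of `x`, `y` and `Δ`. -/
noncomputable def closed (K : Type*) [Field K] [Algebra (MvPowerSeries (Fin 2) ℚ) K]
    (s : MvPowerSeries (Fin 2) ℚ) (c : K → K → K → Coef K) (n : ℕ) : K :=
  (c (emb K (X 0)) (emb K (X 1)) (emb K (discr (X 0) (X 1)))).eval (emb K (X 0)) (emb K (X 1))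
    (emb K s) n

set_option linter.unusedSectionVars false

variable {K : Type*} [Field K] [Algebra (MvPowerSeries (Fin 2) ℚ) K]

theorem boundedDenom_closed [IsFractionRing (MvPowerSeries (Fin 2) ℚ) K]
    {s : MvPowerSeries (Fin 2) ℚ} (hs₁ : MvPowerSeries.constantCoeff s = 1)
    (c : K → K → K → Coef K) : BoundedDenom (closed K s c) :=
  boundedDenom_eval hs₁ _

theorem SqrtDiscr.eval_eq {x y s D : K} (_ : SqrtDiscr x y s D) {c d : Coef K} (h : c = d)
    (n : ℕ) : c.eval x y s n = d.eval x y s n := by rw [h]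

variable [CharZero K] [IsFractionRing (MvPowerSeries (Fin 2) ℚ) K]

/-- With a falling top and a rising bottom the column can only get shorter. So the recurrences only
look back, and they are those that define `ratIrrat`. -/
theorem fall_inc (r n : ℕ) : riseB₀ K r .fall .inc n = (ratIrrat (emb K (X 0)) n).2 ∧
    1 + fallT K r .fall .inc n = (ratIrrat (emb K (X 0)) n).1 := by
  have hx : (1 : K) - emb K (X 0) ≠ 0 := one_sub_X_ne_zero
  induction n with
  | zero => simp [riseB₀_zero, fallT_zero, ratIrrat]
  | succ n ih =>
    obtain ⟨h1, h2⟩ := ih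
    have e1 := riseB₀_succ (K := K) (r := r) (q := .fall) (σ := .inc) (n := n)
    have e2 := fallT_succ (K := K) (r := r) (q := .fall) (σ := .inc) (n := n)
    have e3 := riseT_succ (K := K) (r := r) (q := .fall) (σ := .inc) (n := n)
    have e4 := cont_succ_of_final (K := K) (r := r) (q := .fall) (σ := .inc) (n := n) trivial
      (by simp)
    simp only [Upper.up, Upper.down, Lower.up, Lower.down, fallB₀_dead, fallB_dead,
      riseT_dead_top, riseB_of_up_dead (q := .fall) rfl, h1] at e1 e2 e3 e4
    simp only [ratIrrat]
    constructor
    · rw [eq_div_iff hx]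
      linear_combination e1 + emb K (X 0) * (e4 + e3 - e1 + h2)
    · rw [eq_div_iff hx]
      linear_combination (1 - emb K (X 0)) * e2 + emb K (X 0) * (e4 + e3) + h2

variable {s : MvPowerSeries (Fin 2) ℚ}

theorem closed_zero (hs : s ^ 2 = discr (X 0) (X 1)) (c : K → K → K → Coef K) (h1 : ∀ {x y s D : K}, SqrtDiscr x y s D →
    zeroIrr (c x y D) = 0) (v : K)
    (h2 : ∀ {x y s D : K}, SqrtDiscr x y s D → zeroRat (c x y D) = v) :
    closed K s c 0 = v := by
  have H : SqrtDiscr (emb K (X 0)) (emb K (X 1)) (emb K s) _ := sqrtDiscr_emb (K := K) hs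
  rw [closed, eval_zero, h1 H, h2 H, zero_mul, add_zero]


/-- Since a falling top cannot rise again, `1 + fallT` counts all continuations at positive heights,
the `1` being the empty one. This makes the pair of recurrences with `fallB₀` close up. -/
theorem fall_dec (hs : s ^ 2 = discr (X 0) (X 1)) (hs₁ : MvPowerSeries.constantCoeff s = 1)
    (r n : ℕ) : 1 + fallT K r .fall .dec n = closed K s coefFall n := by
  have H := sqrtDiscr_emb (K := K) hs
  refine eq_of_forward (f := fun n => 1 + fallT K r .fall .dec n) (h := fallB₀ K r .fall .dec)
    (h' := closed K s coefFallDown) (.add (.of_mem_range fun _ => one_mem _) boundedDenom_fallT)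
    (boundedDenom_closed hs₁ _) ?_ (fun n => ?_) (fun n => ?_) n
  · rw [closed_zero hs _ coefFall_zeroIrr 1 coefFall_zeroRat, fallT_zero, add_zero]
  all_goals
    have e2 := fallT_succ (K := K) (r := r) (q := .fall) (σ := .dec) (n := n)
    have e1 := fallB₀_succ (K := K) (r := r) (q := .fall) (σ := .dec) (n := n)
    have e3 := riseT_succ (K := K) (r := r) (q := .fall) (σ := .dec) (n := n)
    have e4 := cont_succ_of_final (K := K) (r := r) (q := .fall) (σ := .dec) (n := n) trivial
      (by simp)
    have k1 := H.eval_eq (coefFall_eq H) (n + 1)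
    have k2 := H.eval_eq (coefFallDown_eq H) (n + 2)
    simp only [Upper.up, Upper.down, Lower.up, Lower.down, riseB_of_up_dead (q := .fall) rfl,
      riseT_dead_top, fallB_of_up_dead (q := .fall) rfl, (fall_inc r n).1] at e1 e2 e3 e4
    simp only [eval_add, eval_sub, eval_smul, eval_back H, eval_irratl] at k1 k2
    simp only [closed]
  · linear_combination e2 - k1 - e1
  · linear_combination e1 - k2 + emb K (X 0) * (e4 + e3 - e2)

end stages

/-! ### Climbing to the second mode -/

section stages

open MvPowerSeries (X)
open Coef
set_option linter.unusedSectionVars false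

variable {K : Type*} [Field K] [Algebra (MvPowerSeries (Fin 2) ℚ) K]
variable [CharZero K] [IsFractionRing (MvPowerSeries (Fin 2) ℚ) K]
variable {s : MvPowerSeries (Fin 2) ℚ}

theorem climb0_inc (hs : s ^ 2 = discr (X 0) (X 1)) (hs₁ : MvPowerSeries.constantCoeff s = 1) (r n : ℕ) :
    riseB K r (.climb 0) .inc n = closed K s coefRise0 n := by
  have H := sqrtDiscr_emb (K := K) hs
  refine eq_of_forward (h := riseT K r (.climb 0) .inc) (h' := closed K s coefRise0Stay)
    boundedDenom_riseB (boundedDenom_closed hs₁ _) ?_ (fun n => ?_) (fun n => ?_) n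
  · rw [closed_zero hs _ coefRise0_zeroIrr 0 coefRise0_zeroRat, riseB_zero]
  · have e1 := riseB_succ (K := K) (r := r) (q := (.climb 0)) (σ := .inc) (n := n)
    have k1 := H.eval_eq (coefRise0Stay_eq H) (n + 1)
    simp only [Lower.up] at e1
    simp only [eval_sub, eval_back H] at k1
    simp only [closed]
    linear_combination e1 - k1
  · have e1 := riseB_succ (K := K) (r := r) (q := (.climb 0)) (σ := .inc) (n := n)
    have e2 := riseT_succ (K := K) (r := r) (q := (.climb 0)) (σ := .inc) (n := n)
    have e3 := cont_succ_of_final (K := K) (r := r) (q := (.climb 0)) (σ := .inc) (n := n)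
      trivial (by simp)
    have k1 := H.eval_eq (coefRise0_eq H) (n + 1)
    have k2 := H.eval_eq (coefRise0Stay_eq' H) (n + 2)
    simp only [Upper.up, Upper.down, Lower.up, Lower.down, fallB_dead, (fall_inc r n).2]
      at e1 e2 e3
    simp only [eval_add, eval_sub, eval_smul, eval_back H, eval_ratl] at k1 k2
    simp only [closed]
    linear_combination e2 - k2 + emb K (X 0) * (e3 - k1 - e1)

theorem riseT_climb0_inc (hs : s ^ 2 = discr (X 0) (X 1)) (hs₁ : MvPowerSeries.constantCoeff s = 1) (r n : ℕ) :
    riseT K r (.climb 0) .inc (n + 1) = closed K s coefRise0Stay (n + 1) := by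
  have H := sqrtDiscr_emb (K := K) hs
  have e1 := riseB_succ (K := K) (r := r) (q := (.climb 0)) (σ := .inc) (n := n)
  have k1 := H.eval_eq (coefRise0Stay_eq H) (n + 1)
  simp only [Lower.up, climb0_inc hs hs₁] at e1
  simp only [eval_sub, eval_back H] at k1
  simp only [closed] at e1 ⊢
  linear_combination k1 - e1

theorem climb0_dec (hs : s ^ 2 = discr (X 0) (X 1)) (hs₁ : MvPowerSeries.constantCoeff s = 1) (r n : ℕ) :
    fallB K r (.climb 0) .dec (n + 1) = closed K s coefClimb0Down (n + 1) ∧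
      riseT K r (.climb 0) .dec (n + 1) = closed K s coefClimb0Stay (n + 1) := by
  have H := sqrtDiscr_emb (K := K) hs
  have h1 : ∀ n, 1 ≤ n → fallB K r (.climb 0) .dec n = closed K s coefClimb0Down n := by
    refine eq_of_backward₂ (e := riseT K r (.climb 0) .dec) (e' := closed K s coefClimb0Stay)
      boundedDenom_fallB (boundedDenom_closed hs₁ _) 1 (fun n hn => ?_) (fun n hn => ?_)
    · obtain ⟨n, rfl⟩ := Nat.exists_eq_add_of_le' hn
      have e1 := fallB_succ (K := K) (r := r) (q := (.climb 0)) (σ := .dec) (n := n)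
      have k1 := H.eval_eq (coefClimb0Down_eq H) (n + 2)
      simp only [Lower.down] at e1
      simp only [eval_sub, eval_smul, eval_back H] at k1
      simp only [closed]
      linear_combination e1 - k1
    · obtain ⟨n, rfl⟩ := Nat.exists_eq_add_of_le' hn
      have e1 := fallB_succ (K := K) (r := r) (q := (.climb 0)) (σ := .dec) (n := n)
      have e2 := riseT_succ (K := K) (r := r) (q := (.climb 0)) (σ := .dec) (n := n)
      have e3 := cont_succ_of_final (K := K) (r := r) (q := (.climb 0)) (σ := .dec) (n := n)
        trivial (by simp)
      have k1 := H.eval_eq (coefClimb0_eq H) (n + 1)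
      have k2 := H.eval_eq (coefClimb0Stay_eq H) (n + 2)
      simp only [Upper.up, Upper.down, Lower.up, Lower.down, fall_dec hs hs₁, climb0_inc hs hs₁]
        at e1 e2 e3
      simp only [eval_add, eval_sub, eval_smul, eval_back H] at k1 k2
      simp only [closed] at e1 e2 e3 ⊢
      linear_combination e2 - k2 + emb K (X 0) * (e3 - k1 - e1)
  refine ⟨h1 _ (by omega), ?_⟩
  have e1 := fallB_succ (K := K) (r := r) (q := (.climb 0)) (σ := .dec) (n := n)
  have k1 := H.eval_eq (coefClimb0Down_eq H) (n + 2)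
  simp only [Lower.down, h1 _ (Nat.le_add_left _ _)] at e1
  simp only [eval_sub, eval_smul, eval_back H] at k1
  simp only [closed] at e1 ⊢
  linear_combination k1 - e1

/-- The relations between the closed forms for two consecutive values of `k` in `climb k`. -/
structure ClimbRel (x y D : K) (cP cR cS dP d dD dS : K → K → K → Coef K) : Prop where
  zeroRat : zeroRat (cR x y D) = 0
  zeroIrr : zeroIrr (cR x y D) = 0
  rise : cR x y D - back x y D (cR x y D) = cS x y D
  stay : back x y D (cS x y D) - y • cP x y D = x • back x y D (cR x y D)
  climb : d x y D = back x y D (cR x y D) + dD x y D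
  climbDown : back x y D (dD x y D) - y • dD x y D = back x y D (dS x y D)
  climbStay : back x y D (dS x y D) - y • dP x y D = x • back x y D (d x y D)

/-- A unit step up leads from `climb (k + 1)` to `climb k`, which is already solved. So `riseT` does
not refer to itself at greater heights. For a rising bottom, plain induction on `n` suffices, with a
division by `1 - x` at each step; for a falling bottom, a backward recurrence of order one remains.
-/
theorem climb_succ (hs : s ^ 2 = discr (X 0) (X 1)) (hs₁ : MvPowerSeries.constantCoeff s = 1)
    {cP cR cS dP d dD dS : K → K → K → Coef K}
    (h : ClimbRel (emb K (X 0)) (emb K (X 1)) (emb K (discr (X 0) (X 1))) cP cR cS dP d dD dS)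
    (r k : ℕ) (hP : ∀ n, riseT K r (.climb k) .inc (n + 1) = closed K s cP (n + 1))
    (hP' : ∀ n, riseT K r (.climb k) .dec (n + 1) = closed K s dP (n + 1)) :
    (∀ n, riseB K r (.climb (k + 1)) .inc n = closed K s cR n) ∧
    (∀ n, riseT K r (.climb (k + 1)) .inc (n + 1) = closed K s cS (n + 1)) ∧
    (∀ n, cont K r (.climb (k + 1)) .dec (n + 1) = closed K s d (n + 1)) ∧
    ∀ n, riseT K r (.climb (k + 1)) .dec (n + 1) = closed K s dS (n + 1) := by
  have H := sqrtDiscr_emb (K := K) hs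
  have hx : (1 : K) - emb K (X 0) ≠ 0 := one_sub_X_ne_zero
  have h1 : ∀ n, riseB K r (.climb (k + 1)) .inc n = closed K s cR n := by
    intro n
    induction n with
    | zero => rw [riseB_zero, closed, eval_zero, h.zeroRat, h.zeroIrr, zero_mul, add_zero]
    | succ n ih =>
      have e1 := riseB_succ (K := K) (r := r) (q := (.climb (k + 1))) (σ := .inc) (n := n)
      have e2 := riseT_succ (K := K) (r := r) (q := (.climb (k + 1))) (σ := .inc) (n := n)
      have e3 := cont_succ_of_not_final (K := K) (r := r) (q := (.climb (k + 1))) (σ := .inc)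
        (n := n) not_false
      have k1 := H.eval_eq h.rise (n + 1)
      have k2 := H.eval_eq h.stay (n + 2)
      simp only [Upper.up, Upper.down, Lower.up, Lower.down, fallT_dead_top, fallB_dead,
        add_tsub_cancel_right, hP, ih] at e1 e2 e3
      simp only [eval_sub, eval_smul, eval_back H] at k1 k2
      simp only [closed] at e1 e2 e3 ⊢
      -- The new term also occurs, with the factor `x`, in the continuation of the next column.
      apply mul_left_cancel₀ hx
      linear_combination e1 + e2 + emb K (X 0) * (e3 - e1) - k1 - k2
  have h2 : ∀ n, 1 ≤ n → fallB K r (.climb (k + 1)) .dec n = closed K s dD n := by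
    refine eq_of_backward boundedDenom_fallB (boundedDenom_closed hs₁ _) 1 (fun n hn => ?_)
    obtain ⟨n, rfl⟩ := Nat.exists_eq_add_of_le' hn
    have e1 := fallB_succ (K := K) (r := r) (q := (.climb (k + 1))) (σ := .dec) (n := n)
    have e2 := riseT_succ (K := K) (r := r) (q := (.climb (k + 1))) (σ := .dec) (n := n)
    have e3 := cont_succ_of_not_final (K := K) (r := r) (q := (.climb (k + 1))) (σ := .dec)
      (n := n) not_false
    have k1 := H.eval_eq h.climb (n + 1)
    have k2 := H.eval_eq h.climbDown (n + 2)
    have k3 := H.eval_eq h.climbStay (n + 2)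
    simp only [Upper.up, Upper.down, Lower.up, Lower.down, fallT_dead_top,
      add_tsub_cancel_right, hP', h1] at e1 e2 e3
    simp only [eval_add, eval_sub, eval_smul, eval_back H] at k1 k2 k3
    simp only [closed] at e1 e2 e3 ⊢
    linear_combination e1 + e2 + emb K (X 0) * (e3 - e1) - k2 - k3 - emb K (X 0) * k1
  refine ⟨h1, fun n => ?_, fun n => ?_, fun n => ?_⟩
  · have e1 := riseB_succ (K := K) (r := r) (q := (.climb (k + 1))) (σ := .inc) (n := n)
    have k1 := H.eval_eq h.rise (n + 1)
    simp only [Lower.up, h1] at e1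
    simp only [eval_sub, eval_back H] at k1
    simp only [closed] at e1 ⊢
    linear_combination k1 - e1
  · have e1 := fallB_succ (K := K) (r := r) (q := (.climb (k + 1))) (σ := .dec) (n := n)
    have e3 := cont_succ_of_not_final (K := K) (r := r) (q := (.climb (k + 1))) (σ := .dec)
      (n := n) not_false
    have k1 := H.eval_eq h.climb (n + 1)
    rw [h2 _ (by omega)] at e1
    simp only [Upper.down, Lower.up, Lower.down, fallT_dead_top, h1] at e1 e3
    simp only [eval_add, eval_back H] at k1
    simp only [closed] at e1 e3 ⊢
    linear_combination e3 - e1 - k1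
  · have e1 := fallB_succ (K := K) (r := r) (q := (.climb (k + 1))) (σ := .dec) (n := n)
    have k2 := H.eval_eq h.climbDown (n + 2)
    rw [h2 _ (by omega)] at e1
    simp only [Lower.down] at e1
    rw [h2 _ (by omega)] at e1
    simp only [eval_sub, eval_smul, eval_back H] at k2
    simp only [closed] at e1 ⊢
    linear_combination k2 - e1

theorem climb1 (hs : s ^ 2 = discr (X 0) (X 1)) (hs₁ : MvPowerSeries.constantCoeff s = 1) (r : ℕ) :
    (∀ n, riseB K r (.climb 1) .inc n = closed K s coefRise1 n) ∧
    (∀ n, riseT K r (.climb 1) .inc (n + 1) = closed K s coefRise1Stay (n + 1)) ∧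
    (∀ n, cont K r (.climb 1) .dec (n + 1) = closed K s coefClimb1 (n + 1)) ∧
    ∀ n, riseT K r (.climb 1) .dec (n + 1) = closed K s coefClimb1Stay (n + 1) :=
  have H := sqrtDiscr_emb (K := K) hs
  climb_succ hs hs₁ ⟨coefRise1_zeroRat H, coefRise1_zeroIrr H, coefRise1_eq H,
    coefRise1Stay_eq H, coefClimb1_eq H, coefClimb1Down_eq H, coefClimb1Stay_eq H⟩ r 0
    (riseT_climb0_inc hs hs₁ r) (fun n => (climb0_dec hs hs₁ r n).2)

theorem climb2 (hs : s ^ 2 = discr (X 0) (X 1)) (hs₁ : MvPowerSeries.constantCoeff s = 1) (r : ℕ) :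
    (∀ n, riseB K r (.climb 2) .inc n = closed K s coefRise2 n) ∧
    (∀ n, riseT K r (.climb 2) .inc (n + 1) = closed K s coefRise2Stay (n + 1)) ∧
    (∀ n, cont K r (.climb 2) .dec (n + 1) = closed K s coefClimb2 (n + 1)) ∧
    ∀ n, riseT K r (.climb 2) .dec (n + 1) = closed K s coefClimb2Stay (n + 1) :=
  have H := sqrtDiscr_emb (K := K) hs
  climb_succ hs hs₁ ⟨coefRise2_zeroRat H, coefRise2_zeroIrr H, coefRise2_eq H,
    coefRise2Stay_eq H, coefClimb2_eq H, coefClimb2Down_eq H, coefClimb2Stay_eq H⟩ r 1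
    (climb1 hs hs₁ r).2.1 (climb1 hs hs₁ r).2.2.2

theorem climb3 (hs : s ^ 2 = discr (X 0) (X 1)) (hs₁ : MvPowerSeries.constantCoeff s = 1) (r : ℕ) :
    (∀ n, riseB K r (.climb 3) .inc n = closed K s coefRise3 n) ∧
    (∀ n, riseT K r (.climb 3) .inc (n + 1) = closed K s coefRise3Stay (n + 1)) ∧
    (∀ n, cont K r (.climb 3) .dec (n + 1) = closed K s coefClimb3 (n + 1)) ∧
    ∀ n, riseT K r (.climb 3) .dec (n + 1) = closed K s coefClimb3Stay (n + 1) :=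
  have H := sqrtDiscr_emb (K := K) hs
  climb_succ hs hs₁ ⟨coefRise3_zeroRat H, coefRise3_zeroIrr H, coefRise3_eq H,
    coefRise3Stay_eq H, coefClimb3_eq H, coefClimb3Down_eq H, coefClimb3Stay_eq H⟩ r 2
    (climb2 hs hs₁ r).2.1 (climb2 hs hs₁ r).2.2.2

end stages

/-! ### The indent and the first mode -/

section stages

open MvPowerSeries (X)
open Coef
set_option linter.unusedSectionVars false

variable {K : Type*} [Field K] [Algebra (MvPowerSeries (Fin 2) ℚ) K]
variable [CharZero K] [IsFractionRing (MvPowerSeries (Fin 2) ℚ) K]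
variable {s : MvPowerSeries (Fin 2) ℚ}

/-- Before its goal is reached a climbing top must not go down, so not higher means equal. -/
theorem fallT_climb_inc (k r n : ℕ) :
    fallT K r (.climb (k + 1)) .inc n = riseB₀ K r (.climb (k + 1)) .inc n := by
  rcases n with _ | n
  · rw [fallT_zero, riseB₀_zero]
  · rw [fallT_succ, riseB₀_succ]
    simp [Upper.down, Lower.up, Lower.down, fallT_dead_top, fallB₀_dead]

theorem fallT_climb_dec (k r n : ℕ) : fallT K r (.climb (k + 1)) .dec (n + 1) =
    riseB₀ K r (.climb (k + 1)) .inc n + fallB₀ K r (.climb (k + 1)) .dec (n + 1) := by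
  rw [fallT_succ, fallB₀_succ (n := n)]
  simp only [Upper.down, Lower.up, Lower.down, fallT_dead_top]
  ring

theorem cont_climb_inc (k r n : ℕ) :
    cont K r (.climb (k + 1)) .inc (n + 1) = riseB K r (.climb (k + 1)) .inc (n + 1) := by
  rw [cont_succ_of_not_final (q := .climb (k + 1)) not_false, riseB_succ]
  simp [Upper.down, Lower.up, Lower.down, fallT_dead_top, fallB_dead]

/-- In the state `dip` the top can only stay or go on to `climb`, so `fallT` contains all
continuations. The second relation results from eliminating both sequences `riseB₀`. -/
theorem dip_inc_succ (k n : ℕ) : fallT K (k + 1) .dip .inc (n + 1) =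
    riseB₀ K (k + 1) (.climb (k + 1)) .inc n + riseB₀ K (k + 1) .dip .inc (n + 1) ∧
    fallT K (k + 1) .dip .inc (n + 1) = fallT K (k + 1) .dip .inc n +
      emb K (X 0) * (riseB K (k + 1) (.climb (k + 1)) .inc n +
        fallT K (k + 1) .dip .inc (n + 1)) := by
  have e1 := fun n => fallT_succ (K := K) (r := k + 1) (q := .dip) (σ := .inc) (n := n)
  have e2 := fun n => riseB₀_succ (K := K) (r := k + 1) (q := .dip) (σ := .inc) (n := n)
  have e3 := fun n => cont_succ_of_not_final (K := K) (r := k + 1) (q := .dip) (σ := .inc)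
    (n := n) not_false
  have e4 := fun n => riseT_succ (K := K) (r := k + 1) (q := .dip) (σ := .inc) (n := n)
  simp only [Upper.up, Upper.down, Lower.up, Lower.down, fallT_climb_inc, fallB₀_dead,
    fallB_dead, riseT_dead_top, riseB_of_up_dead (q := .dip) rfl] at e1 e2 e3 e4
  constructor
  · linear_combination e1 n - e2 n
  -- The recurrences for `riseB₀` hold at positive heights; at height zero both of these sequences
  -- vanish.
  · rcases n with _ | n
    · have h0 := riseB_zero (K := K) (r := k + 1) (q := .climb (k + 1)) (σ := .inc)
      rw [fallT_zero, h0]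
      have h1 := e1 0
      have h3 := e3 0
      simp only [riseB₀_zero] at h1 h3
      linear_combination h1 + emb K (X 0) * (h3 + e4 0 - h1)
    · have e5 := riseB₀_succ (K := K) (r := k + 1) (q := .climb (k + 1)) (σ := .inc) (n := n)
      simp only [Lower.up, cont_climb_inc] at e5
      linear_combination e1 (n + 1) + e2 n - e1 n + e5 + emb K (X 0) * (e3 (n + 1) + e4 (n + 1) -
        e1 (n + 1))

theorem dip_inc (hs : s ^ 2 = discr (X 0) (X 1)) (hs₁ : MvPowerSeries.constantCoeff s = 1) (n : ℕ) :
    fallT K 2 .dip .inc n + fallT K 3 .dip .inc n = closed K s coefDip n := by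
  have H := sqrtDiscr_emb (K := K) hs
  have hx : (1 : K) - emb K (X 0) ≠ 0 := one_sub_X_ne_zero
  induction n with
  | zero => rw [closed_zero hs _ coefDip_zeroIrr 0 coefDip_zeroRat, fallT_zero, fallT_zero, add_zero]
  | succ n ih =>
    have e2 := (dip_inc_succ (K := K) 1 n).2
    have e3 := (dip_inc_succ (K := K) 2 n).2
    have k1 := H.eval_eq (coefDip_eq H) (n + 1)
    simp only [Nat.reduceAdd, (climb2 hs hs₁ 2).1, (climb3 hs hs₁ 3).1] at e2 e3
    simp only [eval_add, eval_sub, eval_smul, eval_back H] at k1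
    simp only [closed] at e2 e3 ih ⊢
    apply mul_left_cancel₀ hx
    linear_combination e2 + e3 + ih - k1

/-- All continuations of the climb are known from `climb2` and `climb3`, so the recurrence only sums
them up with powers of `y`. -/
theorem land (hs : s ^ 2 = discr (X 0) (X 1)) (hs₁ : MvPowerSeries.constantCoeff s = 1) (n : ℕ) :
    fallB₀ K 2 (.climb 2) .dec (n + 1) + fallB₀ K 3 (.climb 3) .dec (n + 1) =
      closed K s coefLand (n + 1) := by
  have H := sqrtDiscr_emb (K := K) hs
  refine eq_of_backward₀ (f := fun n => fallB₀ K 2 (.climb 2) .dec n +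
    fallB₀ K 3 (.climb 3) .dec n) (boundedDenom_fallB₀.add boundedDenom_fallB₀)
    (boundedDenom_closed hs₁ _) 1 (fun n hn => ?_) (n + 1) (by omega)
  obtain ⟨n, rfl⟩ := Nat.exists_eq_add_of_le' hn
  have e2 := fallB₀_succ (K := K) (r := 2) (q := .climb 2) (σ := .dec) (n := n)
  have e3 := fallB₀_succ (K := K) (r := 3) (q := .climb 3) (σ := .dec) (n := n)
  have k1 := H.eval_eq (coefLand_eq H) (n + 2)
  simp only [Lower.down, (climb2 hs hs₁ 2).2.2.1, (climb3 hs hs₁ 3).2.2.1] at e2 e3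
  simp only [eval_add, eval_sub, eval_smul, eval_back H] at k1
  simp only [closed] at e2 e3 ⊢
  linear_combination e2 + e3 - k1

theorem dip_dec_succ (k n : ℕ) : fallT K (k + 1) .dip .dec (n + 1) =
      fallT K (k + 1) (.climb (k + 1)) .dec n + riseB₀ K (k + 1) .dip .inc n +
        fallB₀ K (k + 1) .dip .dec (n + 1) ∧
    fallB₀ K (k + 1) .dip .dec (n + 1) = emb K (X 1) * fallB₀ K (k + 1) .dip .dec (n + 2) +
      emb K (X 0) * fallT K (k + 1) .dip .dec (n + 1) := by
  have e1 := fallT_succ (K := K) (r := k + 1) (q := .dip) (σ := .dec) (n := n)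
  have e2 := fallB₀_succ (K := K) (r := k + 1) (q := .dip) (σ := .dec) (n := n)
  have e3 := cont_succ_of_not_final (K := K) (r := k + 1) (q := .dip) (σ := .dec) (n := n)
    not_false
  have e4 := riseT_succ (K := K) (r := k + 1) (q := .dip) (σ := .dec) (n := n)
  simp only [Upper.up, Upper.down, Lower.up, Lower.down, riseT_dead_top,
    riseB_of_up_dead (q := .dip) rfl, fallB_of_up_dead (q := .dip) rfl] at e1 e2 e3 e4
  constructor
  · linear_combination e1 - e2
  · linear_combination e2 + emb K (X 0) * (e3 + e4 - e1)

theorem dip_dec_one (k : ℕ) :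
    fallT K (k + 1) .dip .dec 1 = fallB₀ K (k + 1) .dip .dec 1 := by
  rw [(dip_dec_succ k 0).1, fallT_zero, riseB₀_zero, add_zero, zero_add]

/-- This form needs height at least two: the top steps down onto a column in the state `climb`, and
splitting the continuations there by `fallT_climb_dec` requires that this column is not empty.
Height one is treated in `dip_dec_one`. -/
theorem dip_dec_succ_succ (k n : ℕ) : fallT K (k + 1) .dip .dec (n + 2) =
      fallT K (k + 1) .dip .inc (n + 1) + fallB₀ K (k + 1) (.climb (k + 1)) .dec (n + 1) +
        fallB₀ K (k + 1) .dip .dec (n + 2) := by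
  rw [(dip_dec_succ k (n + 1)).1, fallT_climb_dec, (dip_inc_succ k n).1]
  ring

theorem dip_dec (hs : s ^ 2 = discr (X 0) (X 1)) (hs₁ : MvPowerSeries.constantCoeff s = 1) (n : ℕ) :
    fallB₀ K 2 .dip .dec (n + 2) + fallB₀ K 3 .dip .dec (n + 2) =
      closed K s coefDipFallDown (n + 2) ∧
    fallT K 2 .dip .dec (n + 2) + fallT K 3 .dip .dec (n + 2) =
      closed K s coefDipFall (n + 2) := by
  have H := sqrtDiscr_emb (K := K) hs
  have h1 : ∀ n, fallT K 2 .dip .dec (n + 2) + fallT K 3 .dip .dec (n + 2) -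
      closed K s coefDipFall (n + 2) = fallB₀ K 2 .dip .dec (n + 2) +
        fallB₀ K 3 .dip .dec (n + 2) - closed K s coefDipFallDown (n + 2) := by
    intro n
    have e2 := dip_dec_succ_succ (K := K) 1 n
    have e3 := dip_dec_succ_succ (K := K) 2 n
    have e4 := dip_inc (K := K) hs hs₁ (n + 1)
    have e5 := land (K := K) hs hs₁ n
    have k1 := H.eval_eq (coefDipFall_eq H) (n + 2)
    simp only [eval_add, eval_back H] at k1
    simp only [closed] at e4 e5 ⊢
    linear_combination e2 + e3 + e4 + e5 - k1
  have h2 : ∀ n, 2 ≤ n → fallB₀ K 2 .dip .dec n + fallB₀ K 3 .dip .dec n =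
      closed K s coefDipFallDown n := by
    refine eq_of_backward (f := fun n => fallB₀ K 2 .dip .dec n + fallB₀ K 3 .dip .dec n)
      (boundedDenom_fallB₀.add boundedDenom_fallB₀) (boundedDenom_closed hs₁ _) 2 (fun n hn => ?_)
    obtain ⟨n, rfl⟩ := Nat.exists_eq_add_of_le' hn
    have e2 := (dip_dec_succ (K := K) 1 (n + 1)).2
    have e3 := (dip_dec_succ (K := K) 2 (n + 1)).2
    have e4 := h1 n
    have k1 := H.eval_eq (coefDipFallDown_eq H) (n + 3)
    simp only [eval_sub, eval_smul, eval_back H] at k1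
    simp only [closed] at e4 ⊢
    linear_combination e2 + e3 - k1 + emb K (X 0) * e4
  have h3 := h1 n
  rw [h2 _ (by omega), sub_self, sub_eq_zero] at h3
  exact ⟨h2 _ (by omega), h3⟩

theorem rise_inc (hs : s ^ 2 = discr (X 0) (X 1)) (hs₁ : MvPowerSeries.constantCoeff s = 1) (n : ℕ) :
    riseB K 2 .rise .inc n + riseB K 3 .rise .inc n = closed K s coefPeakUp n := by
  have H := sqrtDiscr_emb (K := K) hs
  have e1 := fun r n => riseB_succ (K := K) (r := r) (q := .rise) (σ := .inc) (n := n)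
  have e2 := fun r n => riseT_succ (K := K) (r := r) (q := .rise) (σ := .inc) (n := n)
  have e3 := fun r n => cont_succ_of_not_final (K := K) (r := r) (q := .rise) (σ := .inc)
    (n := n) not_false
  simp only [Upper.up, Upper.down, Lower.up, Lower.down, fallB_dead] at e1 e2 e3
  refine eq_of_forward (f := fun n => riseB K 2 .rise .inc n + riseB K 3 .rise .inc n)
    (h := fun n => riseT K 2 .rise .inc n + riseT K 3 .rise .inc n)
    (h' := closed K s coefPeakStay) (boundedDenom_riseB.add boundedDenom_riseB)
    (boundedDenom_closed hs₁ _) ?_ (fun n => ?_) (fun n => ?_) n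
  · rw [closed_zero hs _ coefPeakUp_zeroIrr 0 coefPeakUp_zeroRat, riseB_zero, riseB_zero, add_zero]
  · have k1 := H.eval_eq (coefPeakUp_eq H) (n + 1)
    simp only [eval_sub, eval_back H] at k1
    simp only [closed]
    linear_combination e1 2 n + e1 3 n - k1
  · have e4 := dip_inc (K := K) hs hs₁ n
    have k1 := H.eval_eq (coefPeak_eq H) (n + 1)
    have k2 := H.eval_eq (coefPeakStay_eq H) (n + 2)
    simp only [eval_add, eval_sub, eval_smul, eval_back H] at k1 k2
    simp only [closed] at e4 ⊢
    linear_combination e2 2 n + e2 3 n - k2 + emb K (X 0) * (e3 2 n + e3 3 n - e1 2 n - e1 3 n +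
      e4 - k1)

/-- The closed forms for `rise` and `dec` are valid from height three on. At heights two and one the
same recurrences hold for the series, but the closed forms refer to values at height zero that
belong to no series. The resulting errors `B₂` and `B₁` are computed and taken into account. -/
theorem rise_dec (hs : s ^ 2 = discr (X 0) (X 1)) (hs₁ : MvPowerSeries.constantCoeff s = 1) :
    emb K (X 1) * (riseT K 2 .rise .dec 1 + riseT K 3 .rise .dec 1) =
      -(2 * emb K (X 0) ^ 2 * polyA (emb K (X 0)) (emb K (X 1)) * (emb K s) /
        ((1 - emb K (X 0)) ^ 3 * ((1 - emb K (X 0)) ^ 2 - emb K (X 1)) *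
          emb K (discr (X 0) (X 1)) ^ 3)) -
      emb K (X 0) ^ 2 * polyB (emb K (X 0)) (emb K (X 1)) /
        ((1 - emb K (X 0)) ^ 5 * ((1 - emb K (X 0)) ^ 2 - emb K (X 1)) ^ 3 *
          emb K (discr (X 0) (X 1)) ^ 3) := by
  have H := sqrtDiscr_emb (K := K) hs
  have hx : (1 : K) - emb K (X 0) ≠ 0 := one_sub_X_ne_zero
  have e1 := fun r n => fallB_succ (K := K) (r := r) (q := .rise) (σ := .dec) (n := n)
  have e2 := fun r n => riseT_succ (K := K) (r := r) (q := .rise) (σ := .dec) (n := n)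
  have e3 := fun r n => cont_succ_of_not_final (K := K) (r := r) (q := .rise) (σ := .dec)
    (n := n) not_false
  have e4 := rise_inc (K := K) hs hs₁
  have k1 := fun n => H.eval_eq (coefPeakFallDown_eq H) (n + 1)
  have k2 := fun n => H.eval_eq (coefPeakFallStay_eq H) (n + 1)
  have k3 := fun n => H.eval_eq (coefPeakFall_eq H) (n + 1)
  simp only [Upper.up, Upper.down, Lower.up, Lower.down] at e1 e2 e3
  simp only [eval_add, eval_sub, eval_smul, eval_back H] at k1 k2 k3
  simp only [closed] at e4
  -- The bound is one more than in `dip_dec`, since a step down from `rise` leads to `dip` at the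
  -- height below.
  have h3 : ∀ n, 3 ≤ n → fallB K 2 .rise .dec n + fallB K 3 .rise .dec n =
      closed K s coefPeakFallDown n := by
    refine eq_of_backward₂ (f := fun n => fallB K 2 .rise .dec n + fallB K 3 .rise .dec n)
      (e := fun n => riseT K 2 .rise .dec n + riseT K 3 .rise .dec n)
      (e' := closed K s coefPeakFallStay) (boundedDenom_fallB.add boundedDenom_fallB)
      (boundedDenom_closed hs₁ _) 3 (fun n hn => ?_) (fun n hn => ?_)
    · obtain ⟨n, rfl⟩ := Nat.exists_eq_add_of_le' hn
      simp only [closed]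
      linear_combination e1 2 (n + 2) + e1 3 (n + 2) - k1 (n + 3)
    · obtain ⟨n, rfl⟩ := Nat.exists_eq_add_of_le' hn
      have e5 := (dip_dec (K := K) hs hs₁ n).2
      simp only [closed] at e5 ⊢
      linear_combination e2 2 (n + 2) + e2 3 (n + 2) - k2 (n + 3) + emb K (X 0) * (e3 2 (n + 2) +
        e3 3 (n + 2) - e1 2 (n + 2) - e1 3 (n + 2) + e4 (n + 2) + e5 - k3 (n + 2))
  have b3 := h3 3 le_rfl
  have b4 := h3 4 (by omega)
  have d2 := (dip_dec (K := K) hs hs₁ 0).1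
  have d1 := (dip_dec_succ (K := K) 1 0).2
  have d1' := (dip_dec_succ (K := K) 2 0).2
  have u0 := e3 2 0
  have u0' := e3 3 0
  have u1 := e3 2 1
  have u1' := e3 3 1
  have a0 := H.eval_eq (coefDipFallDown_eq H) 2
  have a1 := H.eval_eq (coefDipFall_eq H) 1
  have z1 := closed_zero (K := K) hs _ coefDip_zeroIrr 0 coefDip_zeroRat
  have z2 := closed_zero (K := K) hs _ coefPeakUp_zeroIrr 0 coefPeakUp_zeroRat
  have c1 := k1 1
  have c2 := k1 2
  have c3 := k1 3
  have f2 := k2 2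
  have f1 := k2 1
  have g1 := k3 1
  have g0 := k3 0
  simp only [zero_add, Nat.reduceAdd] at d2 d1 d1' u0 u0' u1 u1' a0 a1 c1 c2 c3 f1 f2 g1 g0
  have w1 := e1 2 0
  have w1' := e1 3 0
  have w2 := e1 2 1
  have w2' := e1 3 1
  have w3 := e1 2 2
  have w3' := e1 3 2
  have v1 := e2 2 0
  have v1' := e2 3 0
  have v2 := e2 2 1
  have v2' := e2 3 1
  simp only [zero_add, Nat.reduceAdd] at w1 w1' w2 w2' w3 w3' v1 v1' v2 v2'
  have o2 : fallT K 2 .dip .dec 1 = _ := dip_dec_one 1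
  have o3 : fallT K 3 .dip .dec 1 = _ := dip_dec_one 2
  simp only [Nat.reduceAdd] at o2 o3
  rw [fallT_zero, riseB_zero] at u0 u0'
  rw [o2] at u1 d1
  rw [o3] at u1' d1'
  have p1 := e4 1
  simp only [eval_add, eval_sub, eval_smul, eval_back H, closed] at b3 b4 d2 a0 a1 z1 z2
  have t0 := eval_one H (coefPeakFallStay (emb K (X 0)) (emb K (X 1)) (emb K (discr (X 0) (X 1))))
  have t1 := eval_zero (x := emb K (X 0)) (y := emb K (X 1)) (s := emb K s)
    (coefLand (emb K (X 0)) (emb K (X 1)) (emb K (discr (X 0) (X 1))))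
  have t2 := eval_zero (x := emb K (X 0)) (y := emb K (X 1)) (s := emb K s)
    (coefDipFall (emb K (X 0)) (emb K (X 1)) (emb K (discr (X 0) (X 1))))
  have t3 := total_rat H
  have t4 := total_irr H
  -- From here on only linear relations between values are used, so the explicit vectors and series
  -- are made opaque.
  generalize coefPeakFallDown (emb K (X 0)) (emb K (X 1)) (emb K (discr (X 0) (X 1))) = C1 at *
  generalize coefPeakFallStay (emb K (X 0)) (emb K (X 1)) (emb K (discr (X 0) (X 1))) = C2 at *
  generalize coefPeakFall (emb K (X 0)) (emb K (X 1)) (emb K (discr (X 0) (X 1))) = C3 at *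
  generalize coefDipFall (emb K (X 0)) (emb K (X 1)) (emb K (discr (X 0) (X 1))) = C4 at *
  generalize coefLand (emb K (X 0)) (emb K (X 1)) (emb K (discr (X 0) (X 1))) = C5 at *
  generalize emb K (X 0) = x at *
  generalize emb K (X 1) = y at *
  generalize emb K (discr (X 0) (X 1)) = D at *
  generalize emb K s = S at *
  set B₁ := fallB K 2 .rise .dec 1 + fallB K 3 .rise .dec 1 - C1.eval x y S 1 with hB₁
  set B₂ := fallB K 2 .rise .dec 2 + fallB K 3 .rise .dec 2 - C1.eval x y S 2 with hB₂
  -- At height one the closed form of `dip` contains the value of `coefLand` at height zero, whereas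
  -- the series has no such contribution.
  have m0 : (1 - x) * (fallB₀ K 2 .dip .dec 1 + fallB₀ K 3 .dip .dec 1 - C4.eval x y S 1) =
      -(C5.eval x y S 0) := by
    linear_combination d1 + d1' + y * d2 - a1 - z1 - a0
  -- The error in `dip` at height one propagates to `rise` at height two.
  have m2 : (1 - x) * B₂ =
      x * (fallB₀ K 2 .dip .dec 1 + fallB₀ K 3 .dip .dec 1 - C4.eval x y S 1) := by
    linear_combination w2 + w2' + v2 + v2' - c2 - f2 +
      x * (u1 + u1' - g1 - w2 - w2' + p1) + 2 * y * b3 - y * (w3 + w3') - y ^ 2 * b4 + y * c3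
  -- At height one there are two sources: the error at height two, and the value of `coefDipFall` at
  -- height zero, where the series `fallT` vanishes.
  have m1 : (1 - x) * B₁ = 2 * y * B₂ - x * C4.eval x y S 0 := by
    linear_combination w1 + w1' - c1 + v1 + v1' - f1 + x * (u0 + u0' - g0 - z2 - w1 - w1') -
      y * (w2 + w2' - c2 + y * b3)
  have n2 : B₂ = -(x * C5.eval x y S 0 / (1 - x) ^ 2) := by
    rw [← neg_div, eq_div_iff (pow_ne_zero 2 hx)]
    linear_combination (1 - x) * m2 + x * m0
  have n1 : B₁ = (2 * y * B₂ - x * C4.eval x y S 0) / (1 - x) := by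
    rw [eq_div_iff hx]
    linear_combination m1
  -- `riseT` at height one is `fallB` at height one minus `y` times `fallB` at height two, for the
  -- series and for the closed forms alike.
  have n0 : riseT K 2 .rise .dec 1 + riseT K 3 .rise .dec 1 = C2.eval x y S 1 + B₁ - y * B₂ := by
    linear_combination c1 - w1 - w1'
  rw [n0, n1, n2, t0, t1, t2]
  linear_combination t3 + S * t4

end stages

/-! ### The sequences that the automata accept -/

/-- The automaton with the moves `u` (unit step up) and `v` (unit step down) reads the values
`f 0, …, f n` and ends in a state of `F`. -/
def Run {S : Type*} (u v : S → S) (F : S → Prop) : S → (ℕ → ℤ) → ℕ → Prop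
  | s, _, 0 => F s
  | s, f, n + 1 => Run u v F (moveBy u v s (f 1 - f 0)) (fun i => f (i + 1)) n

/-- The sequence is weakly increasing from `i` to `j`. -/
def Incr (f : ℕ → ℤ) (i j : ℕ) : Prop := ∀ k, i ≤ k → k < j → f k ≤ f (k + 1)

/-- The sequence is weakly decreasing from `i` to `j`. -/
def Decr (f : ℕ → ℤ) (i j : ℕ) : Prop := ∀ k, i ≤ k → k < j → f (k + 1) ≤ f k

section monotone

variable {f : ℕ → ℤ} {i j k l : ℕ}

theorem Incr.le (h : Incr f i j) (hi : i ≤ k) (hkl : k ≤ l) (hl : l ≤ j) : f k ≤ f l := by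
  induction l, hkl using Nat.le_induction with
  | base => exact le_rfl
  | succ l hkl ih => exact (ih (by omega)).trans (h l (by omega) (by omega))

theorem Decr.le (h : Decr f i j) (hi : i ≤ k) (hkl : k ≤ l) (hl : l ≤ j) : f l ≤ f k := by
  induction l, hkl using Nat.le_induction with
  | base => exact le_rfl
  | succ l hkl ih => exact (h l (by omega) (by omega)).trans (ih (by omega))

theorem Incr.mono (h : Incr f i j) (hi : i ≤ k) (hl : l ≤ j) : Incr f k l :=
  fun m h1 h2 => h m (by omega) (by omega)

theorem Decr.mono (h : Decr f i j) (hi : i ≤ k) (hl : l ≤ j) : Decr f k l :=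
  fun m h1 h2 => h m (by omega) (by omega)

theorem Incr.trans (h : Incr f i j) (h' : Incr f j k) : Incr f i k := fun m h1 h2 =>
  (lt_or_ge m j).elim (h m h1) (fun h3 => h' m h3 h2)

theorem Decr.trans (h : Decr f i j) (h' : Decr f j k) : Decr f i k := fun m h1 h2 =>
  (lt_or_ge m j).elim (h m h1) (fun h3 => h' m h3 h2)

theorem incr_shift : Incr (fun i => f (i + 1)) i j ↔ Incr f (i + 1) (j + 1) := by
  constructor
  · intro h k h1 h2
    obtain ⟨k, rfl⟩ := Nat.exists_eq_add_of_le' (show 1 ≤ k by omega)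
    exact h k (by omega) (by omega)
  · exact fun h k h1 h2 => h (k + 1) (by omega) (by omega)

theorem decr_shift : Decr (fun i => f (i + 1)) i j ↔ Decr f (i + 1) (j + 1) := by
  constructor
  · intro h k h1 h2
    obtain ⟨k, rfl⟩ := Nat.exists_eq_add_of_le' (show 1 ≤ k by omega)
    exact h k (by omega) (by omega)
  · exact fun h k h1 h2 => h (k + 1) (by omega) (by omega)

theorem incr_self : Incr f i i := fun _ h1 h2 => by omega

theorem decr_self : Decr f i i := fun _ h1 h2 => by omega

theorem incr_step (h : f i ≤ f (i + 1)) : Incr f i (i + 1) := fun k h1 h2 => by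
  obtain rfl : k = i := by omega
  exact h

theorem decr_step (h : f (i + 1) ≤ f i) : Decr f i (i + 1) := fun k h1 h2 => by
  obtain rfl : k = i := by omega
  exact h

/-- The sequence decreases and then increases. -/
def Valley (f : ℕ → ℤ) (n : ℕ) : Prop := ∃ m ≤ n, Decr f 0 m ∧ Incr f m n

/-- The sequence increases to a mode that is at least `k` higher than the first term, and then
decreases. -/
def ClimbBy (k : ℕ) (f : ℕ → ℤ) (n : ℕ) : Prop :=
  ∃ p ≤ n, Incr f 0 p ∧ Decr f p n ∧ f 0 + k ≤ f p

/-- The sequence decreases by `d`, increases to a mode that is at least `r` higher, and then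
decreases. -/
def DipBy (d r : ℕ) (f : ℕ → ℤ) (n : ℕ) : Prop :=
  ∃ c p, c ≤ p ∧ p ≤ n ∧ Decr f 0 c ∧ f c = f 0 - d ∧ Incr f c p ∧ Decr f p n ∧ f c + r ≤ f p

/-- The sequence increases to a mode, decreases by two, increases to a second mode that is at least
`r` higher, and then decreases. -/
def Indent (r : ℕ) (f : ℕ → ℤ) (n : ℕ) : Prop :=
  ∃ a c p, a ≤ c ∧ c ≤ p ∧ p ≤ n ∧ Incr f 0 a ∧ Decr f a c ∧ f c = f a - 2 ∧ Incr f c p ∧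
    Decr f p n ∧ f c + r ≤ f p

/-- The truncation at zero expresses that the mode may be higher than required. -/
theorem climbBy_shift {m n : ℕ} (h0 : f 0 ≤ f 1) (k : ℕ) (hm : (m : ℤ) = max (k - (f 1 - f 0)) 0) :
    ClimbBy m (fun i => f (i + 1)) n ↔ ClimbBy k f (n + 1) := by
  constructor
  · rintro ⟨p, h1, h2, h3, h4⟩
    rw [incr_shift] at h2
    rw [decr_shift] at h3
    simp only [zero_add] at h4
    have h5 := h2.le le_rfl (by omega) le_rfl
    simp only [zero_add] at h5
    exact ⟨p + 1, by omega, (incr_step h0).trans h2, h3, by omega⟩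
  · rintro ⟨p, h1, h2, h3, h4⟩
    rcases p with _ | p
    · have h5 := h3 0 le_rfl (by omega)
      simp only [zero_add] at h5
      refine ⟨0, by omega, incr_self, decr_shift.2 (h3.mono (by omega) le_rfl), ?_⟩
      simp only [zero_add]
      omega
    · have h5 := h2.le (k := 1) (by omega) (show 1 ≤ p + 1 by omega) le_rfl
      exact ⟨p, by omega, incr_shift.2 (h2.mono (by omega) le_rfl), decr_shift.2 h3, by
        simp only [zero_add]; omega⟩

theorem climbBy_of_lt {n : ℕ} (h0 : f 1 < f 0) (k : ℕ) :
    ClimbBy k f (n + 1) ↔ k = 0 ∧ Decr f 0 (n + 1) := by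
  constructor
  · rintro ⟨p, h1, h2, h3, h4⟩
    rcases p with _ | p
    · exact ⟨by omega, h3⟩
    · have := h2 0 le_rfl (by omega)
      simp only [zero_add] at this
      omega
  · rintro ⟨rfl, h⟩
    exact ⟨0, by omega, incr_self, h, by simp⟩

theorem dipBy_shift {d e r n : ℕ} (hd : 0 < d) (h0 : f 1 ≤ f 0) (he : (e : ℤ) = d - (f 0 - f 1)) :
    DipBy e r (fun i => f (i + 1)) n ↔ DipBy d r f (n + 1) := by
  constructor
  · rintro ⟨c, p, h1, h2, h3, h4, h5, h6, h7⟩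
    simp only [zero_add] at h4
    exact ⟨c + 1, p + 1, by omega, by omega, (decr_step h0).trans (decr_shift.1 h3), by omega,
      incr_shift.1 h5, decr_shift.1 h6, h7⟩
  · rintro ⟨c, p, h1, h2, h3, h4, h5, h6, h7⟩
    rcases c with _ | c
    · omega
    · obtain ⟨p, rfl⟩ := Nat.exists_eq_add_of_le' (show 1 ≤ p by omega)
      exact ⟨c, p, by omega, by omega, decr_shift.2 (h3.mono (by omega) le_rfl), by
        simp only [zero_add]; omega, incr_shift.2 h5, decr_shift.2 h6, h7⟩

/-- A weakly decreasing stretch with equal ends is constant, so it can be joined to the increasing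
stretch that follows. -/
theorem dipBy_zero {r n : ℕ} : DipBy 0 r f n ↔ ClimbBy r f n := by
  constructor
  · rintro ⟨c, p, h1, h2, h3, h4, h5, h6, h7⟩
    refine ⟨p, h2, Incr.trans (fun k _ hk => ?_) h5, h6, by push_cast at h4; omega⟩
    have h8 := h3.le (Nat.zero_le _) hk.le le_rfl
    have h9 := h3.le le_rfl (Nat.zero_le (k + 1)) hk
    have h10 := h3.le le_rfl (Nat.zero_le k) hk.le
    have h11 := h3.le (Nat.zero_le _) (show k + 1 ≤ c by omega) le_rfl
    push_cast at h4
    omega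
  · rintro ⟨p, h1, h2, h3, h4⟩
    exact ⟨0, p, by omega, h1, decr_self, by simp, h2, h3, h4⟩

theorem not_dipBy {d r n : ℕ} (hd : 0 < d) (h0 : f 0 < f 1 ∨ (d : ℤ) < f 0 - f 1) :
    ¬ DipBy d r f (n + 1) := by
  rintro ⟨c, p, h1, h2, h3, h4, h5, h6, h7⟩
  rcases c with _ | c
  · omega
  · have h8 := h3.le (Nat.zero_le 1) (show 1 ≤ c + 1 by omega) le_rfl
    have h9 := h3 0 le_rfl (by omega)
    simp only [zero_add] at h9
    omega

theorem indent_shift {r n : ℕ} (h0 : f 0 ≤ f 1) :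
    Indent r (fun i => f (i + 1)) n ↔ Indent r f (n + 1) := by
  constructor
  · rintro ⟨a, c, p, h1, h2, h3, h4, h5, h6, h7, h8, h9⟩
    exact ⟨a + 1, c + 1, p + 1, by omega, by omega, by omega,
      (incr_step h0).trans (incr_shift.1 h4), decr_shift.1 h5, h6, incr_shift.1 h7,
      decr_shift.1 h8, h9⟩
  · rintro ⟨a, c, p, h1, h2, h3, h4, h5, h6, h7, h8, h9⟩
    -- If the first mode is at index `0`, the hypothesis forces `f 0 = f 1`, and the mode of the
    -- tail is again at index `0`.
    rcases a with _ | a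
    · rcases c with _ | c
      · omega
      obtain ⟨p, rfl⟩ := Nat.exists_eq_add_of_le' (show 1 ≤ p by omega)
      have h10 := h5 0 le_rfl (by omega)
      simp only [zero_add] at h10
      exact ⟨0, c, p, by omega, by omega, by omega, incr_self,
        decr_shift.2 (h5.mono (by omega) le_rfl), by simp only [zero_add]; omega, incr_shift.2 h7,
        decr_shift.2 h8, h9⟩
    · obtain ⟨p, rfl⟩ := Nat.exists_eq_add_of_le' (show 1 ≤ p by omega)
      obtain ⟨c, rfl⟩ := Nat.exists_eq_add_of_le' (show 1 ≤ c by omega)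
      exact ⟨a, c, p, by omega, by omega, by omega, incr_shift.2 (h4.mono (by omega) le_rfl),
        decr_shift.2 h5, h6, incr_shift.2 h7, decr_shift.2 h8, h9⟩

theorem indent_of_lt {r n : ℕ} (h0 : f 1 < f 0) : Indent r f (n + 1) ↔ DipBy 2 r f (n + 1) := by
  constructor
  · rintro ⟨a, c, p, h1, h2, h3, h4, h5, h6, h7, h8, h9⟩
    rcases a with _ | a
    · exact ⟨c, p, h2, h3, h5, h6, h7, h8, h9⟩
    · have := h4 0 le_rfl (by omega)
      simp only [zero_add] at this
      omega
  · rintro ⟨c, p, h2, h3, h5, h6, h7, h8, h9⟩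
    exact ⟨0, c, p, by omega, h2, h3, incr_self, h5, h6, h7, h8, h9⟩

end monotone

section run

variable {r : ℕ} {f : ℕ → ℤ} {n : ℕ}

theorem not_run_dead (f : ℕ → ℤ) (n : ℕ) :
    ¬ Run Upper.up (Upper.down r) Upper.Final .dead f n := by
  induction n generalizing f with
  | zero => exact not_false
  | succ n ih =>
    rw [Run, moveBy_fixed rfl rfl]
    exact ih _

theorem moveBy_fall {d : ℤ} (h : d ≤ 0) :
    moveBy Upper.up (Upper.down r) .fall d = .fall := by
  rcases h.lt_or_eq with h | rfl
  · rw [moveBy, if_neg (by omega)]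
    exact Function.iterate_fixed rfl _
  · rfl

theorem moveBy_climb {d : ℤ} (h : 0 ≤ d) (k : ℕ) :
    moveBy Upper.up (Upper.down r) (.climb k) d = .climb (k - d.toNat) := by
  rw [moveBy, if_pos h]
  generalize d.toNat = m
  induction m generalizing k with
  | zero => rfl
  | succ m ih =>
    rw [Function.iterate_succ_apply, Upper.up, ih]
    congr 1
    omega

theorem moveBy_rise {d : ℤ} (h : 0 ≤ d) :
    moveBy Upper.up (Upper.down r) .rise d = .rise := by
  rw [moveBy, if_pos h]
  exact Function.iterate_fixed rfl _

theorem run_fall (f : ℕ → ℤ) (n : ℕ) :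
    Run Upper.up (Upper.down r) Upper.Final .fall f n ↔ Decr f 0 n := by
  induction n generalizing f with
  | zero => exact ⟨fun _ => decr_self, fun _ => trivial⟩
  | succ n ih =>
    rw [Run]
    rcases le_or_gt (f 1) (f 0) with h | h
    · rw [moveBy_fall (by omega), ih, decr_shift]
      exact ⟨(decr_step h).trans, fun h => h.mono (by omega) le_rfl⟩
    · rw [moveBy_up (by omega)]
      change Run _ _ _ (moveBy _ _ Upper.dead _) _ _ ↔ _
      rw [moveBy_fixed rfl rfl]
      refine ⟨fun h' => absurd h' (not_run_dead _ _), fun h' => ?_⟩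
      have := h' 0 le_rfl (by omega)
      simp only [zero_add] at this
      omega

theorem run_climb (k : ℕ) (f : ℕ → ℤ) (n : ℕ) :
    Run Upper.up (Upper.down r) Upper.Final (.climb k) f n ↔ ClimbBy k f n := by
  induction n generalizing f k with
  | zero =>
    constructor
    · intro h
      obtain rfl : k = 0 := by
        rcases k with _ | k
        · rfl
        · exact h.elim
      exact ⟨0, le_rfl, incr_self, decr_self, by simp⟩
    · rintro ⟨p, hp, -, -, h⟩
      obtain rfl : p = 0 := by omega
      obtain rfl : k = 0 := by omega
      trivial
  | succ n ih =>
    rw [Run]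
    rcases le_or_gt (f 0) (f 1) with h | h
    · rw [moveBy_climb (by omega), ih, climbBy_shift h k (by omega)]
    · rw [moveBy_down (by omega), climbBy_of_lt h]
      rcases k with _ | k
      · change Run _ _ _ (moveBy _ _ Upper.fall _) _ _ ↔ _
        rw [moveBy_fall (by omega), run_fall, decr_shift]
        exact ⟨fun h' => ⟨rfl, (decr_step h.le).trans h'⟩, fun h' => h'.2.mono (by omega) le_rfl⟩
      · change Run _ _ _ (moveBy _ _ Upper.dead _) _ _ ↔ _
        rw [moveBy_fixed rfl rfl]
        exact ⟨fun h' => absurd h' (not_run_dead _ _), fun h' => absurd h'.1 (by omega)⟩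

theorem run_dip (hr : 0 < r) (f : ℕ → ℤ) (n : ℕ) :
    Run Upper.up (Upper.down r) Upper.Final .dip f n ↔ DipBy 1 r f n := by
  induction n generalizing f with
  | zero =>
    refine ⟨fun h => h.elim, ?_⟩
    rintro ⟨c, p, h1, h2, -, h3, -⟩
    obtain rfl : c = 0 := by omega
    omega
  | succ n ih =>
    rw [Run]
    rcases lt_trichotomy (f 0) (f 1) with h | h | h
    · rw [moveBy_up (by omega)]
      change Run _ _ _ (moveBy _ _ Upper.dead _) _ _ ↔ _
      rw [moveBy_fixed rfl rfl]
      exact ⟨fun h' => absurd h' (not_run_dead _ _), fun h' =>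
        absurd h' (not_dipBy one_pos (Or.inl h))⟩
    · rw [h, sub_self, moveBy_zero, ih, dipBy_shift one_pos h.ge (by omega)]
    · rw [moveBy_down (by omega)]
      change Run _ _ _ (moveBy _ _ (Upper.climb r) _) _ _ ↔ _
      rcases (show f 1 - f 0 + 1 ≤ 0 by omega).lt_or_eq with h1 | h1
      · obtain ⟨r, rfl⟩ := Nat.exists_eq_add_of_le' hr
        rw [moveBy_down h1]
        change Run _ _ _ (moveBy _ _ Upper.dead _) _ _ ↔ _
        rw [moveBy_fixed rfl rfl]
        exact ⟨fun h' => absurd h' (not_run_dead _ _), fun h' =>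
          absurd h' (not_dipBy one_pos (Or.inr (by push_cast; omega)))⟩
      · rw [h1, moveBy_zero, run_climb, ← dipBy_zero, dipBy_shift one_pos h.le]
        push_cast
        omega

/-- A first drop by one leads to `dip`, a drop by exactly two to `climb r`, and a larger one is
fatal. The last claim needs `0 < r`, as `climb 0` may go on to fall. -/
theorem run_rise (hr : 0 < r) (f : ℕ → ℤ) (n : ℕ) :
    Run Upper.up (Upper.down r) Upper.Final .rise f n ↔ Indent r f n := by
  induction n generalizing f with
  | zero =>
    refine ⟨fun h => h.elim, ?_⟩
    rintro ⟨a, c, p, h1, h2, h3, -, -, h4, -⟩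
    obtain rfl : c = 0 := by omega
    obtain rfl : a = 0 := by omega
    omega
  | succ n ih =>
    rw [Run]
    rcases le_or_gt (f 0) (f 1) with h | h
    · rw [moveBy_rise (by omega), ih, indent_shift h]
    · rw [moveBy_down (by omega), indent_of_lt h]
      change Run _ _ _ (moveBy _ _ Upper.dip _) _ _ ↔ _
      rcases (show f 1 - f 0 + 1 ≤ 0 by omega).lt_or_eq with h1 | h1
      · rw [moveBy_down h1]
        change Run _ _ _ (moveBy _ _ (Upper.climb r) _) _ _ ↔ _
        rcases (show f 1 - f 0 + 1 + 1 ≤ 0 by omega).lt_or_eq with h2 | h2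
        · obtain ⟨r, rfl⟩ := Nat.exists_eq_add_of_le' hr
          rw [moveBy_down h2]
          change Run _ _ _ (moveBy _ _ Upper.dead _) _ _ ↔ _
          rw [moveBy_fixed rfl rfl]
          exact ⟨fun h' => absurd h' (not_run_dead _ _), fun h' =>
            absurd h' (not_dipBy two_pos (Or.inr (by push_cast; omega)))⟩
        · rw [h2, moveBy_zero, run_climb, ← dipBy_zero, dipBy_shift two_pos h.le]
          push_cast
          omega
      · rw [h1, moveBy_zero, run_dip hr, dipBy_shift two_pos h.le]
        push_cast
        omega

theorem not_run_dead_bottom (f : ℕ → ℤ) (n : ℕ) :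
    ¬ Run Lower.up Lower.down (· ≠ .dead) .dead f n := by
  induction n generalizing f with
  | zero => exact fun h => h rfl
  | succ n ih =>
    rw [Run, moveBy_fixed rfl rfl]
    exact ih _

theorem moveBy_inc {d : ℤ} (h : 0 ≤ d) : moveBy Lower.up Lower.down .inc d = .inc := by
  rw [moveBy, if_pos h]
  exact Function.iterate_fixed rfl _

theorem moveBy_dec {d : ℤ} (h : d ≤ 0) : moveBy Lower.up Lower.down .dec d = .dec := by
  rcases h.lt_or_eq with h | rfl
  · rw [moveBy, if_neg (by omega)]
    exact Function.iterate_fixed rfl _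
  · rfl

theorem run_inc (f : ℕ → ℤ) (n : ℕ) :
    Run Lower.up Lower.down (· ≠ .dead) .inc f n ↔ Incr f 0 n := by
  induction n generalizing f with
  | zero => exact ⟨fun _ => incr_self, fun _ h => by cases h⟩
  | succ n ih =>
    rw [Run]
    rcases le_or_gt (f 0) (f 1) with h | h
    · rw [moveBy_inc (by omega), ih, incr_shift]
      exact ⟨(incr_step h).trans, fun h => h.mono (by omega) le_rfl⟩
    · rw [moveBy_down (by omega)]
      change Run _ _ _ (moveBy _ _ Lower.dead _) _ _ ↔ _
      rw [moveBy_fixed rfl rfl]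
      refine ⟨fun h' => absurd h' (not_run_dead_bottom _ _), fun h' => ?_⟩
      have := h' 0 le_rfl (by omega)
      simp only [zero_add] at this
      omega

theorem run_dec (f : ℕ → ℤ) (n : ℕ) :
    Run Lower.up Lower.down (· ≠ .dead) .dec f n ↔ Valley f n := by
  induction n generalizing f with
  | zero => exact ⟨fun _ => ⟨0, le_rfl, decr_self, incr_self⟩, fun _ h => by cases h⟩
  | succ n ih =>
    rw [Run]
    rcases le_or_gt (f 1) (f 0) with h | h
    · rw [moveBy_dec (by omega), ih]
      constructor
      · rintro ⟨m, h1, h2, h3⟩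
        exact ⟨m + 1, by omega, (decr_step h).trans (decr_shift.1 h2), incr_shift.1 h3⟩
      · rintro ⟨m, h1, h2, h3⟩
        rcases m with _ | m
        · exact ⟨0, by omega, decr_self, incr_shift.2 (h3.mono (by omega) le_rfl)⟩
        · exact ⟨m, by omega, decr_shift.2 (h2.mono (by omega) le_rfl), incr_shift.2 h3⟩
    · rw [moveBy_up (by omega)]
      change Run _ _ _ (moveBy _ _ Lower.inc _) _ _ ↔ _
      rw [moveBy_inc (by omega), run_inc, incr_shift]
      constructor
      · exact fun h' => ⟨0, by omega, decr_self, (incr_step h.le).trans h'⟩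
      · rintro ⟨m, h1, h2, h3⟩
        rcases m with _ | m
        · exact h3.mono (by omega) le_rfl
        · have := h2 0 le_rfl (by omega)
          simp only [zero_add] at this
          omega

end run

/-! ### Lists of columns up to translation -/

/-- The height of the bottom of the `i`-th column. -/
def bot (L : List (ℤ × ℤ)) (i : ℕ) : ℤ := (L.getD i 0).1

/-- The height of the top of the `i`-th column. -/
def top (L : List (ℤ × ℤ)) (i : ℕ) : ℤ := (L.getD i 0).2

/-- Consecutive columns share a cell. -/
def Overlapping (L : List (ℤ × ℤ)) : Prop :=
  ∀ i, i + 1 < L.length → max (bot L i) (bot L (i + 1)) < min (top L i) (top L (i + 1))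

theorem overlapping_cons_cons {c d : ℤ × ℤ} {L : List (ℤ × ℤ)} : Overlapping (c :: d :: L) ↔
    max c.1 d.1 < min c.2 d.2 ∧ Overlapping (d :: L) := by
  constructor
  · intro h
    refine ⟨h 0 (by simp), fun i hi => h (i + 1) (by simpa using hi)⟩
  · rintro ⟨h1, h2⟩ (_ | i) hi
    · exact h1
    · exact h2 i (by simpa using hi)

theorem valid_iff {r : ℕ} {q : Upper} {σ : Lower} {b t : ℤ} {L : List (ℤ × ℤ)} :
    Valid r q σ b t L ↔ Overlapping ((b, t) :: L) ∧
      Run Upper.up (Upper.down r) Upper.Final q (top ((b, t) :: L)) L.length ∧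
      Run Lower.up Lower.down (· ≠ .dead) σ (bot ((b, t) :: L)) L.length := by
  induction L generalizing q σ b t with
  | nil =>
    refine ⟨fun h => ⟨fun i hi => by simp at hi, h.1, h.2⟩, fun h => ⟨h.2.1, h.2.2⟩⟩
  | cons c L ih =>
    rw [Valid, ih, overlapping_cons_cons, List.length_cons, Run, Run, and_assoc]
    exact Iff.rfl

/-- The overlapping columns of a polygon with a valley below and, above, an indent of depth two
to the right of the first mode, and of depth at least `r` to the left of the second. -/
def Profile (r : ℕ) (L : List (ℤ × ℤ)) : Prop :=
  Overlapping L ∧ Indent r (top L) (L.length - 1) ∧ Valley (bot L) (L.length - 1)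

/-- Half the number of vertical steps of the polygon. -/
def perim : List (ℤ × ℤ) → ℕ
  | [] => 0
  | c :: L => (c.2 - c.1).toNat + ups c.1 c.2 L

/-- The lowest columns have their bottom at height zero. -/
def Grounded (L : List (ℤ × ℤ)) : Prop :=
  (∃ i < L.length, bot L i = 0) ∧ ∀ i < L.length, 0 ≤ bot L i

theorem Indent.pos {r : ℕ} {f : ℕ → ℤ} {n : ℕ} (h : Indent r f n) : 0 < n := by
  obtain ⟨a, c, p, h1, h2, h3, -, -, h4, -⟩ := h
  rcases Nat.eq_zero_or_pos n with rfl | h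
  · obtain rfl : a = 0 := by omega
    obtain rfl : c = 0 := by omega
    omega
  · exact h

section shift

variable (k : ℤ) (L : List (ℤ × ℤ))

theorem length_shift : (shift k L).length = L.length := by simp [shift]

variable {L} {i : ℕ}

theorem bot_shift (hi : i < L.length) : bot (shift k L) i = bot L i + k := by
  simp [bot, shift, hi]

theorem top_shift (hi : i < L.length) : top (shift k L) i = top L i + k := by
  simp [top, shift, hi]

end shift

section congr

variable {f g : ℕ → ℤ} {n : ℕ} {k : ℤ}

theorem Incr.congr (h : ∀ i ≤ n, g i = f i + k) {i j : ℕ} (hj : j ≤ n) (hf : Incr f i j) :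
    Incr g i j := fun l h1 h2 => by
  rw [h _ (by omega), h _ (by omega)]
  have := hf l h1 h2
  omega

theorem Decr.congr (h : ∀ i ≤ n, g i = f i + k) {i j : ℕ} (hj : j ≤ n) (hf : Decr f i j) :
    Decr g i j := fun l h1 h2 => by
  rw [h _ (by omega), h _ (by omega)]
  have := hf l h1 h2
  omega

theorem Indent.congr {r : ℕ} (h : ∀ i ≤ n, g i = f i + k) (hf : Indent r f n) : Indent r g n := by
  obtain ⟨a, c, p, h1, h2, h3, h4, h5, h6, h7, h8, h9⟩ := hf
  refine ⟨a, c, p, h1, h2, h3, h4.congr h (by omega), h5.congr h (by omega), ?_,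
    h7.congr h h3, h8.congr h le_rfl, ?_⟩
  · rw [h _ (by omega), h _ (by omega)]; omega
  · rw [h _ (by omega), h _ (by omega)]; omega

theorem Valley.congr (h : ∀ i ≤ n, g i = f i + k) (hf : Valley f n) : Valley g n := by
  obtain ⟨m, h1, h2, h3⟩ := hf
  exact ⟨m, h1, h2.congr h h1, h3.congr h le_rfl⟩

end congr

theorem Profile.shift {r : ℕ} {L : List (ℤ × ℤ)} (h : Profile r L) (k : ℤ) :
    Profile r (shift k L) := by
  have hL := h.2.1.pos
  refine ⟨fun i hi => ?_, ?_, ?_⟩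
  · rw [length_shift] at hi
    have := h.1 i hi
    rw [bot_shift k (by omega), bot_shift k (by omega), top_shift k (by omega),
      top_shift k (by omega)]
    omega
  · rw [length_shift]
    exact h.2.1.congr fun i hi => top_shift k (by omega)
  · rw [length_shift]
    exact h.2.2.congr fun i hi => bot_shift k (by omega)

theorem perim_shift (k : ℤ) (L : List (ℤ × ℤ)) : perim (shift k L) = perim L := by
  rcases L with _ | ⟨c, L⟩
  · rfl
  · have := ups_shift (b := c.1) (t := c.2) k L
    simp only [shift, List.map_cons, perim] at this ⊢
    rw [this, add_sub_add_right_eq_sub]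

open MvPowerSeries (X)

/-- The list is read after a fictitious column of height one in the state `rise`. The first actual
column has the same bottom and a top at least as high, which does not change the states. Only the
cells above the first one are counted by `ups`, which explains the additional factor `X 1` in
`gf_profile_zero`. -/
theorem cons_mem_steps_one {r : ℕ} (hr : 0 < r) {L : List (ℤ × ℤ)} :
    L ∈ steps r .rise .dec 0 1 (Set.Ici 0) {0} ↔ Profile r L ∧ bot L 0 = 0 := by
  rcases L with _ | ⟨c, L⟩
  · refine ⟨fun h => h.elim, fun h => ?_⟩
    exact absurd h.1.2.1.pos (by simp)
  · rw [cons_mem_steps, Profile, List.length_cons, Nat.add_sub_cancel]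
    simp only [Set.mem_Ici, Set.mem_singleton_iff]
    have h0 : bot (c :: L) 0 = c.1 := rfl
    rw [h0]
    constructor
    · rintro ⟨h1, h2, h3, h4⟩
      rw [h2, moveBy_rise h1, moveBy_zero, valid_iff, run_rise hr, run_dec] at h4
      exact ⟨h4, by omega⟩
    · rintro ⟨h4, h2⟩
      have h5 := h4.2.1.pos
      have h6 := h4.1 0 (by simpa using h5)
      have h7 : top (c :: L) 0 = c.2 := rfl
      rw [h0, h7] at h6
      refine ⟨by omega, by omega, by omega, ?_⟩
      rw [h2, sub_self, moveBy_zero, moveBy_rise (by omega), valid_iff, run_rise hr, run_dec]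
      rw [← h2]
      exact h4

theorem finite_fiber_profile_zero {r : ℕ} (hr : 0 < r) (i j : ℕ) :
    (fiber {L | Profile r L ∧ bot L 0 = 0} perim i j).Finite := by
  refine (finite_fiber_steps r .rise .dec 0 1 (Set.Ici 0) {0} i (j - 1)).subset ?_
  rintro L ⟨h1, h2, h3⟩
  replace h1 := (cons_mem_steps_one hr).2 h1
  refine ⟨h1, h2, ?_⟩
  rcases L with _ | ⟨c, L⟩
  · exact h1.elim
  · have h4 := h1.1
    have h5 := h1.2.1
    simp only [Set.mem_Ici, Set.mem_singleton_iff] at h4 h5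
    simp only [perim, ups] at h3 ⊢
    omega

theorem gf_profile_zero {r : ℕ} (hr : 0 < r) : gf {L | Profile r L ∧ bot L 0 = 0} perim =
    X 1 * stepGF r .rise .dec (Set.Ici 0) {0} 1 := by
  rw [stepGF, ← gf_add_one (wt := perim)]
  · congr 1
    ext L
    exact (cons_mem_steps_one hr).symm
  · rintro (_ | ⟨c, L⟩) h1
    · exact h1.elim
    · have h4 := h1.1
      have h5 := h1.2.1
      simp only [Set.mem_Ici, Set.mem_singleton_iff, Nat.cast_one] at h4 h5
      simp only [perim, ups, Nat.cast_one]
      omega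

theorem injOn_shift_grounded (h : List (ℤ × ℤ) → ℤ) :
    Set.InjOn (fun L => shift (h L) L) {L | Grounded L} := by
  intro L hL L' hL' hLL
  have h1 : L' = shift (h L - h L') L := by
    have := congrArg (shift (-h L')) hLL
    simp only [shift_shift] at this
    rw [add_neg_cancel, shift_zero] at this
    rw [sub_eq_add_neg, this]
  obtain ⟨⟨i, hi, hi0⟩, hp⟩ := hL
  rw [h1] at hL'
  obtain ⟨⟨i', hi', hi0'⟩, hp'⟩ := hL'
  rw [length_shift] at hi' hp'
  rw [bot_shift _ hi'] at hi0'
  have h2 := hp i' hi'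
  have h3 := hp' i hi
  rw [bot_shift _ hi] at h3
  rw [h1, show h L - h L' = 0 by omega, shift_zero]

/-- Both sides contain one representative of each translation class: on the left the lowest bottom
is at zero, on the right the first one. -/
theorem image_shift_grounded (r : ℕ) :
    (fun L => shift (-bot L 0) L) '' {L | Profile r L ∧ Grounded L} =
      {L | Profile r L ∧ bot L 0 = 0} := by
  ext L
  constructor
  · rintro ⟨L, ⟨h1, h2⟩, rfl⟩
    have := h1.2.1.pos
    refine ⟨h1.shift _, ?_⟩
    simp only
    rw [bot_shift _ (by omega)]
    ring
  · rintro ⟨h1, h2⟩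
    have h3 := h1.2.1.pos
    obtain ⟨m, hm1, hm2, hm3⟩ := h1.2.2
    refine ⟨shift (-bot L m) L, ⟨h1.shift _, ⟨m, ?_, ?_⟩, fun i hi => ?_⟩, ?_⟩
    · rw [length_shift]; omega
    · rw [bot_shift _ (by omega)]; ring
    · rw [length_shift] at hi
      rw [bot_shift _ hi]
      rcases le_total i m with h | h
      · have := hm2.le (Nat.zero_le _) h le_rfl
        omega
      · have := hm3.le le_rfl h (by omega)
        omega
    · simp only
      rw [shift_shift, bot_shift _ (by omega), h2, zero_add, neg_neg, neg_add_cancel, shift_zero]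

theorem finite_fiber_profile_grounded {r : ℕ} (hr : 0 < r) (i j : ℕ) :
    (fiber {L | Profile r L ∧ Grounded L} perim i j).Finite := by
  refine Set.Finite.of_finite_image (f := fun L => shift (-bot L 0) L) ?_
    ((injOn_shift_grounded _).mono fun L h => h.1.2)
  rw [← fiber_image (wt := perim) (fun L => length_shift _ L) (fun L _ => perim_shift _ L),
    image_shift_grounded]
  exact finite_fiber_profile_zero hr i j

theorem gf_profile_grounded {r : ℕ} (hr : 0 < r) : gf {L | Profile r L ∧ Grounded L} perim =
    X 1 * stepGF r .rise .dec (Set.Ici 0) {0} 1 := by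
  rw [← gf_profile_zero hr, ← image_shift_grounded, gf_image (wt' := perim)]
  · exact (injOn_shift_grounded _).mono fun L h => h.2
  · exact fun L => length_shift _ L
  · exact fun L _ => perim_shift _ L

/-! ### Mirror images -/

section reverse

theorem bot_reverse {L : List (ℤ × ℤ)} {i : ℕ} (hi : i < L.length) :
    bot L.reverse i = bot L (L.length - 1 - i) := by
  rw [bot, bot, List.getD_eq_getElem _ _ (by simpa using hi),
    List.getD_eq_getElem _ _ (by omega), List.getElem_reverse]

theorem top_reverse {L : List (ℤ × ℤ)} {i : ℕ} (hi : i < L.length) :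
    top L.reverse i = top L (L.length - 1 - i) := by
  rw [top, top, List.getD_eq_getElem _ _ (by simpa using hi),
    List.getD_eq_getElem _ _ (by omega), List.getElem_reverse]

/-- The mirror image of `Indent`. -/
def IndentLeft (r : ℕ) (f : ℕ → ℤ) (n : ℕ) : Prop :=
  ∃ a c p, a ≤ c ∧ c ≤ p ∧ p ≤ n ∧ Incr f 0 a ∧ Decr f a c ∧ f c + r ≤ f a ∧ Incr f c p ∧
    Decr f p n ∧ f c = f p - 2

variable {f g : ℕ → ℤ} {n : ℕ}

theorem Incr.reverse (h : ∀ i ≤ n, g i = f (n - i)) {i j : ℕ} (hi : i ≤ j) (hj : j ≤ n)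
    (hf : Incr f i j) : Decr g (n - j) (n - i) := fun k h1 h2 => by
  rw [h _ (by omega), h _ (by omega)]
  have := hf (n - (k + 1)) (by omega) (by omega)
  rwa [show n - (k + 1) + 1 = n - k by omega] at this

theorem Decr.reverse (h : ∀ i ≤ n, g i = f (n - i)) {i j : ℕ} (hi : i ≤ j) (hj : j ≤ n)
    (hf : Decr f i j) : Incr g (n - j) (n - i) := fun k h1 h2 => by
  rw [h _ (by omega), h _ (by omega)]
  have := hf (n - (k + 1)) (by omega) (by omega)
  rwa [show n - (k + 1) + 1 = n - k by omega] at this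

theorem Valley.reverse (h : ∀ i ≤ n, g i = f (n - i)) (hf : Valley f n) : Valley g n := by
  obtain ⟨m, h1, h2, h3⟩ := hf
  refine ⟨n - m, by omega, ?_, ?_⟩
  · have := h3.reverse h h1 le_rfl
    rwa [Nat.sub_self] at this
  · exact h2.reverse h (Nat.zero_le _) h1

theorem Indent.reverse {r : ℕ} (h : ∀ i ≤ n, g i = f (n - i)) (hf : Indent r f n) :
    IndentLeft r g n := by
  obtain ⟨a, c, p, h1, h2, h3, h4, h5, h6, h7, h8, h9⟩ := hf
  have e : ∀ i ≤ n, g (n - i) = f i := fun i hi => by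
    rw [h _ (by omega), show n - (n - i) = i by omega]
  refine ⟨n - p, n - c, n - a, by omega, by omega, by omega, ?_, h7.reverse h h2 h3, ?_,
    h5.reverse h h1 (by omega), h4.reverse h (Nat.zero_le _) (by omega), ?_⟩
  · have := h8.reverse h h3 le_rfl
    rwa [Nat.sub_self] at this
  · rw [e _ (by omega), e _ (by omega)]; exact h9
  · rw [e _ (by omega), e _ (by omega)]; exact h6

theorem IndentLeft.reverse {r : ℕ} (h : ∀ i ≤ n, g i = f (n - i)) (hf : IndentLeft r f n) :
    Indent r g n := by
  obtain ⟨a, c, p, h1, h2, h3, h4, h5, h6, h7, h8, h9⟩ := hf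
  have e : ∀ i ≤ n, g (n - i) = f i := fun i hi => by
    rw [h _ (by omega), show n - (n - i) = i by omega]
  refine ⟨n - p, n - c, n - a, by omega, by omega, by omega, ?_, h7.reverse h h2 h3, ?_,
    h5.reverse h h1 (by omega), h4.reverse h (Nat.zero_le _) (by omega), ?_⟩
  · have := h8.reverse h h3 le_rfl
    rwa [Nat.sub_self] at this
  · rw [e _ (by omega), e _ (by omega)]; exact h9
  · rw [e _ (by omega), e _ (by omega)]; exact h6

end reverse

/-- The mirror image of `Profile`. -/
def ProfileLeft (r : ℕ) (L : List (ℤ × ℤ)) : Prop :=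
  Overlapping L ∧ IndentLeft r (top L) (L.length - 1) ∧ Valley (bot L) (L.length - 1)

theorem Overlapping.reverse {L : List (ℤ × ℤ)} (h : Overlapping L) : Overlapping L.reverse := by
  intro i hi
  rw [List.length_reverse] at hi
  rw [bot_reverse (by omega), bot_reverse (by omega), top_reverse (by omega),
    top_reverse (by omega)]
  have := h (L.length - 1 - (i + 1)) (by omega)
  rw [show L.length - 1 - (i + 1) + 1 = L.length - 1 - i by omega] at this
  omega

theorem Grounded.reverse {L : List (ℤ × ℤ)} (h : Grounded L) : Grounded L.reverse := by
  obtain ⟨⟨i, hi, h0⟩, hp⟩ := h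
  refine ⟨⟨L.length - 1 - i, by rw [List.length_reverse]; omega, ?_⟩, fun j hj => ?_⟩
  · rw [bot_reverse (by omega), show L.length - 1 - (L.length - 1 - i) = i by omega, h0]
  · rw [List.length_reverse] at hj
    rw [bot_reverse hj]
    exact hp _ (by omega)

theorem image_reverse_profile (r : ℕ) : List.reverse '' {L | Profile r L ∧ Grounded L} =
    {L | ProfileLeft r L ∧ Grounded L} := by
  ext L
  constructor
  · rintro ⟨L, ⟨h, hg⟩, rfl⟩
    have hp := h.2.1.pos
    refine ⟨⟨h.1.reverse, ?_, ?_⟩, hg.reverse⟩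
    · rw [List.length_reverse]
      exact h.2.1.reverse fun i hi => top_reverse (by omega)
    · rw [List.length_reverse]
      exact h.2.2.reverse fun i hi => bot_reverse (by omega)
  · rintro ⟨h, hg⟩
    have hp : 0 < L.length := by
      obtain ⟨⟨i, hi, -⟩, -⟩ := hg
      omega
    refine ⟨L.reverse, ⟨⟨h.1.reverse, ?_, ?_⟩, hg.reverse⟩, L.reverse_reverse⟩
    · rw [List.length_reverse]
      exact h.2.1.reverse fun i hi => top_reverse (by omega)
    · rw [List.length_reverse]
      exact h.2.2.reverse fun i hi => bot_reverse (by omega)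

theorem ups_eq_sum (c : ℤ × ℤ) (L : List (ℤ × ℤ)) : ups c.1 c.2 L =
    ∑ i ∈ Finset.range L.length, ((top (c :: L) (i + 1) - top (c :: L) i).toNat +
      (bot (c :: L) i - bot (c :: L) (i + 1)).toNat) := by
  induction L generalizing c with
  | nil => rfl
  | cons d L ih =>
    rw [ups, ih, List.length_cons, Finset.sum_range_succ', add_comm]
    rfl

/-- Twice the positive part of an increment is its absolute value plus the increment, and the
increments telescope. The right-hand side is invariant under reversal and counts the vertical edges
of the polygon. -/
theorem two_mul_perim {L : List (ℤ × ℤ)} (h : bot L 0 ≤ top L 0) : (2 * perim L : ℤ) =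
    ∑ i ∈ Finset.range (L.length - 1), (|top L (i + 1) - top L i| + |bot L (i + 1) - bot L i|) +
      (top L 0 - bot L 0) + (top L (L.length - 1) - bot L (L.length - 1)) := by
  rcases L with _ | ⟨c, L⟩
  · simp [perim, top, bot]
  · have h1 := Finset.sum_range_sub (top (c :: L)) L.length
    have h2 := Finset.sum_range_sub (bot (c :: L)) L.length
    have h3 : top (c :: L) 0 = c.2 := rfl
    have h4 : bot (c :: L) 0 = c.1 := rfl
    rw [h3, h4] at h
    rw [perim, ups_eq_sum, List.length_cons, Nat.add_sub_cancel]
    push_cast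
    rw [mul_add, Finset.mul_sum, Int.toNat_of_nonneg (by omega)]
    have h5 : ∀ i, 2 * (((top (c :: L) (i + 1) - top (c :: L) i).toNat : ℤ) +
        ((bot (c :: L) i - bot (c :: L) (i + 1)).toNat : ℤ)) =
        (|top (c :: L) (i + 1) - top (c :: L) i| + |bot (c :: L) (i + 1) - bot (c :: L) i|) +
        (top (c :: L) (i + 1) - top (c :: L) i) - (bot (c :: L) (i + 1) - bot (c :: L) i) := by
      intro i
      rcases abs_cases (top (c :: L) (i + 1) - top (c :: L) i) with h | h <;>
      rcases abs_cases (bot (c :: L) (i + 1) - bot (c :: L) i) with h' | h' <;> omega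
    simp only [Int.ofNat_toNat] at h5 ⊢
    rw [Finset.sum_congr rfl fun i _ => h5 i, Finset.sum_sub_distrib, Finset.sum_add_distrib (f :=
      fun i => |top (c :: L) (i + 1) - top (c :: L) i| + |bot (c :: L) (i + 1) - bot (c :: L) i|),
      h1, h2, h3, h4]
    ring

theorem perim_reverse {L : List (ℤ × ℤ)} (hL : 2 ≤ L.length) (h : Overlapping L) :
    perim L.reverse = perim L := by
  have h0 := h 0 (by omega)
  have h1 := h.reverse 0 (by rw [List.length_reverse]; omega)
  have h2 : (2 * perim L.reverse : ℤ) = 2 * perim L := by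
    rw [two_mul_perim (by omega), two_mul_perim (by omega), List.length_reverse,
      ← Finset.sum_range_reflect, bot_reverse (by omega), top_reverse (by omega),
      bot_reverse (by omega), top_reverse (by omega), Nat.sub_zero, Nat.sub_self]
    rw [Finset.sum_congr rfl fun i hi => ?_, add_right_comm]
    rw [Finset.mem_range] at hi
    rw [top_reverse (by omega), top_reverse (by omega), bot_reverse (by omega),
      bot_reverse (by omega),
      show L.length - 1 - (L.length - 1 - 1 - i + 1) = i by omega,
      show L.length - 1 - (L.length - 1 - 1 - i) = i + 1 by omega, abs_sub_comm,
      abs_sub_comm (bot L i)]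
  omega

theorem two_le_length_of_profile {r : ℕ} {L : List (ℤ × ℤ)} (h : Profile r L) : 2 ≤ L.length := by
  have := h.2.1.pos
  omega

theorem finite_fiber_profileLeft {r : ℕ} (hr : 0 < r) (i j : ℕ) :
    (fiber {L | ProfileLeft r L ∧ Grounded L} perim i j).Finite := by
  rw [← image_reverse_profile, fiber_image (wt' := perim) (fun L => List.length_reverse)
    (fun L h => perim_reverse (two_le_length_of_profile h.1) h.1.1)]
  exact (finite_fiber_profile_grounded hr i j).image _

theorem gf_profileLeft {r : ℕ} (hr : 0 < r) : gf {L | ProfileLeft r L ∧ Grounded L} perim =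
    X 1 * stepGF r .rise .dec (Set.Ici 0) {0} 1 := by
  rw [← gf_profile_grounded hr, ← image_reverse_profile, gf_image (wt' := perim)]
  · exact List.reverse_injective.injOn
  · exact fun L => List.length_reverse
  · exact fun L h => perim_reverse (two_le_length_of_profile h.1) h.1.1

/-! ### Splitting by the higher of the two modes -/

/-- The sequence has two modes, which are separated by a single indent of depth two. -/
def TwoModes (f : ℕ → ℤ) (n : ℕ) : Prop :=
  ∃ a c p, a ≤ c ∧ c ≤ p ∧ p ≤ n ∧ Incr f 0 a ∧ Decr f a c ∧ Incr f c p ∧ Decr f p n ∧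
    min (f a) (f p) = f c + 2

/-- The depth is measured from the lower mode. If this is the left one, the right one is at least
two above the base; otherwise the left one is at least three above it. Ties are assigned to the
first case. -/
theorem twoModes_iff {f : ℕ → ℤ} {n : ℕ} : TwoModes f n ↔ Indent 2 f n ∨ IndentLeft 3 f n := by
  constructor
  · rintro ⟨a, c, p, h1, h2, h3, h4, h5, h6, h7, h8⟩
    rcases le_or_gt (f a) (f p) with h | h
    · exact Or.inl ⟨a, c, p, h1, h2, h3, h4, h5, by omega, h6, h7, by push_cast; omega⟩
    · exact Or.inr ⟨a, c, p, h1, h2, h3, h4, h5, by push_cast; omega, h6, h7, by omega⟩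
  · rintro (⟨a, c, p, h1, h2, h3, h4, h5, h6, h7, h8, h9⟩ |
      ⟨a, c, p, h1, h2, h3, h4, h5, h6, h7, h8, h9⟩)
    · exact ⟨a, c, p, h1, h2, h3, h4, h5, h7, h8, by push_cast at h9; omega⟩
    · exact ⟨a, c, p, h1, h2, h3, h4, h5, h7, h8, by push_cast at h6; omega⟩

/-- The first decomposition makes `f p` a maximum, whereas in the second one all values from `c'` on
are below `f a'`. So `p < c'`. But up to `c'` the second decomposition allows only one rise and one
descent, which leaves no room for the drop to `c` and the climb to `p`. -/
theorem not_indent_and_indentLeft {f : ℕ → ℤ} {n : ℕ} (h : Indent 2 f n) : ¬ IndentLeft 3 f n := by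
  obtain ⟨a, c, p, h1, h2, h3, h4, h5, h6, h7, h8, h9⟩ := h
  rintro ⟨a', c', p', k1, k2, k3, k4, k5, k6, k7, k8, k9⟩
  push_cast at h9 k6
  have hmax : f a' ≤ f p := by
    rcases le_total a' a with ha | ha
    · have := h4.le (Nat.zero_le _) ha le_rfl
      omega
    rcases le_total a' c with hc | hc
    · have := h5.le le_rfl ha hc
      omega
    rcases le_total a' p with hp | hp
    · exact h7.le hc hp le_rfl
    · exact h8.le le_rfl hp (by omega)
  have hpc : p < c' := by
    by_contra! hcp
    rcases le_total p p' with hp | hp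
    · have := k7.le hcp hp le_rfl
      omega
    · have := k8.le le_rfl hp h3
      omega
  rcases le_total c a' with hc | hc
  · have := k4.le (Nat.zero_le _) h1 hc
    omega
  · have := k5.le hc h2 hpc.le
    omega

/-- The columns of a bimodal polygon whose minimum bounding rectangle touches the axes. -/
def Bimodal (L : List (ℤ × ℤ)) : Prop :=
  Overlapping L ∧ TwoModes (top L) (L.length - 1) ∧ Valley (bot L) (L.length - 1) ∧ Grounded L

theorem setOf_bimodal : {L | Bimodal L} =
    {L | Profile 2 L ∧ Grounded L} ∪ {L | ProfileLeft 3 L ∧ Grounded L} := by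
  ext L
  change Bimodal L ↔ (Profile 2 L ∧ Grounded L) ∨ (ProfileLeft 3 L ∧ Grounded L)
  rw [Bimodal, twoModes_iff, Profile, ProfileLeft]
  tauto

theorem finite_fiber_bimodal (i j : ℕ) : (fiber {L | Bimodal L} perim i j).Finite := by
  refine ((finite_fiber_profile_grounded two_pos i j).union
    (finite_fiber_profileLeft three_pos i j)).subset ?_
  rintro L ⟨h1, h2⟩
  rw [setOf_bimodal] at h1
  exact h1.imp (⟨·, h2⟩) (⟨·, h2⟩)

theorem gf_bimodal : gf {L | Bimodal L} perim = X 1 *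
    (stepGF 2 .rise .dec (Set.Ici 0) {0} 1 + stepGF 3 .rise .dec (Set.Ici 0) {0} 1) := by
  rw [setOf_bimodal, gf_union (finite_fiber_profile_grounded two_pos)
    (finite_fiber_profileLeft three_pos), gf_profile_grounded two_pos, gf_profileLeft three_pos,
    mul_add]
  rw [Set.disjoint_left]
  exact fun L h h' => not_indent_and_indentLeft h.1.2.1 h'.1.2.1

/-! ### Cuts of closed trails, and counting points by coordinates -/

section general

/-- Rotated to start at `x`, the trail leaves `A` on its way to `y` and comes back to `A`
afterwards. The two crossing edges are different because no edge of a trail is repeated. -/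
theorem exists_two_boundary_edges {V : Type*} {G : SimpleGraph V} {v : V} {c : G.Walk v v}
    (hc : c.IsTrail) {A : Set V} {x y : V} (hx : x ∈ c.toSubgraph.verts)
    (hy : y ∈ c.toSubgraph.verts) (hxA : x ∈ A) (hyA : y ∉ A) :
    ∃ p q p' q', c.toSubgraph.Adj p q ∧ p ∈ A ∧ q ∉ A ∧ c.toSubgraph.Adj p' q' ∧ p' ∈ A ∧
      q' ∉ A ∧ s(p, q) ≠ s(p', q') := by
  classical
  rw [SimpleGraph.Walk.mem_verts_toSubgraph] at hx hy
  have hy' : y ∈ (c.rotate x hx).support := by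
    rw [← SimpleGraph.Walk.mem_verts_toSubgraph, SimpleGraph.Walk.toSubgraph_rotate,
      SimpleGraph.Walk.mem_verts_toSubgraph]
    exact hy
  have hd := (hc.rotate hx).edges_nodup
  rw [← SimpleGraph.Walk.take_spec _ hy', SimpleGraph.Walk.edges_append] at hd
  obtain ⟨d, hd1, hd2, hd3⟩ :=
    ((c.rotate x hx).takeUntil y hy').exists_boundary_dart A hxA hyA
  obtain ⟨d', hd1', hd2', hd3'⟩ :=
    ((c.rotate x hx).dropUntil y hy').exists_boundary_dart Aᶜ hyA (fun h => h hxA)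
  have he : d.edge ∈ ((c.rotate x hx).takeUntil y hy').edges := List.mem_map_of_mem hd1
  have he' : d'.edge ∈ ((c.rotate x hx).dropUntil y hy').edges := List.mem_map_of_mem hd1'
  have hm : ∀ e : G.Dart, e.edge ∈ (c.rotate x hx).edges → c.toSubgraph.Adj e.fst e.snd := by
    intro e h
    rw [← SimpleGraph.Walk.toSubgraph_rotate c hx, ← SimpleGraph.Subgraph.mem_edgeSet,
      SimpleGraph.Walk.mem_edges_toSubgraph]
    exact h
  refine ⟨d.fst, d.snd, d'.snd, d'.fst, hm d ?_, hd2, hd3, (hm d' ?_).symm, ?_, hd2', ?_⟩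
  · exact SimpleGraph.Walk.edges_takeUntil_subset_edges _ hy' he
  · exact SimpleGraph.Walk.edges_dropUntil_subset_edges _ hy' he'
  · exact not_not.1 hd3'
  · intro h
    rw [Sym2.eq_swap (a := d'.snd)] at h
    exact List.disjoint_of_nodup_append hd he (by rw [show d.edge = d'.edge from h]; exact he')

theorem ncard_eq_sum_fst {A : Set (ℤ × ℤ)} (hA : A.Finite) (n : ℕ)
    (h : ∀ p ∈ A, 0 ≤ p.1 ∧ p.1 < n) :
    A.ncard = ∑ i ∈ Finset.range n, {y | ((i : ℤ), y) ∈ A}.ncard := by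
  classical
  rw [Set.ncard_eq_toFinset_card A hA, Finset.card_eq_sum_card_fiberwise
    (f := fun p => p.1.toNat) (t := Finset.range n)]
  · refine Finset.sum_congr rfl fun i _ => ?_
    rw [← Set.ncard_coe_finset, ← Set.ncard_image_of_injective {y | ((i : ℤ), y) ∈ A}
      (f := fun y => ((i : ℤ), y)) (fun y z h => congrArg Prod.snd h)]
    congr 1
    ext p
    simp only [Finset.coe_filter, Set.Finite.mem_toFinset, Set.mem_image]
    constructor
    · rintro ⟨h1, h2⟩
      have h3 := h p h1
      have h4 : (i : ℤ) = p.1 := by omega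
      exact ⟨p.2, by rw [h4]; exact h1, by rw [h4]⟩
    · rintro ⟨y, hy, rfl⟩
      exact ⟨hy, by simp⟩
  · intro p hp
    have := h p ((Set.Finite.mem_toFinset hA).1 hp)
    simp only [Finset.coe_range, Set.mem_Iio]
    omega

theorem ncard_eq_sum_snd {A : Set (ℤ × ℤ)} (hA : A.Finite) (n : ℕ)
    (h : ∀ p ∈ A, 0 ≤ p.2 ∧ p.2 < n) :
    A.ncard = ∑ k ∈ Finset.range n, {x | (x, (k : ℤ)) ∈ A}.ncard := by
  rw [← Set.ncard_image_of_injective A Prod.swap_injective,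
    ncard_eq_sum_fst (hA.image _) n]
  · refine Finset.sum_congr rfl fun k _ => ?_
    congr 1
    ext x
    constructor
    · rintro ⟨p, hp, h⟩
      rw [Prod.swap_eq_iff_eq_swap] at h
      rw [h] at hp
      exact hp
    · intro hx
      exact ⟨_, hx, rfl⟩
  · rintro _ ⟨p, hp, rfl⟩
    exact h p hp

end general

/-! ### Subgraphs of the square lattice -/

section lattice

variable {P : squareLattice.Subgraph}

theorem squareLattice_adj {p q : ℤ × ℤ} : squareLattice.Adj p q ↔
    q = (p.1 + 1, p.2) ∨ p = (q.1 + 1, q.2) ∨ q = (p.1, p.2 + 1) ∨ p = (q.1, q.2 + 1) := by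
  obtain ⟨a, b⟩ := p
  obtain ⟨c, d⟩ := q
  change ((b = d ∧ |a - c| = 1) ∨ (a = c ∧ |b - d| = 1)) ↔ _
  simp only [Prod.mk.injEq]
  rcases abs_cases (a - c) with h | h <;> rcases abs_cases (b - d) with h' | h' <;> omega

theorem subgraph_ext {P Q : squareLattice.Subgraph} (hP : ∀ p ∈ P.verts, ∃ q, P.Adj p q)
    (hQ : ∀ p ∈ Q.verts, ∃ q, Q.Adj p q)
    (hh : ∀ i y, P.Adj (i, y) (i + 1, y) ↔ Q.Adj (i, y) (i + 1, y))
    (hv : ∀ i y, P.Adj (i, y) (i, y + 1) ↔ Q.Adj (i, y) (i, y + 1)) : P = Q := by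
  have key : ∀ p q, squareLattice.Adj p q → (P.Adj p q ↔ Q.Adj p q) := by
    intro p q h
    rcases squareLattice_adj.1 h with rfl | rfl | rfl | rfl
    · exact hh p.1 p.2
    · rw [P.adj_comm, Q.adj_comm]; exact hh q.1 q.2
    · exact hv p.1 p.2
    · rw [P.adj_comm, Q.adj_comm]; exact hv q.1 q.2
  have hadj : ∀ p q, P.Adj p q ↔ Q.Adj p q := fun p q =>
    ⟨fun h => (key p q h.adj_sub).1 h, fun h => (key p q h.adj_sub).2 h⟩
  refine SimpleGraph.Subgraph.ext ?_ (funext₂ fun p q => propext (hadj p q))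
  ext p
  constructor
  · intro h
    obtain ⟨q, hq⟩ := hP p h
    exact ((hadj p q).1 hq).fst_mem
  · intro h
    obtain ⟨q, hq⟩ := hQ p h
    exact ((hadj p q).2 hq).fst_mem

theorem neighborSet_eq [DecidableRel P.Adj] (i y : ℤ) : P.neighborSet (i, y) =
    ↑(({(i - 1, y), (i + 1, y), (i, y - 1), (i, y + 1)} : Finset (ℤ × ℤ)).filter
      fun q => P.Adj (i, y) q) := by
  ext q
  rw [SimpleGraph.Subgraph.mem_neighborSet, Finset.mem_coe, Finset.mem_filter, iff_and_self]
  intro h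
  simp only [Finset.mem_insert, Finset.mem_singleton]
  obtain ⟨a, b⟩ := q
  rcases squareLattice_adj.1 h.adj_sub with h | h | h | h <;>
    simp only [Prod.mk.injEq] at h ⊢ <;> omega

theorem ncard_neighborSet [DecidableRel P.Adj] (i y : ℤ) : (P.neighborSet (i, y)).ncard =
    (if P.Adj (i - 1, y) (i, y) then 1 else 0) + (if P.Adj (i, y) (i + 1, y) then 1 else 0) +
    (if P.Adj (i, y - 1) (i, y) then 1 else 0) + (if P.Adj (i, y) (i, y + 1) then 1 else 0) := by
  rw [neighborSet_eq, Set.ncard_coe_finset, Finset.card_filter,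
    Finset.sum_insert, Finset.sum_insert, Finset.sum_insert, Finset.sum_singleton,
    add_assoc, add_assoc]
  · simp only [P.adj_comm (i - 1, y), P.adj_comm (i, y - 1)]
  · simp; omega
  · simp
  · simp; omega

theorem edgeSet_ncard (hP : P.verts.Finite) :
    P.edgeSet.ncard = horizontalPerimeter P + verticalPerimeter P := by
  have h1 : P.edgeSet = (fun p : ℤ × ℤ => s(p, (p.1 + 1, p.2))) '' {p | P.Adj p (p.1 + 1, p.2)} ∪
      (fun p : ℤ × ℤ => s(p, (p.1, p.2 + 1))) '' {p | P.Adj p (p.1, p.2 + 1)} := by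
    ext e
    induction e with
    | h p q =>
      rw [SimpleGraph.Subgraph.mem_edgeSet]
      constructor
      · intro h
        rcases squareLattice_adj.1 h.adj_sub with rfl | rfl | rfl | rfl
        · exact Or.inl ⟨p, h, rfl⟩
        · exact Or.inl ⟨q, h.symm, Sym2.eq_swap⟩
        · exact Or.inr ⟨p, h, rfl⟩
        · exact Or.inr ⟨q, h.symm, Sym2.eq_swap⟩
      · rintro (⟨r, hr, h⟩ | ⟨r, hr, h⟩)
        · rw [← SimpleGraph.Subgraph.mem_edgeSet, ← h]
          exact hr
        · rw [← SimpleGraph.Subgraph.mem_edgeSet, ← h]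
          exact hr
  have hf1 : {p | P.Adj p (p.1 + 1, p.2)}.Finite := hP.subset fun p h => h.fst_mem
  have hf2 : {p | P.Adj p (p.1, p.2 + 1)}.Finite := hP.subset fun p h => h.fst_mem
  rw [h1, Set.ncard_union_eq _ (hf1.image _) (hf2.image _), Set.ncard_image_of_injective,
    Set.ncard_image_of_injective, horizontalPerimeter, verticalPerimeter]
  · rintro ⟨a, b⟩ ⟨c, d⟩ h
    simp only [Sym2.eq_iff, Prod.mk.injEq] at h ⊢
    omega
  · rintro ⟨a, b⟩ ⟨c, d⟩ h
    simp only [Sym2.eq_iff, Prod.mk.injEq] at h ⊢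
    omega
  · rw [Set.disjoint_left]
    rintro _ ⟨⟨a, b⟩, -, rfl⟩ ⟨⟨c, d⟩, -, h⟩
    simp only [Sym2.eq_iff, Prod.mk.injEq] at h
    omega

end lattice

/-! ### The boundary of a union of columns -/

section boundary

/-- The unit square with lower left corner `(i, y)` belongs to the `i`-th of the `w` columns with
bottoms `b` and tops `t`. -/
def Cell (w : ℕ) (b t : ℤ → ℤ) (i y : ℤ) : Prop := 0 ≤ i ∧ i < w ∧ b i ≤ y ∧ y < t i

/-- The boundary of the union of the columns. -/
def boundary (w : ℕ) (b t : ℤ → ℤ) : squareLattice.Subgraph where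
  verts := {p | ∃ q, squareLattice.Adj p q ∧
    ((p.2 = q.2 ∧ ¬ (Cell w b t (min p.1 q.1) p.2 ↔ Cell w b t (min p.1 q.1) (p.2 - 1))) ∨
    (p.1 = q.1 ∧ ¬ (Cell w b t p.1 (min p.2 q.2) ↔ Cell w b t (p.1 - 1) (min p.2 q.2))))}
  -- An edge belongs to the boundary if exactly one of the two cells beside it belongs to the union;
  -- `min` picks its left or lower endpoint.
  Adj p q := squareLattice.Adj p q ∧
    ((p.2 = q.2 ∧ ¬ (Cell w b t (min p.1 q.1) p.2 ↔ Cell w b t (min p.1 q.1) (p.2 - 1))) ∨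
    (p.1 = q.1 ∧ ¬ (Cell w b t p.1 (min p.2 q.2) ↔ Cell w b t (p.1 - 1) (min p.2 q.2))))
  adj_sub h := h.1
  edge_vert h := ⟨_, h⟩
  symm := ⟨fun p q h => by
    refine ⟨h.1.symm, h.2.imp (fun h => ⟨h.1.symm, ?_⟩) (fun h => ⟨h.1.symm, ?_⟩)⟩
    · rw [min_comm, ← h.1]; exact h.2
    · rw [min_comm, ← h.1]; exact h.2⟩

variable {w : ℕ} {b t : ℤ → ℤ}

theorem boundary_adj_right {i y : ℤ} : (boundary w b t).Adj (i, y) (i + 1, y) ↔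
    ¬ (Cell w b t i y ↔ Cell w b t i (y - 1)) := by
  have h : min i (i + 1) = i := by omega
  simp only [boundary, squareLattice_adj, h]
  simp

theorem boundary_adj_up {i y : ℤ} : (boundary w b t).Adj (i, y) (i, y + 1) ↔
    ¬ (Cell w b t i y ↔ Cell w b t (i - 1) y) := by
  have h : min y (y + 1) = y := by omega
  simp only [boundary, squareLattice_adj, h]
  simp

theorem exists_adj_of_mem_boundary {p : ℤ × ℤ} (hp : p ∈ (boundary w b t).verts) :
    ∃ q, (boundary w b t).Adj p q := hp

theorem boundary_congr {b' t' : ℤ → ℤ} (hb : ∀ i : ℤ, 0 ≤ i → i < w → b i = b' i)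
    (ht : ∀ i : ℤ, 0 ≤ i → i < w → t i = t' i) : boundary w b t = boundary w b' t' := by
  have h : Cell w b t = Cell w b' t' := by
    ext i y
    constructor
    · rintro ⟨h1, h2, h3, h4⟩
      exact ⟨h1, h2, hb i h1 h2 ▸ h3, ht i h1 h2 ▸ h4⟩
    · rintro ⟨h1, h2, h3, h4⟩
      exact ⟨h1, h2, (hb i h1 h2).symm ▸ h3, (ht i h1 h2).symm ▸ h4⟩
  simp only [boundary, h]

/-- The columns are not empty, and consecutive columns share a cell. -/
structure Columns (w : ℕ) (b t : ℤ → ℤ) : Prop where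
  lt : ∀ i : ℤ, 0 ≤ i → i < w → b i < t i
  overlap : ∀ i : ℤ, 0 ≤ i → i + 1 < w → max (b i) (b (i + 1)) < min (t i) (t (i + 1))

theorem boundary_adj_right_iff (h : ∀ i : ℤ, 0 ≤ i → i < w → b i < t i) {i y : ℤ} :
    (boundary w b t).Adj (i, y) (i + 1, y) ↔ 0 ≤ i ∧ i < w ∧ (y = b i ∨ y = t i) := by
  rw [boundary_adj_right, Cell, Cell]
  have := h i
  by_cases h1 : 0 ≤ i ∧ i < w
  · have := h i h1.1 h1.2
    omega
  · omega

theorem boundary_adj_up_iff (h : Columns w b t) {i y : ℤ} :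
    (boundary w b t).Adj (i, y) (i, y + 1) ↔
      (0 < i ∧ i < w ∧ (min (b (i - 1)) (b i) ≤ y ∧ y < max (b (i - 1)) (b i) ∨
        min (t (i - 1)) (t i) ≤ y ∧ y < max (t (i - 1)) (t i))) ∨
      (i = 0 ∧ i < w ∧ b 0 ≤ y ∧ y < t 0) ∨
      (0 < i ∧ i = w ∧ b (i - 1) ≤ y ∧ y < t (i - 1)) := by
  rw [boundary_adj_up, Cell, Cell]
  rcases lt_trichotomy i 0 with hi | rfl | hi
  · omega
  · omega
  · rcases lt_trichotomy i w with hw | hw | hw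
    · have := h.overlap (i - 1) (by omega) (by omega)
      rw [sub_add_cancel] at this
      have h1 := h.lt i (by omega) (by omega)
      have h2 := h.lt (i - 1) (by omega) (by omega)
      omega
    · have h2 := h.lt (i - 1) (by omega) (by omega)
      omega
    · omega

theorem horizontal_ncard (h : ∀ i : ℤ, 0 ≤ i → i < w → b i < t i) {i : ℤ} (h0 : 0 ≤ i) (hw : i < w) :
    {y | (boundary w b t).Adj (i, y) (i + 1, y)}.ncard = 2 := by
  have : {y | (boundary w b t).Adj (i, y) (i + 1, y)} = {b i, t i} := by
    ext y
    simp only [Set.mem_ofPred_eq, boundary_adj_right_iff h, h0, hw, true_and, Set.mem_insert_iff,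
      Set.mem_singleton_iff]
  rw [this, Set.ncard_pair (h i h0 hw).ne]

theorem verts_boundary (h : Columns w b t) {p : ℤ × ℤ} (hp : p ∈ (boundary w b t).verts) :
    ∃ i : ℤ, 0 ≤ i ∧ i < w ∧ (p.1 = i ∨ p.1 = i + 1) ∧ b i ≤ p.2 ∧ p.2 ≤ t i := by
  obtain ⟨q, hq⟩ := hp
  have hq' : (boundary w b t).Adj p q := hq
  obtain ⟨x, y⟩ := p
  obtain ⟨x', y'⟩ := q
  have key : ∀ x y, (boundary w b t).Adj (x, y) (x, y + 1) →
      ∃ i : ℤ, 0 ≤ i ∧ i < w ∧ (x = i ∨ x = i + 1) ∧ b i ≤ y ∧ y + 1 ≤ t i := by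
    intro x y h
    rw [boundary_adj_up, Cell, Cell] at h
    by_cases hx : 0 ≤ x ∧ x < ↑w ∧ b x ≤ y ∧ y < t x
    · exact ⟨x, hx.1, hx.2.1, Or.inl rfl, by omega, by omega⟩
    · exact ⟨x - 1, by omega, by omega, Or.inr (by omega), by omega, by omega⟩
  rcases squareLattice_adj.1 hq.1 with h' | h' | h' | h' <;>
    simp only [Prod.mk.injEq] at h' <;> obtain ⟨rfl, rfl⟩ := h'
  · rw [boundary_adj_right_iff h.lt] at hq'
    have := h.lt x hq'.1 hq'.2.1
    exact ⟨x, hq'.1, hq'.2.1, Or.inl rfl, by simp only; omega, by simp only; omega⟩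
  · have h1 := hq'.symm
    rw [boundary_adj_right_iff h.lt] at h1
    have := h.lt x' h1.1 h1.2.1
    exact ⟨x', h1.1, h1.2.1, Or.inr rfl, by simp only; omega, by simp only; omega⟩
  · obtain ⟨i, h1, h2, h3, h4, h5⟩ := key _ _ hq'
    exact ⟨i, h1, h2, h3, by simp only; omega, by simp only; omega⟩
  · obtain ⟨i, h1, h2, h3, h4, h5⟩ := key _ _ hq'.symm
    exact ⟨i, h1, h2, h3, by simp only; omega, by simp only; omega⟩

theorem ncard_Ico (a c : ℤ) : (Set.Ico a c).ncard = (c - a).toNat := by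
  rw [← Finset.coe_Ico, Set.ncard_coe_finset, Int.card_Ico]

theorem vertical_ncard (h : Columns w b t) {i : ℤ} (h0 : 0 ≤ i) (hw : i + 1 < w) :
    ({y | (boundary w b t).Adj (i + 1, y) (i + 1, y + 1)}.ncard : ℤ) =
      |t (i + 1) - t i| + |b (i + 1) - b i| := by
  have h1 := h.overlap i h0 hw
  have : {y | (boundary w b t).Adj (i + 1, y) (i + 1, y + 1)} =
      Set.Ico (min (b i) (b (i + 1))) (max (b i) (b (i + 1))) ∪
      Set.Ico (min (t i) (t (i + 1))) (max (t i) (t (i + 1))) := by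
    ext y
    simp only [Set.mem_ofPred_eq, boundary_adj_up_iff h, add_sub_cancel_right, Set.mem_union,
      Set.mem_Ico]
    omega
  rw [this, Set.ncard_union_eq _ (Set.finite_Ico _ _) (Set.finite_Ico _ _), ncard_Ico, ncard_Ico]
  · rcases abs_cases (t (i + 1) - t i) with h | h <;>
    rcases abs_cases (b (i + 1) - b i) with h' | h' <;> omega
  · rw [Set.disjoint_left]
    intro y h2 h3
    rw [Set.mem_Ico] at h2 h3
    omega

theorem vertical_ncard_zero (h : Columns w b t) (hw : 0 < w) :
    ({y | (boundary w b t).Adj (0, y) (0, y + 1)}.ncard : ℤ) = t 0 - b 0 := by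
  have h1 := h.lt 0 le_rfl (by omega)
  have : {y | (boundary w b t).Adj (0, y) (0, y + 1)} = Set.Ico (b 0) (t 0) := by
    ext y
    simp only [Set.mem_ofPred_eq, boundary_adj_up_iff h, Set.mem_Ico]
    constructor
    · omega
    · exact fun h3 => Or.inr (Or.inl ⟨trivial, by omega, h3.1, h3.2⟩)
  rw [this, ncard_Ico]
  omega

theorem vertical_ncard_last (h : Columns w b t) (hw : 0 < w) :
    ({y | (boundary w b t).Adj (w, y) (w, y + 1)}.ncard : ℤ) = t (w - 1) - b (w - 1) := by
  have h1 := h.lt (w - 1) (by omega) (by omega)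
  have : {y | (boundary w b t).Adj (w, y) (w, y + 1)} = Set.Ico (b (w - 1)) (t (w - 1)) := by
    ext y
    simp only [Set.mem_ofPred_eq, boundary_adj_up_iff h, Set.mem_Ico]
    constructor
    · omega
    · exact fun h3 => Or.inr (Or.inr ⟨by omega, trivial, h3.1, h3.2⟩)
  rw [this, ncard_Ico]
  omega

theorem finite_verts_boundary (h : Columns w b t) : (boundary w b t).verts.Finite := by
  have : (⋃ i ∈ Finset.Ico (0 : ℤ) w, Set.Icc i (i + 1) ×ˢ Set.Icc (b i) (t i)).Finite :=
    Set.Finite.biUnion (Finset.finite_toSet _) fun i _ =>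
      (Set.finite_Icc _ _).prod (Set.finite_Icc _ _)
  refine this.subset fun p hp => ?_
  obtain ⟨i, h1, h2, h3, h4, h5⟩ := verts_boundary h hp
  simp only [Set.mem_iUnion]
  exact ⟨i, Finset.mem_Ico.2 ⟨h1, h2⟩, ⟨by omega, by omega⟩, h4, h5⟩

theorem horizontalPerimeter_boundary (h : Columns w b t) :
    horizontalPerimeter (boundary w b t) = 2 * w := by
  rw [horizontalPerimeter, ncard_eq_sum_fst ((finite_verts_boundary h).subset
    fun p hp => hp.fst_mem) w, Finset.sum_congr rfl fun i hi => ?_, Finset.sum_const,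
    Finset.card_range, smul_eq_mul, mul_comm]
  · rw [Finset.mem_range] at hi
    exact horizontal_ncard h.lt (by omega) (by omega)
  · intro p hp
    have := (boundary_adj_right_iff h.lt).1 hp
    omega

theorem verticalPerimeter_boundary (h : Columns w b t) (hw : 0 < w) :
    (verticalPerimeter (boundary w b t) : ℤ) =
      ∑ i ∈ Finset.range (w - 1), (|t (i + 1) - t i| + |b (i + 1) - b i|) +
      (t 0 - b 0) + (t (w - 1) - b (w - 1)) := by
  obtain ⟨w, rfl⟩ := Nat.exists_eq_add_of_le' hw
  rw [verticalPerimeter, ncard_eq_sum_fst ((finite_verts_boundary h).subset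
    fun p hp => hp.fst_mem) (w + 1 + 1), Finset.sum_range_succ, Finset.sum_range_succ', Nat.cast_add,
    Nat.cast_add, Nat.cast_sum, Nat.add_sub_cancel]
  · have h1 := vertical_ncard_zero h hw
    have h2 := vertical_ncard_last h hw
    simp only [Set.mem_ofPred_eq] at h1 h2 ⊢
    rw [h2, Nat.cast_zero, h1, Finset.sum_congr rfl fun i hi => ?_]
    rw [Finset.mem_range] at hi
    have := vertical_ncard h (i := i) (by omega) (by push_cast; omega)
    exact_mod_cast this
  · intro p hp
    have := (boundary_adj_up_iff h).1 hp
    push_cast at this ⊢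
    omega

end boundary

/-! ### The boundary is a cycle -/

section boundaryCycle

variable {w : ℕ} {b t : ℤ → ℤ}

/-- The degree is the number of changes between inside and outside among the four cells around the
vertex. It is even, and the value four would require a checkerboard pattern, which the overlap of
consecutive columns excludes. -/
theorem ncard_neighborSet_boundary (h : Columns w b t) {p : ℤ × ℤ}
    (hp : ((boundary w b t).neighborSet p).Nonempty) :
    ((boundary w b t).neighborSet p).ncard = 2 := by
  classical
  obtain ⟨i, y⟩ := p
  have h1 := boundary_adj_right (w := w) (b := b) (t := t) (i := i - 1) (y := y)
  have h2 := boundary_adj_right (w := w) (b := b) (t := t) (i := i) (y := y)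
  have h3 := boundary_adj_up (w := w) (b := b) (t := t) (i := i) (y := y - 1)
  have h4 := boundary_adj_up (w := w) (b := b) (t := t) (i := i) (y := y)
  rw [sub_add_cancel] at h1 h3
  have hc : ¬ (Cell w b t (i - 1) (y - 1) ∧ Cell w b t i y ∧ ¬ Cell w b t i (y - 1) ∧
      ¬ Cell w b t (i - 1) y) := by
    rintro ⟨⟨a1, a2, a3, a4⟩, ⟨b1, b2, b3, b4⟩, c, d⟩
    have := h.overlap (i - 1) a1 (by omega)
    rw [sub_add_cancel] at this
    simp only [Cell] at c d
    omega
  have hc' : ¬ (Cell w b t i (y - 1) ∧ Cell w b t (i - 1) y ∧ ¬ Cell w b t (i - 1) (y - 1) ∧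
      ¬ Cell w b t i y) := by
    rintro ⟨⟨a1, a2, a3, a4⟩, ⟨b1, b2, b3, b4⟩, c, d⟩
    have := h.overlap (i - 1) b1 (by omega)
    rw [sub_add_cancel] at this
    simp only [Cell] at c d
    omega
  have h0 : ((boundary w b t).neighborSet (i, y)).ncard ≠ 0 :=
    (Set.ncard_pos ((Finset.finite_toSet _).subset (neighborSet_eq i y).subset)).2 hp |>.ne'
  rw [ncard_neighborSet] at h0 ⊢
  simp only [h1, h2, h3, h4] at h0 ⊢
  by_cases c1 : Cell w b t (i - 1) (y - 1) <;> by_cases c2 : Cell w b t i y <;>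
    by_cases c3 : Cell w b t i (y - 1) <;> by_cases c4 : Cell w b t (i - 1) y <;>
    simp [c1, c2, c3, c4] at h0 hc hc' ⊢

theorem reachable_vertical {G : SimpleGraph (ℤ × ℤ)} {x y₁ y₂ : ℤ} (h : y₁ ≤ y₂)
    (hadj : ∀ y, y₁ ≤ y → y < y₂ → G.Adj (x, y) (x, y + 1)) : G.Reachable (x, y₁) (x, y₂) := by
  induction y₂, h using Int.leInduction with
  | base => rfl
  | succ y h ih =>
    exact (ih fun z h1 h2 => hadj z h1 (by omega)).trans (hadj y h (by omega)).reachable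

theorem reachable_of_vertical {G : SimpleGraph (ℤ × ℤ)} {x y₁ y₂ y y' : ℤ}
    (hadj : ∀ y, y₁ ≤ y → y < y₂ → G.Adj (x, y) (x, y + 1)) (h1 : y₁ ≤ y) (h2 : y ≤ y₂)
    (h1' : y₁ ≤ y') (h2' : y' ≤ y₂) : G.Reachable (x, y) (x, y') := by
  rcases le_total y y' with h | h
  · exact reachable_vertical h fun z h3 h4 => hadj z (by omega) (by omega)
  · exact (reachable_vertical h fun z h3 h4 => hadj z (by omega) (by omega)).symm

/-- The boundary without its lowest edge on the left. -/
def cutBoundary (w : ℕ) (b t : ℤ → ℤ) : SimpleGraph (ℤ × ℤ) :=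
  (boundary w b t).spanningCoe \ SimpleGraph.fromEdgeSet {s((0, b 0), (0, b 0 + 1))}

theorem cutBoundary_adj {p q : ℤ × ℤ} : (cutBoundary w b t).Adj p q ↔
    (boundary w b t).Adj p q ∧ s(p, q) ≠ s((0, b 0), (0, b 0 + 1)) := by
  rw [cutBoundary, SimpleGraph.sdiff_adj, SimpleGraph.fromEdgeSet_adj,
    SimpleGraph.Subgraph.spanningCoe_adj, Set.mem_singleton_iff]
  constructor
  · rintro ⟨h1, h2⟩
    exact ⟨h1, fun h => h2 ⟨h, h1.ne⟩⟩
  · rintro ⟨h1, h2⟩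
    exact ⟨h1, fun h => h2 h.1⟩

theorem cutBoundary_adj_right (h : Columns w b t) {i y : ℤ} (h0 : 0 ≤ i) (hw : i < w)
    (hy : y = b i ∨ y = t i) : (cutBoundary w b t).Adj (i, y) (i + 1, y) := by
  rw [cutBoundary_adj, boundary_adj_right_iff h.lt]
  refine ⟨⟨h0, hw, hy⟩, fun h => ?_⟩
  simp only [Sym2.eq_iff, Prod.mk.injEq] at h
  omega

theorem cutBoundary_adj_up {i y : ℤ} (h : (boundary w b t).Adj (i, y) (i, y + 1))
    (h0 : i ≠ 0 ∨ y ≠ b 0) : (cutBoundary w b t).Adj (i, y) (i, y + 1) := by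
  rw [cutBoundary_adj]
  refine ⟨h, fun h => ?_⟩
  simp only [Sym2.eq_iff, Prod.mk.injEq] at h
  omega

variable (h : Columns w b t)

include h

/-- This and the next lemmas walk round the boundary from the lower end of the deleted edge: along
the bottoms, up the right side, back along the tops, and down the left side. -/
theorem reachable_bottom (i : ℤ) (h0 : 0 ≤ i) (hw : i < w) :
    (cutBoundary w b t).Reachable (0, b 0) (i, b i) := by
  induction i, h0 using Int.leInduction with
  | base => rfl
  | succ i h0 ih =>
    refine ((ih (by omega)).trans
      (cutBoundary_adj_right h h0 (by omega) (Or.inl rfl)).reachable).trans ?_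
    refine reachable_of_vertical (y₁ := min (b i) (b (i + 1))) (y₂ := max (b i) (b (i + 1)))
      (fun y h1 h2 => cutBoundary_adj_up ?_ (by omega)) (by omega) (by omega) (by omega) (by omega)
    rw [boundary_adj_up_iff h, add_sub_cancel_right]
    omega

theorem reachable_last (hw : 0 < w) {y : ℤ} (h1 : b (w - 1) ≤ y) (h2 : y ≤ t (w - 1)) :
    (cutBoundary w b t).Reachable (0, b 0) (w, y) := by
  refine (reachable_bottom h (w - 1) (by omega) (by omega)).trans ?_
  have h3 := cutBoundary_adj_right h (i := w - 1) (by omega) (by omega) (Or.inl rfl)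
  rw [sub_add_cancel] at h3
  refine h3.reachable.trans (reachable_of_vertical (y₁ := b (w - 1)) (y₂ := t (w - 1))
    (fun y h1 h2 => cutBoundary_adj_up ?_ (by omega)) (by omega) (by omega) h1 h2)
  rw [boundary_adj_up_iff h]
  omega

theorem reachable_top (hw : 0 < w) (i : ℤ) (h0 : 0 ≤ i) (hi : i < w) :
    (cutBoundary w b t).Reachable (0, b 0) (i + 1, t i) := by
  obtain ⟨k, hk⟩ : ∃ k : ℕ, i = w - 1 - k := ⟨(w - 1 - i).toNat, by omega⟩
  induction k generalizing i with
  | zero =>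
    obtain rfl : i = w - 1 := by omega
    rw [sub_add_cancel]
    exact reachable_last h hw (h.lt _ h0 hi).le le_rfl
  | succ k ih =>
    refine (ih (i + 1) (by omega) (by omega) (by omega)).trans ?_
    refine (cutBoundary_adj_right h (i := i + 1) (by omega) (by omega)
      (Or.inr rfl)).symm.reachable.trans ?_
    refine reachable_of_vertical (y₁ := min (t i) (t (i + 1))) (y₂ := max (t i) (t (i + 1)))
      (fun y h1 h2 => cutBoundary_adj_up ?_ (by omega)) (by omega) (by omega) (by omega) (by omega)
    rw [boundary_adj_up_iff h, add_sub_cancel_right]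
    omega

theorem reachable_top' (hw : 0 < w) (i : ℤ) (h0 : 0 ≤ i) (hi : i < w) :
    (cutBoundary w b t).Reachable (0, b 0) (i, t i) :=
  (reachable_top h hw i h0 hi).trans
    (cutBoundary_adj_right h h0 hi (Or.inr rfl)).symm.reachable

theorem reachable_first (hw : 0 < w) {y : ℤ} (h1 : b 0 < y) (h2 : y ≤ t 0) :
    (cutBoundary w b t).Reachable (0, b 0) (0, y) := by
  refine (reachable_top' h hw 0 le_rfl (by omega)).trans
    (reachable_of_vertical (y₁ := b 0 + 1) (y₂ := t 0)
    (fun y h1 h2 => cutBoundary_adj_up ?_ (by omega)) (by omega) (by omega) (by omega) (by omega))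
  rw [boundary_adj_up_iff h]
  omega

theorem reachable_boundary (hw : 0 < w) {p : ℤ × ℤ} (hp : p ∈ (boundary w b t).verts) :
    (cutBoundary w b t).Reachable (0, b 0) p := by
  have key : ∀ x y, (boundary w b t).Adj (x, y) (x, y + 1) →
      (cutBoundary w b t).Reachable (0, b 0) (x, y) ∧
      (cutBoundary w b t).Reachable (0, b 0) (x, y + 1) := by
    intro x y hxy
    rcases (boundary_adj_up_iff h).1 hxy with ⟨h1, h2, h3⟩ | ⟨rfl, h2, h3⟩ | ⟨h1, rfl, h3⟩
    · have ha : ∀ y, (boundary w b t).Adj (x, y) (x, y + 1) →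
          (cutBoundary w b t).Adj (x, y) (x, y + 1) := fun y h => cutBoundary_adj_up h (by omega)
      rcases h3 with h3 | h3
      · have hb := reachable_bottom h x h1.le h2
        have hs : ∀ y, min (b (x - 1)) (b x) ≤ y → y < max (b (x - 1)) (b x) →
            (cutBoundary w b t).Adj (x, y) (x, y + 1) := fun y h4 h5 =>
          ha y ((boundary_adj_up_iff h).2 (Or.inl ⟨h1, h2, Or.inl ⟨h4, h5⟩⟩))
        exact ⟨hb.trans (reachable_of_vertical hs (by omega) (by omega) (by omega) (by omega)),
          hb.trans (reachable_of_vertical hs (by omega) (by omega) (by omega) (by omega))⟩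
      · have hb := reachable_top' h hw x h1.le h2
        have hs : ∀ y, min (t (x - 1)) (t x) ≤ y → y < max (t (x - 1)) (t x) →
            (cutBoundary w b t).Adj (x, y) (x, y + 1) := fun y h4 h5 =>
          ha y ((boundary_adj_up_iff h).2 (Or.inl ⟨h1, h2, Or.inr ⟨h4, h5⟩⟩))
        exact ⟨hb.trans (reachable_of_vertical hs (by omega) (by omega) (by omega) (by omega)),
          hb.trans (reachable_of_vertical hs (by omega) (by omega) (by omega) (by omega))⟩
    · refine ⟨?_, reachable_first h hw (by omega) (by omega)⟩
      rcases h3.1.eq_or_lt with h4 | h4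
      · rw [← h4]
      · exact reachable_first h hw (by omega) (by omega)
    · exact ⟨reachable_last h hw (by omega) (by omega), reachable_last h hw (by omega) (by omega)⟩
  have key' : ∀ x y, (boundary w b t).Adj (x, y) (x + 1, y) →
      (cutBoundary w b t).Reachable (0, b 0) (x, y) ∧
      (cutBoundary w b t).Reachable (0, b 0) (x + 1, y) := by
    intro x y hxy
    obtain ⟨h1, h2, h3⟩ := (boundary_adj_right_iff h.lt).1 hxy
    have h4 := (cutBoundary_adj_right h h1 h2 h3).reachable
    have h5 : (cutBoundary w b t).Reachable (0, b 0) (x, y) := by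
      rcases h3 with rfl | rfl
      · exact reachable_bottom h x h1 h2
      · exact reachable_top' h hw x h1 h2
    exact ⟨h5, h5.trans h4⟩
  obtain ⟨q, hq⟩ := exists_adj_of_mem_boundary hp
  rcases squareLattice_adj.1 hq.adj_sub with rfl | rfl | rfl | rfl
  · exact (key' _ _ hq).1
  · exact (key' _ _ hq.symm).2
  · exact (key _ _ hq).1
  · exact (key _ _ hq.symm).2

/-- The deleted edge is not a bridge, so it lies on a cycle. At each of its vertices this cycle uses
both edges of the boundary, hence it is closed under adjacency, and by connectedness it is the whole
boundary. -/
theorem isSelfAvoidingPolygon_boundary (hw : 0 < w) :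
    IsSelfAvoidingPolygon (boundary w b t) := by
  have h0 := h.lt 0 le_rfl (by omega)
  have he : (boundary w b t).spanningCoe.Adj (0, b 0) (0, b 0 + 1) := by
    rw [SimpleGraph.Subgraph.spanningCoe_adj, boundary_adj_up_iff h]
    omega
  obtain ⟨u, p, hp, hpe⟩ := SimpleGraph.adj_and_reachable_delete_edges_iff_exists_cycle.1
    ⟨he, reachable_first h hw (by omega) (by omega)⟩
  refine ⟨u, p.mapLe (boundary w b t).spanningCoe_le, hp.mapLe _, ?_⟩
  have hadj : ∀ v ∈ p.support, ∀ v', (boundary w b t).Adj v v' → p.toSubgraph.Adj v v' := by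
    intro v hv v' hvv
    have h1 := hp.ncard_neighborSet_toSubgraph_eq_two hv
    have h2 := ncard_neighborSet_boundary h (p := v) ⟨v', hvv⟩
    have h3 : p.toSubgraph.neighborSet v ⊆ (boundary w b t).neighborSet v := fun q hq => hq.adj_sub
    have h4 := Set.eq_of_subset_of_ncard_le h3 (by omega)
      (Set.finite_of_ncard_ne_zero (by omega))
    have h5 : v' ∈ p.toSubgraph.neighborSet v := by rw [h4]; exact hvv
    exact h5
  have hsupp : ∀ v v', (cutBoundary w b t).Reachable v v' → v ∈ p.support → v' ∈ p.support := by
    rintro v v' ⟨q⟩ hv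
    induction q with
    | nil => exact hv
    | cons hq q ih =>
      refine ih ?_
      have := (hadj _ hv _ (cutBoundary_adj.1 hq).1).snd_mem
      rwa [SimpleGraph.Walk.mem_verts_toSubgraph] at this
  have hfst : (0, b 0) ∈ p.support := p.fst_mem_support_of_mem_edges hpe
  have hmem : ∀ v, v ∈ p.support ↔ v ∈ (boundary w b t).verts := by
    intro v
    constructor
    · intro hv
      have h1 := hp.ncard_neighborSet_toSubgraph_eq_two hv
      obtain ⟨q, hq⟩ := Set.nonempty_of_ncard_ne_zero (s := p.toSubgraph.neighborSet v) (by omega)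
      have h2 : (boundary w b t).Adj v q := hq.adj_sub
      exact h2.fst_mem
    · exact fun hv => hsupp _ _ (reachable_boundary h hw hv) hfst
  refine SimpleGraph.Subgraph.ext ?_ (funext₂ fun v v' => propext ?_)
  · ext v
    rw [SimpleGraph.Walk.mem_verts_toSubgraph, SimpleGraph.Walk.support_mapLe_eq_support, hmem]
  · rw [SimpleGraph.Walk.adj_toSubgraph_mapLe]
    exact ⟨fun hv => hv.adj_sub, fun hv => hadj v ((hmem v).2 hv.fst_mem) v' hv⟩

end boundaryCycle

/-! ### Total variation of the boundary heights -/

section variation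

open Finset

variable {f : ℕ → ℤ} {i j n m : ℕ}

theorem sum_Ico_abs_of_incr (hij : i ≤ j) (h : Incr f i j) :
    ∑ k ∈ Ico i j, |f (k + 1) - f k| = f j - f i := by
  rw [← sum_Ico_sub f hij]
  refine sum_congr rfl fun k hk => abs_of_nonneg ?_
  rw [mem_Ico] at hk
  have := h k hk.1 hk.2
  omega

theorem sum_Ico_abs_of_decr (hij : i ≤ j) (h : Decr f i j) :
    ∑ k ∈ Ico i j, |f (k + 1) - f k| = f i - f j := by
  rw [← neg_sub, ← sum_Ico_sub f hij, ← sum_neg_distrib]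
  refine sum_congr rfl fun k hk => abs_of_nonpos ?_
  rw [mem_Ico] at hk
  have := h k hk.1 hk.2
  omega

theorem sub_le_sum_Ico_abs (hij : i ≤ j) : f j - f i ≤ ∑ k ∈ Ico i j, |f (k + 1) - f k| := by
  rw [← sum_Ico_sub f hij]
  exact sum_le_sum fun k _ => le_abs_self _

theorem sub_le_sum_Ico_abs' (hij : i ≤ j) : f i - f j ≤ ∑ k ∈ Ico i j, |f (k + 1) - f k| := by
  rw [← neg_sub, ← sum_Ico_sub f hij, ← sum_neg_distrib]
  exact sum_le_sum fun k _ => neg_le_abs _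

theorem incr_of_sum_Ico_abs (hij : i ≤ j) (h : ∑ k ∈ Ico i j, |f (k + 1) - f k| = f j - f i) :
    Incr f i j := by
  rw [← sum_Ico_sub f hij, eq_comm, sum_eq_sum_iff_of_le fun k _ => le_abs_self _] at h
  intro k h1 h2
  have := h k (mem_Ico.2 ⟨h1, h2⟩)
  have := abs_nonneg (f (k + 1) - f k)
  omega

theorem decr_of_sum_Ico_abs (hij : i ≤ j) (h : ∑ k ∈ Ico i j, |f (k + 1) - f k| = f i - f j) :
    Decr f i j := by
  rw [← neg_sub, ← sum_Ico_sub f hij, ← sum_neg_distrib, eq_comm,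
    sum_eq_sum_iff_of_le fun k _ => neg_le_abs _] at h
  intro k h1 h2
  have := h k (mem_Ico.2 ⟨h1, h2⟩)
  have := abs_nonneg (f (k + 1) - f k)
  omega

theorem sum_range_abs_of_twoModes {a c p : ℕ} (hac : a ≤ c) (hcp : c ≤ p) (hpn : p ≤ n)
    (h1 : Incr f 0 a) (h2 : Decr f a c) (h3 : Incr f c p) (h4 : Decr f p n)
    (h5 : min (f a) (f p) = f c + 2) :
    ∑ k ∈ range n, |f (k + 1) - f k| = 2 * max (f a) (f p) + 4 - f 0 - f n := by
  rw [range_eq_Ico, ← sum_Ico_consecutive _ (Nat.zero_le p) hpn,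
    ← sum_Ico_consecutive _ (Nat.zero_le c) hcp, ← sum_Ico_consecutive _ (Nat.zero_le a) hac,
    sum_Ico_abs_of_incr (Nat.zero_le a) h1, sum_Ico_abs_of_decr hac h2, sum_Ico_abs_of_incr hcp h3,
    sum_Ico_abs_of_decr hpn h4]
  omega

theorem sum_range_abs_of_valley (hm : m ≤ n) (h1 : Decr f 0 m) (h2 : Incr f m n) :
    ∑ k ∈ range n, |f (k + 1) - f k| = f 0 + f n - 2 * f m := by
  rw [range_eq_Ico, ← sum_Ico_consecutive _ (Nat.zero_le m) hm,
    sum_Ico_abs_of_decr (Nat.zero_le m) h1, sum_Ico_abs_of_incr hm h2]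
  omega

/-- The right-hand side is the least variation of a sequence that passes through `f m`, so the
sequence is monotone on both sides of `m`. -/
theorem valley_of_sum_range_abs (hm : m ≤ n)
    (h : ∑ k ∈ range n, |f (k + 1) - f k| = f 0 + f n - 2 * f m) : Valley f n := by
  rw [range_eq_Ico, ← sum_Ico_consecutive _ (Nat.zero_le m) hm] at h
  have h1 := sub_le_sum_Ico_abs (f := f) hm
  have h2 := sub_le_sum_Ico_abs' (f := f) (Nat.zero_le m)
  exact ⟨m, hm, decr_of_sum_Ico_abs (Nat.zero_le m) (by omega), incr_of_sum_Ico_abs hm (by omega)⟩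

theorem le_max_of_two_modes {a c p k : ℕ}
    (h1 : Incr f 0 a) (h2 : Decr f a c) (h3 : Incr f c p) (h4 : Decr f p n) (hk : k ≤ n) :
    f k ≤ max (f a) (f p) := by
  rcases le_total k a with h | h
  · exact le_max_of_le_left (h1.le (Nat.zero_le _) h le_rfl)
  rcases le_total k c with h' | h'
  · exact le_max_of_le_left (h2.le le_rfl h h')
  rcases le_total k p with h | h
  · exact le_max_of_le_right (h3.le h' h le_rfl)
  · exact le_max_of_le_right (h4.le le_rfl h hk)

end variation

section intervals

variable {f : ℤ → ℤ} {i j : ℕ}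

theorem incr_iff_monotoneOn :
    Incr (fun k => f k) i j ↔ MonotoneOn f (Set.Icc (i : ℤ) j) := by
  constructor
  · intro hf x hx y hy hxy
    rw [Set.mem_Icc] at hx hy
    have := hf.le (k := x.toNat) (l := y.toNat) (by omega) (by omega) (by omega)
    rwa [Int.toNat_of_nonneg (by omega), Int.toNat_of_nonneg (by omega)] at this
  · intro hf k h1 h2
    exact hf ⟨by omega, by omega⟩ ⟨by push_cast; omega, by push_cast; omega⟩ (by push_cast; omega)

theorem decr_iff_antitoneOn :
    Decr (fun k => f k) i j ↔ AntitoneOn f (Set.Icc (i : ℤ) j) := by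
  constructor
  · intro hf x hx y hy hxy
    rw [Set.mem_Icc] at hx hy
    have := hf.le (k := x.toNat) (l := y.toNat) (by omega) (by omega) (by omega)
    rwa [Int.toNat_of_nonneg (by omega), Int.toNat_of_nonneg (by omega)] at this
  · intro hf k h1 h2
    exact hf ⟨by omega, by omega⟩ ⟨by push_cast; omega, by push_cast; omega⟩ (by push_cast; omega)

end intervals

/-! ### Cuts, parity and vertex degrees of self-avoiding polygons -/

section polygon

variable {P : squareLattice.Subgraph}

namespace IsSelfAvoidingPolygon

theorem finite_verts (hP : IsSelfAvoidingPolygon P) : P.verts.Finite := by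
  obtain ⟨v, c, -, rfl⟩ := hP
  exact c.support.finite_toSet.subset fun p hp => (c.mem_verts_toSubgraph).1 hp

theorem ncard_neighborSet (hP : IsSelfAvoidingPolygon P) {p : ℤ × ℤ} (hp : p ∈ P.verts) :
    (P.neighborSet p).ncard = 2 := by
  obtain ⟨v, c, hc, rfl⟩ := hP
  exact hc.ncard_neighborSet_toSubgraph_eq_two ((c.mem_verts_toSubgraph).1 hp)

theorem exists_adj (hP : IsSelfAvoidingPolygon P) {p : ℤ × ℤ} (hp : p ∈ P.verts) :
    ∃ q, P.Adj p q :=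
  Set.nonempty_of_ncard_ne_zero (s := P.neighborSet p) (by rw [hP.ncard_neighborSet hp]; decide)

theorem exists_cut (hP : IsSelfAvoidingPolygon P) {A : Set (ℤ × ℤ)} {x y : ℤ × ℤ}
    (hx : x ∈ P.verts) (hy : y ∈ P.verts) (hxA : x ∈ A) (hyA : y ∉ A) :
    ∃ p q p' q', P.Adj p q ∧ p ∈ A ∧ q ∉ A ∧ P.Adj p' q' ∧ p' ∈ A ∧ q' ∉ A ∧
      s(p, q) ≠ s(p', q') := by
  obtain ⟨v, c, hc, rfl⟩ := hP
  exact exists_two_boundary_edges hc.isTrail hx hy hxA hyA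

theorem two_le_ncard_column (hP : IsSelfAvoidingPolygon P) {p q : ℤ × ℤ} {i : ℤ}
    (hp : p ∈ P.verts) (hq : q ∈ P.verts) (hpi : p.1 ≤ i) (hqi : i < q.1) :
    2 ≤ {y | P.Adj (i, y) (i + 1, y)}.ncard := by
  obtain ⟨⟨x₁, y₁⟩, ⟨x₂, y₂⟩, ⟨x₃, y₃⟩, ⟨x₄, y₄⟩, h1, h2, h3, h4, h5, h6, h7⟩ :=
    hP.exists_cut (A := {p | p.1 ≤ i}) hp hq hpi (by simpa using hqi)
  have hf : {y | P.Adj (i, y) (i + 1, y)}.Finite :=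
    Set.Finite.of_finite_image (f := fun y => ((i : ℤ), y))
      (hP.finite_verts.subset (by rintro _ ⟨y, hy, rfl⟩; exact hy.fst_mem))
      (fun y _ z _ h => congrArg Prod.snd h)
  have a1 := squareLattice_adj.1 h1.adj_sub
  have a2 := squareLattice_adj.1 h4.adj_sub
  simp only [Set.mem_ofPred_eq, Prod.mk.injEq] at h2 h3 h5 h6 a1 a2
  obtain ⟨rfl, rfl, rfl⟩ : x₁ = i ∧ x₂ = i + 1 ∧ y₂ = y₁ := by omega
  obtain ⟨rfl, rfl, rfl⟩ : x₃ = x₁ ∧ x₄ = x₁ + 1 ∧ y₄ = y₃ := by omega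
  exact (Set.one_lt_ncard hf).2 ⟨y₂, h1, y₄, h4, fun h => h7 (by rw [h])⟩

/-- The cut is formed by the points above level `k` with abscissa in `S`. By `hS` no horizontal edge
leaves it, so it can only be left downwards through row `k`. Taking for `S` the two sides of the
indent gives two edges on either side. -/
theorem two_le_ncard_row (hP : IsSelfAvoidingPolygon P) {p q : ℤ × ℤ} {k : ℤ} (S : Set ℤ)
    (hS : ∀ x y, k < y → P.Adj (x, y) (x + 1, y) → (x ∈ S ↔ x + 1 ∈ S))
    (hp : p ∈ P.verts) (hq : q ∈ P.verts) (hpS : p.1 ∈ S) (hpi : k < p.2) (hqi : q.2 ≤ k) :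
    2 ≤ {x | x ∈ S ∧ P.Adj (x, k) (x, k + 1)}.ncard := by
  obtain ⟨⟨x₁, y₁⟩, ⟨x₂, y₂⟩, ⟨x₃, y₃⟩, ⟨x₄, y₄⟩, h1, h2, h3, h4, h5, h6, h7⟩ :=
    hP.exists_cut (A := {p | k < p.2 ∧ p.1 ∈ S}) hp hq ⟨hpi, hpS⟩ (fun h => by
      have := h.1
      omega)
  have hf : {x | x ∈ S ∧ P.Adj (x, k) (x, k + 1)}.Finite :=
    Set.Finite.of_finite_image (f := fun x => (x, (k : ℤ)))
      (hP.finite_verts.subset (by rintro _ ⟨y, hy, rfl⟩; exact hy.2.fst_mem))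
      (fun y _ z _ h => congrArg Prod.fst h)
  have key : ∀ x₁ y₁ x₂ y₂, P.Adj (x₁, y₁) (x₂, y₂) → k < y₁ → x₁ ∈ S → ¬ (k < y₂ ∧ x₂ ∈ S) →
      x₂ = x₁ ∧ y₁ = k + 1 ∧ y₂ = k := by
    intro x₁ y₁ x₂ y₂ h h1 h2 h3
    have ha := squareLattice_adj.1 h.adj_sub
    simp only [Prod.mk.injEq] at ha
    rcases ha with ⟨rfl, rfl⟩ | ⟨rfl, rfl⟩ | ⟨rfl, rfl⟩ | ⟨rfl, rfl⟩
    · exact absurd ⟨h1, (hS _ _ h1 h).1 h2⟩ h3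
    · exact absurd ⟨h1, (hS _ _ h1 h.symm).2 h2⟩ h3
    · exact absurd ⟨by omega, h2⟩ h3
    · have : ¬ k < y₂ := fun h => h3 ⟨h, h2⟩
      omega
  obtain ⟨rfl, rfl, rfl⟩ := key _ _ _ _ h1 h2.1 h2.2 h3
  obtain ⟨rfl, rfl, rfl⟩ := key _ _ _ _ h4 h5.1 h5.2 h6
  exact (Set.one_lt_ncard hf).2
    ⟨x₂, ⟨h2.2, h1.symm⟩, x₄, ⟨h5.2, h4.symm⟩, fun h => h7 (by rw [h])⟩

/-- Every point has degree zero or two, so the number of edges among its four directions is even. -/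
theorem parity (hP : IsSelfAvoidingPolygon P) (i y : ℤ) :
    (P.Adj (i, y) (i, y + 1) ↔ P.Adj (i, y - 1) (i, y)) ↔
      (P.Adj (i - 1, y) (i, y) ↔ P.Adj (i, y) (i + 1, y)) := by
  classical
  have h := _root_.ncard_neighborSet (P := P) i y
  have h0 : (P.neighborSet (i, y)).ncard = 2 ∨ (P.neighborSet (i, y)).ncard = 0 := by
    by_cases hp : (i, y) ∈ P.verts
    · exact Or.inl (hP.ncard_neighborSet hp)
    · right
      rw [Set.ncard_eq_zero ((Finset.finite_toSet _).subset (neighborSet_eq i y).subset)]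
      exact Set.eq_empty_of_forall_notMem fun q hq => hp (P.edge_vert hq)
  rw [h] at h0
  clear h
  by_cases c1 : P.Adj (i, y) (i, y + 1) <;> by_cases c2 : P.Adj (i, y - 1) (i, y) <;>
    by_cases c3 : P.Adj (i - 1, y) (i, y) <;> by_cases c4 : P.Adj (i, y) (i + 1, y) <;>
    simp [c1, c2, c3, c4] at h0 ⊢

/-- The horizontal edges determine the vertical ones: there are none below the polygon, and going
up, `parity` yields the edge above a point from the other three. -/
theorem eq_boundary (hP : IsSelfAvoidingPolygon P) {w : ℕ} {b t : ℤ → ℤ}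
    (h0 : ∀ p ∈ P.verts, 0 ≤ p.2) (hbt : ∀ i : ℤ, 0 ≤ i → i < w → b i < t i)
    (h : ∀ i y, P.Adj (i, y) (i + 1, y) ↔ 0 ≤ i ∧ i < w ∧ (y = b i ∨ y = t i)) :
    P = boundary w b t := by
  have hh : ∀ i y, P.Adj (i, y) (i + 1, y) ↔ (boundary w b t).Adj (i, y) (i + 1, y) :=
    fun i y => by rw [h, boundary_adj_right_iff hbt]
  have hb : ∀ i : ℤ, 0 ≤ i → i < w → 0 ≤ b i := fun i h1 h2 =>
    h0 _ ((h i (b i)).2 ⟨h1, h2, Or.inl rfl⟩).fst_mem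
  refine subgraph_ext (fun p hp => hP.exists_adj hp) (fun p hp => exists_adj_of_mem_boundary hp)
    hh fun i y => ?_
  have hneg : ∀ y < 0, (P.Adj (i, y) (i, y + 1) ↔ (boundary w b t).Adj (i, y) (i, y + 1)) := by
    intro y hy
    rw [iff_false_left (fun h => absurd (h0 _ h.fst_mem) (by simpa using hy)), boundary_adj_up,
      not_not, Cell, Cell]
    have h1 := hb i
    have h2 := hb (i - 1)
    omega
  rcases lt_or_ge y 0 with hy | hy
  · exact hneg y hy
  have h1 : -1 ≤ y := by omega
  clear hy
  -- The induction starts at `-1`, a row without edges on either side.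
  induction y, h1 using Int.leInduction with
  | base => exact hneg _ (by norm_num)
  | succ y hy ih =>
    have h1 := hP.parity i (y + 1)
    have h2 := hh (i - 1) (y + 1)
    rw [sub_add_cancel] at h2
    have ih' : P.Adj (i, y) (i, y + 1) ↔ (boundary w b t).Adj (i, y) (i, y + 1) := ih
    rw [add_sub_cancel_right, h2, hh, ih'] at h1
    have h3 := boundary_adj_right (w := w) (b := b) (t := t) (i := i - 1) (y := y + 1)
    have h4 := boundary_adj_right (w := w) (b := b) (t := t) (i := i) (y := y + 1)
    rw [sub_add_cancel] at h3
    rw [h3, h4, boundary_adj_up, add_sub_cancel_right] at h1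
    rw [boundary_adj_up]
    clear h2 h3 h4 ih ih' hneg
    by_cases c1 : Cell w b t i (y + 1) <;> by_cases c2 : Cell w b t (i - 1) (y + 1) <;>
      by_cases c3 : Cell w b t i y <;> by_cases c4 : Cell w b t (i - 1) y <;>
      simpa [c1, c2, c3, c4] using h1

end IsSelfAvoidingPolygon

/-- Otherwise the next column lies above the current one. If they touch, the common corner has
degree four; if there is a gap, only one edge connects the part on the left with the rest, while a
cycle crosses every cut twice. -/
theorem bot_succ_lt_top {w : ℕ} {b t : ℤ → ℤ} (hP : IsSelfAvoidingPolygon (boundary w b t))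
    (hbt : ∀ i : ℤ, 0 ≤ i → i < w → b i < t i) {i : ℤ} (h0 : 0 ≤ i) (hi : i + 1 < w) :
    b (i + 1) < t i := by
  classical
  have h1 := hbt i h0 (by omega)
  have h2 := hbt (i + 1) (by omega) hi
  have ha := fun i y => boundary_adj_right_iff hbt (i := i) (y := y)
  by_contra! hlt
  have m1 := (ha i (t i)).2 ⟨h0, by omega, Or.inr rfl⟩
  rcases hlt.eq_or_lt with heq | hlt
  · have m2 := (ha (i + 1) (t i)).2 ⟨by omega, by omega, Or.inl heq⟩
    have m3 := boundary_adj_up (w := w) (b := b) (t := t) (i := i + 1) (y := t i)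
    have m4 := boundary_adj_up (w := w) (b := b) (t := t) (i := i + 1) (y := t i - 1)
    rw [sub_add_cancel] at m4
    have h3 := hP.ncard_neighborSet m2.fst_mem
    rw [ncard_neighborSet, add_sub_cancel_right, if_pos m1, if_pos m2, if_pos, if_pos] at h3
    · omega
    · rw [m3, add_sub_cancel_right, Cell, Cell]
      omega
    · rw [m4, add_sub_cancel_right, Cell, Cell]
      omega
  · have m2 := (ha (i + 1) (t (i + 1))).2 ⟨by omega, by omega, Or.inr rfl⟩
    obtain ⟨⟨x₁, y₁⟩, ⟨x₂, y₂⟩, ⟨x₃, y₃⟩, ⟨x₄, y₄⟩, k1, k2, k3, k4, k5, k6, k7⟩ :=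
      hP.exists_cut (A := {p | p.1 ≤ i ∨ p.1 = i + 1 ∧ p.2 ≤ t i}) m1.fst_mem m2.fst_mem
      (Or.inl le_rfl) (by simp only [Set.mem_ofPred_eq]; omega)
    have key : ∀ x₁ y₁ x₂ y₂, (boundary w b t).Adj (x₁, y₁) (x₂, y₂) →
        (x₁ ≤ i ∨ x₁ = i + 1 ∧ y₁ ≤ t i) → ¬ (x₂ ≤ i ∨ x₂ = i + 1 ∧ y₂ ≤ t i) →
        x₁ = i + 1 ∧ x₂ = i + 1 ∧ y₁ = t i ∧ y₂ = t i + 1 := by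
      intro x₁ y₁ x₂ y₂ h h1 h2
      rcases squareLattice_adj.1 h.adj_sub with h' | h' | h' | h' <;>
        simp only [Prod.mk.injEq] at h' <;> obtain ⟨rfl, rfl⟩ := h'
      · have := (ha _ _).1 h
        have h3 : x₁ = i ∨ x₁ = i + 1 := by omega
        rcases h3 with rfl | rfl <;> omega
      · omega
      · omega
      · omega
    simp only [Set.mem_ofPred_eq] at k2 k3 k5 k6
    obtain ⟨rfl, rfl, rfl, rfl⟩ := key _ _ _ _ k1 k2 k3
    obtain ⟨rfl, rfl, rfl, rfl⟩ := key _ _ _ _ k4 k5 k6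
    exact k7 rfl

theorem bot_lt_top_succ {w : ℕ} {b t : ℤ → ℤ} (hP : IsSelfAvoidingPolygon (boundary w b t))
    (hbt : ∀ i : ℤ, 0 ≤ i → i < w → b i < t i) {i : ℤ} (h0 : 0 ≤ i) (hi : i + 1 < w) :
    b i < t (i + 1) := by
  classical
  have h1 := hbt i h0 (by omega)
  have h2 := hbt (i + 1) (by omega) hi
  have ha := fun i y => boundary_adj_right_iff hbt (i := i) (y := y)
  by_contra! hlt
  have m1 := (ha (i + 1) (t (i + 1))).2 ⟨by omega, by omega, Or.inr rfl⟩
  rcases hlt.eq_or_lt with heq | hlt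
  · have m2 := (ha i (t (i + 1))).2 ⟨by omega, by omega, Or.inl heq⟩
    have m3 := boundary_adj_up (w := w) (b := b) (t := t) (i := i + 1) (y := t (i + 1))
    have m4 := boundary_adj_up (w := w) (b := b) (t := t) (i := i + 1) (y := t (i + 1) - 1)
    rw [sub_add_cancel] at m4
    have h3 := hP.ncard_neighborSet m1.fst_mem
    rw [ncard_neighborSet, add_sub_cancel_right, if_pos m1, if_pos m2, if_pos, if_pos] at h3
    · omega
    · rw [m3, add_sub_cancel_right, Cell, Cell]
      omega
    · rw [m4, add_sub_cancel_right, Cell, Cell]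
      omega
  · have m2 := (ha i (t i)).2 ⟨by omega, by omega, Or.inr rfl⟩
    obtain ⟨⟨x₁, y₁⟩, ⟨x₂, y₂⟩, ⟨x₃, y₃⟩, ⟨x₄, y₄⟩, k1, k2, k3, k4, k5, k6, k7⟩ :=
      hP.exists_cut (A := {p | i + 1 < p.1 ∨ p.1 = i + 1 ∧ p.2 ≤ t (i + 1)}) m1.fst_mem m2.fst_mem
      (Or.inr ⟨rfl, le_rfl⟩) (by simp only [Set.mem_ofPred_eq]; omega)
    have key : ∀ x₁ y₁ x₂ y₂, (boundary w b t).Adj (x₁, y₁) (x₂, y₂) →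
        (i + 1 < x₁ ∨ x₁ = i + 1 ∧ y₁ ≤ t (i + 1)) →
        ¬ (i + 1 < x₂ ∨ x₂ = i + 1 ∧ y₂ ≤ t (i + 1)) →
        x₁ = i + 1 ∧ x₂ = i + 1 ∧ y₁ = t (i + 1) ∧ y₂ = t (i + 1) + 1 := by
      intro x₁ y₁ x₂ y₂ h h1 h2
      rcases squareLattice_adj.1 h.adj_sub with h' | h' | h' | h' <;>
        simp only [Prod.mk.injEq] at h' <;> obtain ⟨rfl, rfl⟩ := h'
      · omega
      · have := (ha _ _).1 h.symm
        have h3 : x₂ = i ∨ x₂ = i + 1 := by omega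
        rcases h3 with rfl | rfl <;> omega
      · omega
      · omega
    simp only [Set.mem_ofPred_eq] at k2 k3 k5 k6
    obtain ⟨rfl, rfl, h5, rfl⟩ := key _ _ _ _ k1 k2 k3
    obtain ⟨rfl, h6, h7, rfl⟩ := key _ _ _ _ k4 k5 k6
    rw [h6, h5, h7] at k7
    exact k7 rfl

theorem columns_of_isSelfAvoidingPolygon {w : ℕ} {b t : ℤ → ℤ}
    (hP : IsSelfAvoidingPolygon (boundary w b t))
    (hbt : ∀ i : ℤ, 0 ≤ i → i < w → b i < t i) : Columns w b t where
  lt := hbt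
  overlap i h0 hi := by
    have h1 := hbt i h0 (by omega)
    have h2 := hbt (i + 1) (by omega) hi
    have h3 := bot_succ_lt_top hP hbt h0 hi
    have h4 := bot_lt_top_succ hP hbt h0 hi
    omega

end polygon

/-! ### Minimal perimeter forces convex columns -/

section columns

open Finset

variable {P : squareLattice.Subgraph} {w h : ℕ}

theorem horizontalPerimeter_eq_sum (hP : IsSelfAvoidingPolygon P)
    (hR : HasBoundingRectangle P w h) : horizontalPerimeter P =
      ∑ i ∈ range w, {y | P.Adj ((i : ℤ), y) ((i : ℤ) + 1, y)}.ncard := by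
  rw [horizontalPerimeter, ncard_eq_sum_fst (hP.finite_verts.subset fun p hp => hp.fst_mem) w]
  · rfl
  · intro p hp
    have h1 := hR.1 _ hp.fst_mem
    have h2 := hR.1 _ hp.snd_mem
    simp only at h2
    omega

theorem verticalPerimeter_eq_sum (hP : IsSelfAvoidingPolygon P)
    (hR : HasBoundingRectangle P w h) : verticalPerimeter P =
      ∑ k ∈ range h, {x | P.Adj (x, (k : ℤ)) (x, (k : ℤ) + 1)}.ncard := by
  rw [verticalPerimeter, ncard_eq_sum_snd (hP.finite_verts.subset fun p hp => hp.fst_mem) h]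
  · rfl
  · intro p hp
    have h1 := hR.1 _ hp.fst_mem
    have h2 := hR.1 _ hp.snd_mem
    simp only at h2
    omega

theorem two_le_column (hP : IsSelfAvoidingPolygon P) (hR : HasBoundingRectangle P w h) {i : ℕ}
    (hi : i < w) : 2 ≤ {y | P.Adj ((i : ℤ), y) ((i : ℤ) + 1, y)}.ncard := by
  obtain ⟨-, ⟨p, hp, hp0⟩, ⟨q, hq, hqw⟩, -⟩ := hR
  exact hP.two_le_ncard_column hp hq (by omega) (by omega)

theorem finite_row (hP : IsSelfAvoidingPolygon P) (k : ℤ) :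
    {x | P.Adj (x, k) (x, k + 1)}.Finite :=
  Set.Finite.of_finite_image (f := fun x => (x, (k : ℤ)))
    (hP.finite_verts.subset (by rintro _ ⟨y, hy, rfl⟩; exact hy.fst_mem))
    (fun y _ z _ h => congrArg Prod.fst h)

theorem two_le_row (hP : IsSelfAvoidingPolygon P) (hR : HasBoundingRectangle P w h) {k : ℕ}
    (hk : k < h) : 2 ≤ {x | P.Adj (x, (k : ℤ)) (x, (k : ℤ) + 1)}.ncard := by
  obtain ⟨-, -, -, ⟨p, hp, hp0⟩, ⟨q, hq, hqw⟩⟩ := hR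
  refine (hP.two_le_ncard_row (k := k) Set.univ (by simp) hq hp trivial (by omega) (by omega)).trans
    (Set.ncard_le_ncard (fun x hx => hx.2) (finite_row hP k))

/-- Above its top height the column `c` contains no horizontal edge. So above level `k` the parts to
its left and to its right are separated, and each of them needs two edges of row `k`. -/
theorem four_le_row (hP : IsSelfAvoidingPolygon P) {k c t : ℤ} (ht : IsTopHeight P c t)
    (hk : t ≤ k) {p q : ℤ × ℤ} (hp : p ∈ P.verts) (hpc : p.1 ≤ c) (hpk : k < p.2)
    (hq : q ∈ P.verts) (hqc : c < q.1) (hqk : k < q.2) :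
    4 ≤ {x | P.Adj (x, k) (x, k + 1)}.ncard := by
  have hc : ∀ x y, k < y → P.Adj (x, y) (x + 1, y) → x ≠ c := by
    rintro x y h1 h2 rfl
    exact ht.2 y (by omega) h2
  have h1 := hP.two_le_ncard_row (k := k) {x | x ≤ c} (fun x y h1 h2 => by
    have := hc x y h1 h2
    simp only [Set.mem_ofPred_eq]
    omega) hp ht.1.fst_mem hpc hpk hk
  have h2 := hP.two_le_ncard_row (k := k) {x | c < x} (fun x y h1 h2 => by
    have := hc x y h1 h2
    simp only [Set.mem_ofPred_eq]
    omega) hq ht.1.fst_mem hqc hqk hk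
  have hf := finite_row hP k
  refine (Nat.add_le_add h1 h2).trans ?_
  rw [← Set.ncard_union_eq _ (hf.subset fun x hx => hx.2) (hf.subset fun x hx => hx.2)]
  · exact Set.ncard_le_ncard (Set.union_subset (fun x hx => hx.2) fun x hx => hx.2) hf
  · rw [Set.disjoint_left]
    rintro x ⟨hx, -⟩ ⟨hx', -⟩
    simp only [Set.mem_ofPred_eq] at hx hx'
    omega

/-- A polygon with an indent of depth two whose perimeter is minimal has convex columns. -/
theorem ncard_column_and_verticalPerimeter (hP : IsSelfAvoidingPolygon P) (hR : HasBoundingRectangle P w h)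
    (hE : P.edgeSet.ncard = 2 * (w + h) + 2 * 2) {t : ℤ → ℤ}
    (ht : ∀ i : ℤ, 0 ≤ i → i < w → IsTopHeight P i (t i)) {a c b : ℤ} (h0 : 0 ≤ a) (hac : a < c)
    (hcb : c < b) (hb : b < w) (hm : min (t a) (t b) = t c + 2) :
    (∀ i < w, {y | P.Adj ((i : ℤ), y) ((i : ℤ) + 1, y)}.ncard = 2) ∧
      verticalPerimeter P = 2 * h + 4 := by
  have hc := ht c (by omega) (by omega)
  have ha := (ht a (by omega) (by omega)).1.fst_mem
  have hb' := (ht b (by omega) (by omega)).1.fst_mem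
  have hc1 := hR.1 _ hc.1.fst_mem
  have ha1 := hR.1 _ ha
  have hb1 := hR.1 _ hb'
  simp only at hc1 ha1 hb1
  have h1 : 2 * w ≤ horizontalPerimeter P := by
    rw [horizontalPerimeter_eq_sum hP hR, mul_comm, ← smul_eq_mul]
    nth_rw 1 [← card_range w]
    exact card_nsmul_le_sum _ _ _ fun i hi => two_le_column hP hR (mem_range.1 hi)
  have h2 : 2 * h + 4 ≤ verticalPerimeter P := by
    rw [verticalPerimeter_eq_sum hP hR]
    -- The rows `t c` and `t c + 1` of the indent have two vertical edges more than the others.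
    calc 2 * h + 4 = ∑ k ∈ range h, (2 + (if k = (t c).toNat then 2 else 0) +
          (if k = (t c + 1).toNat then 2 else 0)) := by
          rw [sum_add_distrib, sum_add_distrib, sum_ite_eq', sum_ite_eq', if_pos, if_pos, sum_const,
            card_range, smul_eq_mul, mul_comm]
          · rw [mem_range]
            omega
          · rw [mem_range]
            omega
      _ ≤ _ := sum_le_sum fun k hk => ?_
    rw [mem_range] at hk
    have h3 := two_le_row hP hR hk
    by_cases hk' : t c ≤ k ∧ k ≤ t c + 1
    · have h4 := four_le_row hP hc hk'.1 ha hac.le (by simp only; omega) hb' hcb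
        (by simp only; omega)
      split_ifs <;> omega
    · split_ifs <;> omega
  -- The number of edges is the sum of the two lower bounds, so both are attained.
  have h3 := edgeSet_ncard hP.finite_verts
  refine ⟨fun i hi => ?_, by omega⟩
  have h4 : ∑ i ∈ range w, 2 = ∑ i ∈ range w, {y | P.Adj ((i : ℤ), y) ((i : ℤ) + 1, y)}.ncard := by
    rw [← horizontalPerimeter_eq_sum hP hR, sum_const, card_range, smul_eq_mul]
    omega
  exact ((sum_eq_sum_iff_of_le fun i hi => two_le_column hP hR (mem_range.1 hi)).1 h4 i
    (mem_range.2 hi)).symm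

theorem exists_columns (hP : IsSelfAvoidingPolygon P) (hR : HasBoundingRectangle P w h)
    (hcol : ∀ i < w, {y | P.Adj ((i : ℤ), y) ((i : ℤ) + 1, y)}.ncard = 2) :
    ∃ b t : ℤ → ℤ, Columns w b t ∧ P = boundary w b t := by
  have key : ∀ i : ℤ, ∃ b t : ℤ, 0 ≤ i → i < w →
      b < t ∧ ∀ y, P.Adj (i, y) (i + 1, y) ↔ y = b ∨ y = t := by
    intro i
    by_cases hi : 0 ≤ i ∧ i < w
    · have h1 := hcol i.toNat (by omega)
      rw [Int.toNat_of_nonneg hi.1] at h1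
      obtain ⟨x, y, hxy, hs⟩ := Set.ncard_eq_two.1 h1
      have h2 : ∀ z, P.Adj (i, z) (i + 1, z) ↔ z = x ∨ z = y := fun z =>
        Set.ext_iff.1 hs z
      rcases lt_or_gt_of_ne hxy with h3 | h3
      · exact ⟨x, y, fun _ _ => ⟨h3, h2⟩⟩
      · exact ⟨y, x, fun _ _ => ⟨h3, fun z => by rw [h2, or_comm]⟩⟩
    · exact ⟨0, 0, fun h1 h2 => absurd ⟨h1, h2⟩ hi⟩
  choose b t hbt using key
  have h1 : P = boundary w b t := by
    refine hP.eq_boundary (fun p hp => (hR.1 p hp).2.2.1) (fun i h1 h2 => (hbt i h1 h2).1)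
      fun i y => ⟨fun h3 => ?_, fun h3 => ((hbt i h3.1 h3.2.1).2 y).2 h3.2.2⟩
    have h4 := hR.1 _ h3.fst_mem
    have h5 := hR.1 _ h3.snd_mem
    simp only at h4 h5
    exact ⟨by omega, by omega, ((hbt i (by omega) (by omega)).2 y).1 h3⟩
  subst h1
  exact ⟨b, t, columns_of_isSelfAvoidingPolygon hP fun i h1 h2 => (hbt i h1 h2).1, rfl⟩

end columns

/-! ### The polygon of a list of columns -/

section polygon

/-- The polygon with the given columns. -/
def polygon (L : List (ℤ × ℤ)) : squareLattice.Subgraph :=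
  boundary L.length (fun i => bot L i.toNat) (fun i => top L i.toNat)

variable {L : List (ℤ × ℤ)}

theorem columns_iff : Columns L.length (fun i => bot L i.toNat) (fun i => top L i.toNat) ↔
    Overlapping L ∧ ∀ i < L.length, bot L i < top L i := by
  constructor
  · intro h
    refine ⟨fun i hi => ?_, fun i hi => ?_⟩
    · have := h.overlap i (by omega) (by omega)
      simpa using this
    · simpa using h.lt i (by omega) (by omega)
  · rintro ⟨h1, h2⟩
    refine ⟨fun i h3 h4 => h2 _ (by omega), fun i h3 h4 => ?_⟩
    have := h1 i.toNat (by omega)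
    have h5 : (i + 1).toNat = i.toNat + 1 := by omega
    simpa only [h5] using this

theorem Overlapping.columns (h : Overlapping L) (hL : 2 ≤ L.length) :
    Columns L.length (fun i => bot L i.toNat) (fun i => top L i.toNat) := by
  refine columns_iff.2 ⟨h, fun i hi => ?_⟩
  rcases Nat.eq_zero_or_pos i with rfl | h0
  · have := h 0 hL
    omega
  · have := h (i - 1) (by omega)
    rw [Nat.sub_add_cancel h0] at this
    omega

theorem two_mul_perim_polygon
    (h : Columns L.length (fun i => bot L i.toNat) (fun i => top L i.toNat)) (hL : 0 < L.length) :
    verticalPerimeter (polygon L) = 2 * perim L := by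
  have h1 := verticalPerimeter_boundary h hL
  have h2 := two_mul_perim (L := L) ((columns_iff.1 h).2 0 hL).le
  have h3 : ((L.length : ℤ) - 1).toNat = L.length - 1 := by omega
  have h4 : ∀ i : ℕ, ((i : ℤ) + 1).toNat = i + 1 := fun i => by omega
  simp only [h3, h4, Int.toNat_natCast, Int.toNat_zero] at h1
  rw [polygon]
  exact_mod_cast h1.trans h2.symm

theorem boundary_eq_polygon {w : ℕ} {b t : ℤ → ℤ} :
    boundary w b t = polygon ((List.range w).map fun i : ℕ => (b i, t i)) := by
  rw [polygon, List.length_map, List.length_range]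
  refine boundary_congr (fun i h0 hi => ?_) fun i h0 hi => ?_
  · have : i.toNat < w := by omega
    simp [bot, this, h0]
  · have : i.toNat < w := by omega
    simp [top, this, h0]

end polygon

/-! ### The bijection between bimodal lists and bimodal polygons -/

section bimodal

variable {P : squareLattice.Subgraph} {L : List (ℤ × ℤ)}

theorem exists_eq_polygon {w : ℕ} {b t : ℤ → ℤ} (h : Columns w b t) : ∃ L : List (ℤ × ℤ),
    L.length = w ∧ Columns L.length (fun i => bot L i.toNat) (fun i => top L i.toNat) ∧
      boundary w b t = polygon L := by
  set L := (List.range w).map fun i : ℕ => (b i, t i) with hL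
  have hlen : L.length = w := by rw [hL, List.length_map, List.length_range]
  have hb : ∀ i < w, bot L i = b i := fun i hi => by simp [bot, hL, hi]
  have ht : ∀ i < w, top L i = t i := fun i hi => by simp [top, hL, hi]
  refine ⟨L, hlen, ?_, boundary_eq_polygon⟩
  rw [columns_iff, hlen]
  refine ⟨fun i hi => ?_, fun i hi => ?_⟩
  · rw [hlen] at hi
    rw [hb i (by omega), hb (i + 1) hi, ht i (by omega), ht (i + 1) hi]
    exact h.overlap i (by omega) (by omega)
  · rw [hb i hi, ht i hi]
    exact h.lt i (by omega) (by omega)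

theorem isTopHeight_polygon_iff
    (h : Columns L.length (fun i => bot L i.toNat) (fun i => top L i.toNat)) {i t : ℤ}
    (h0 : 0 ≤ i) (hi : i < L.length) : IsTopHeight (polygon L) i t ↔ t = top L i.toNat := by
  have hlt := h.lt i h0 hi
  rw [IsTopHeight, polygon, boundary_adj_right_iff h.lt]
  simp only [boundary_adj_right_iff h.lt, h0, hi, true_and] at hlt ⊢
  constructor
  · rintro ⟨h1, h2⟩
    by_contra hne
    exact h2 (top L i.toNat) (by omega) (Or.inr rfl)
  · rintro rfl
    exact ⟨Or.inr rfl, fun t' h1 => by omega⟩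

theorem verts_polygon_bounds
    (h : Columns L.length (fun i => bot L i.toNat) (fun i => top L i.toNat)) {p : ℤ × ℤ}
    (hp : p ∈ (polygon L).verts) : ∃ i < L.length, (p.1 = i ∨ p.1 = i + 1) ∧
      bot L i ≤ p.2 ∧ p.2 ≤ top L i := by
  obtain ⟨i, h0, hi, h1, h2, h3⟩ := verts_boundary h hp
  exact ⟨i.toNat, by omega, by omega, h2, h3⟩

theorem mem_verts_bot
    (h : Columns L.length (fun i => bot L i.toNat) (fun i => top L i.toNat)) {i : ℕ}
    (hi : i < L.length) : ((i : ℤ), bot L i) ∈ (polygon L).verts ∧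
      ((i : ℤ) + 1, bot L i) ∈ (polygon L).verts := by
  have : (polygon L).Adj (i, bot L i) (i + 1, bot L i) :=
    (boundary_adj_right_iff h.lt).2 ⟨by omega, by omega, Or.inl rfl⟩
  exact ⟨this.fst_mem, this.snd_mem⟩

theorem mem_verts_top
    (h : Columns L.length (fun i => bot L i.toNat) (fun i => top L i.toNat)) {i : ℕ}
    (hi : i < L.length) : ((i : ℤ), top L i) ∈ (polygon L).verts := by
  have : (polygon L).Adj (i, top L i) (i + 1, top L i) :=
    (boundary_adj_right_iff h.lt).2 ⟨by omega, by omega, Or.inr rfl⟩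
  exact this.fst_mem

theorem IsBimodalConvexPolygon.exists_polygon (h : IsBimodalConvexPolygon 2 P) :
    ∃ L, Bimodal L ∧ polygon L = P := by
  obtain ⟨hP, w, h, hR, hE, t, ht, a, c, p, h0, hac, hcp, hp, m1, m2, m3, m4, hm⟩ := h
  obtain ⟨hcol, hv⟩ :=
    ncard_column_and_verticalPerimeter hP hR hE ht h0 hac hcp hp hm
  obtain ⟨L, rfl, hL, rfl⟩ : ∃ L : List (ℤ × ℤ), L.length = w ∧
      Columns L.length (fun i => bot L i.toNat) (fun i => top L i.toNat) ∧ P = polygon L := by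
    obtain ⟨b', t', hC, rfl⟩ := exists_columns hP hR hcol
    exact exists_eq_polygon hC
  refine ⟨L, ?_, rfl⟩
  have hO := (columns_iff.1 hL).1
  have htop : ∀ i : ℕ, i ≤ L.length - 1 → top L i = t i + 0 := fun i hi => by
    have := (isTopHeight_polygon_iff hL (i := i) (by omega) (by omega)).1 (ht i (by omega) (by omega))
    simpa using this.symm
  lift a to ℕ using h0
  lift c to ℕ using by omega
  lift p to ℕ using by omega
  have e : ((L.length : ℤ) - 1) = ((L.length - 1 : ℕ) : ℤ) := by omega
  rw [e] at m4
  have n1 := ((incr_iff_monotoneOn (i := 0)).2 m1).congr htop (by omega)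
  have n2 := (decr_iff_antitoneOn.2 m2).congr htop (by omega)
  have n3 := (incr_iff_monotoneOn.2 m3).congr htop (by omega)
  have n4 := (decr_iff_antitoneOn.2 m4).congr htop (by omega)
  have hm' : min (top L a) (top L p) = top L c + 2 := by
    rw [htop a (by omega), htop p (by omega), htop c (by omega)]
    push_cast at hm
    omega
  -- The upper edge of the bounding rectangle is touched at one of the two modes.
  have hmax : max (top L a) (top L p) = h := by
    refine le_antisymm (max_le ?_ ?_) ?_
    · exact (hR.1 _ (mem_verts_top hL (by omega : a < L.length))).2.2.2
    · exact (hR.1 _ (mem_verts_top hL (by omega : p < L.length))).2.2.2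
    · obtain ⟨q, hq, hqh⟩ := hR.2.2.2.2
      obtain ⟨i, hi, -, -, hq2⟩ := verts_polygon_bounds hL hq
      have := le_max_of_two_modes (k := i) n1 n2 n3 n4 (by omega)
      omega
  have hnonneg : ∀ i < L.length, 0 ≤ bot L i := fun i hi =>
    (hR.1 _ (mem_verts_bot hL hi).1).2.2.1
  obtain ⟨m, hm1, hm2⟩ : ∃ i < L.length, bot L i = 0 := by
    obtain ⟨q, hq, hq0⟩ := hR.2.2.2.1
    obtain ⟨i, hi, -, hq2, -⟩ := verts_polygon_bounds hL hq
    have := hnonneg i hi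
    exact ⟨i, hi, by omega⟩
  refine ⟨hO, ⟨a, c, p, by omega, by omega, by omega, n1, n2, n3, n4, hm'⟩, ?_, ⟨m, hm1, hm2⟩, hnonneg⟩
  -- The tops have variation `2 * h + 4` minus their two end values. As there are `2 * h + 4`
  -- vertical edges, the variation of the bottoms equals the sum of their two end values, the
  -- minimum for a sequence that reaches `0`.
  have hs := sum_range_abs_of_twoModes (by omega) (by omega) (by omega) n1 n2 n3 n4 hm'
  have hv1 := two_mul_perim_polygon hL (by omega)
  have hv2 := two_mul_perim (L := L) ((columns_iff.1 hL).2 0 (by omega)).le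
  rw [Finset.sum_add_distrib] at hv2
  exact valley_of_sum_range_abs (m := m) (by omega) (by omega)

theorem Bimodal.two_le_length (h : Bimodal L) : 2 ≤ L.length := by
  obtain ⟨-, ⟨a, c, p, h1, h2, h3, -, -, -, -, h4⟩, -, -⟩ := h
  by_contra! hL
  obtain rfl : a = 0 := by omega
  obtain rfl : c = 0 := by omega
  obtain rfl : p = 0 := by omega
  omega

theorem Bimodal.columns (h : Bimodal L) :
    Columns L.length (fun i => bot L i.toNat) (fun i => top L i.toNat) :=
  h.1.columns h.two_le_length

theorem Bimodal.horizontalPerimeter_polygon (h : Bimodal L) :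
    horizontalPerimeter (polygon L) = 2 * L.length :=
  horizontalPerimeter_boundary h.columns

theorem Bimodal.verticalPerimeter_polygon (h : Bimodal L) :
    verticalPerimeter (polygon L) = 2 * perim L :=
  two_mul_perim_polygon h.columns (by have := h.two_le_length; omega)

theorem Bimodal.isBimodalConvexPolygon (h : Bimodal L) :
    IsBimodalConvexPolygon 2 (polygon L) := by
  have hC := h.columns
  have h2 := h.two_le_length
  have hH := h.horizontalPerimeter_polygon
  have hV := h.verticalPerimeter_polygon
  obtain ⟨-, ⟨a, c, p, hac, hcp, hp, n1, n2, n3, n4, hm⟩, ⟨m, hm1, v1, v2⟩, ⟨m', hm2, hm3⟩, h0⟩ := h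
  have hbm : bot L m = 0 := by
    have h4 := h0 m (by omega)
    rcases le_total m' m with h3 | h3
    · have := v1.le (Nat.zero_le _) h3 le_rfl
      omega
    · have := v2.le le_rfl h3 (by omega)
      omega
  have hmax : ∀ i < L.length, top L i ≤ max (top L a) (top L p) := fun i hi =>
    le_max_of_two_modes n1 n2 n3 n4 (by omega)
  have hlt : ∀ i < L.length, bot L i < top L i := (columns_iff.1 hC).2
  have hpos : 0 ≤ max (top L a) (top L p) := by
    have h3 := hlt 0 (by omega)
    have h4 := h0 0 (by omega)
    have h5 := hmax 0 (by omega)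
    omega
  have hac' : a < c := by
    rcases hac.eq_or_lt with rfl | h
    · omega
    · exact h
  have hcp' : c < p := by
    rcases hcp.eq_or_lt with rfl | h
    · omega
    · exact h
  refine ⟨isSelfAvoidingPolygon_boundary hC (by omega), L.length, (max (top L a) (top L p)).toNat,
    ⟨fun q hq => ?_, ?_, ?_, ?_, ?_⟩, ?_, ?_⟩
  · obtain ⟨i, hi, h3, h4, h5⟩ := verts_polygon_bounds hC hq
    have h6 := h0 i hi
    have h7 := hmax i hi
    omega
  · exact ⟨_, (mem_verts_bot hC (show 0 < L.length by omega)).1, rfl⟩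
  · exact ⟨_, (mem_verts_bot hC (show L.length - 1 < L.length by omega)).2, by simp only; omega⟩
  · exact ⟨_, (mem_verts_bot hC (show m < L.length by omega)).1, hbm⟩
  · rcases le_total (top L a) (top L p) with h3 | h3
    · exact ⟨_, mem_verts_top hC (show p < L.length by omega), by simp only; omega⟩
    · exact ⟨_, mem_verts_top hC (show a < L.length by omega), by simp only; omega⟩
  · have hs := sum_range_abs_of_twoModes hac hcp hp n1 n2 n3 n4 hm
    have hE := edgeSet_ncard (P := polygon L) (finite_verts_boundary hC)
    have hs' := sum_range_abs_of_valley hm1 v1 v2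
    have hv2 := two_mul_perim (L := L) (hlt 0 (by omega)).le
    rw [Finset.sum_add_distrib] at hv2
    omega
  · have ht : ∀ i : ℕ, i ≤ L.length - 1 → top L (i : ℤ).toNat = top L i + 0 := fun i _ => by simp
    have e : ((L.length : ℤ) - 1) = ((L.length - 1 : ℕ) : ℤ) := by omega
    refine ⟨fun i => top L i.toNat, fun i h1 h2 => (isTopHeight_polygon_iff hC h1 h2).2 rfl, a, c, p,
      by omega, by omega, by omega, by omega, ?_, ?_, ?_, ?_, by simpa using hm⟩
    · exact (incr_iff_monotoneOn (i := 0)).1 (n1.congr ht (by omega))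
    · exact decr_iff_antitoneOn.1 (n2.congr ht (by omega))
    · exact incr_iff_monotoneOn.1 (n3.congr ht (by omega))
    · rw [e]
      exact decr_iff_antitoneOn.1 (n4.congr ht (by omega))

/-- The number of horizontal edges gives the length. In each column the two horizontal edges are the
bottom and the top, and their order tells which is which. -/
theorem injOn_polygon : Set.InjOn polygon {L | Bimodal L} := by
  intro L hL M hM h
  have hlen : L.length = M.length := by
    have h1 := hL.horizontalPerimeter_polygon
    rw [h, hM.horizontalPerimeter_polygon] at h1
    omega
  have key : ∀ i < L.length, bot L i = bot M i ∧ top L i = top M i := by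
    intro i hi
    have h1 := (columns_iff.1 hL.columns).2 i hi
    have h2 := (columns_iff.1 hM.columns).2 i (by omega)
    have h3 : ∀ y, (y = bot L i ∨ y = top L i) ↔ (y = bot M i ∨ y = top M i) := by
      intro y
      have h4 := boundary_adj_right_iff hL.columns.lt (i := i) (y := y)
      have h5 := boundary_adj_right_iff hM.columns.lt (i := i) (y := y)
      rw [← polygon, h, polygon, h5] at h4
      simp only [Int.toNat_natCast] at h4
      have h6 : (0 : ℤ) ≤ i ∧ (i : ℤ) < L.length := by omega
      have h7 : (0 : ℤ) ≤ i ∧ (i : ℤ) < M.length := by omega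
      simp only [h6, h7, true_and] at h4
      exact h4.symm
    have h4 := (h3 _).1 (Or.inl rfl)
    have h5 := (h3 _).1 (Or.inr rfl)
    omega
  refine List.ext_getElem hlen fun i h1 h2 => ?_
  have := key i h1
  simp only [bot, top, List.getD_eq_getElem _ _ h1, List.getD_eq_getElem _ _ h2] at this
  exact Prod.ext this.1 this.2

theorem image_polygon_fiber (i j : ℕ) :
    polygon '' fiber {L | Bimodal L} perim i j = bimodalConvexPolygons 2 i j := by
  ext P
  constructor
  · rintro ⟨L, ⟨hL, rfl, rfl⟩, rfl⟩
    exact ⟨hL.isBimodalConvexPolygon, hL.horizontalPerimeter_polygon, hL.verticalPerimeter_polygon⟩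
  · rintro ⟨hP, h1, h2⟩
    obtain ⟨L, hL, rfl⟩ := hP.exists_polygon
    rw [hL.horizontalPerimeter_polygon] at h1
    rw [hL.verticalPerimeter_polygon] at h2
    exact ⟨L, ⟨hL, by omega, by omega⟩, rfl⟩

theorem finite_bimodalConvexPolygons (i j : ℕ) : (bimodalConvexPolygons 2 i j).Finite := by
  rw [← image_polygon_fiber]
  exact (finite_fiber_bimodal i j).image _

theorem bimodalGF_two : bimodalGF 2 = gf {L | Bimodal L} perim := by
  ext n
  rw [coeff_gf]
  change ((bimodalConvexPolygons 2 (n 0) (n 1)).ncard : ℚ) = _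
  rw [← image_polygon_fiber, (injOn_polygon.mono fun L hL => hL.1).ncard_image]

end bimodal

/-! ### The square root of `Δ` and the final formula -/

section final

open MvPowerSeries (X constantCoeff)

/-- The Catalan series satisfies `c = 1 + u * c ^ 2`, hence `(1 - 2 * u * c) ^ 2 = 1 - 4 * u`. It is
substituted at `u = (1 - Δ) / 4`, which has constant term zero. -/
theorem exists_sq_eq_discr : ∃ s : MvPowerSeries (Fin 2) ℚ,
    constantCoeff s = 1 ∧ s ^ 2 = discr (X 0) (X 1) := by
  set u : MvPowerSeries (Fin 2) ℚ := MvPowerSeries.C (1 / 4) * (1 - discr (X 0) (X 1)) with hu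
  have h0 : constantCoeff u = 0 := by simp [hu, discr]
  have hu' : 4 * u = 1 - discr (X 0) (X 1) := by
    rw [hu, ← mul_assoc]
    have : (4 : MvPowerSeries (Fin 2) ℚ) * MvPowerSeries.C (1 / 4) = 1 := by
      rw [← map_ofNat (MvPowerSeries.C (σ := Fin 2) (R := ℚ)) 4, ← map_mul]
      norm_num
    rw [this, one_mul]
  have hs := PowerSeries.HasSubst.of_constantCoeff_zero h0
  have hC := congrArg (fun f => PowerSeries.substAlgHom (R := ℚ) hs
    (PowerSeries.map (Nat.castRingHom ℚ) f)) PowerSeries.catalanSeries_sq_mul_X_add_one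
  simp only [map_add, map_mul, map_pow, map_one, PowerSeries.map_X] at hC
  rw [PowerSeries.substAlgHom_X hs] at hC
  set c := PowerSeries.substAlgHom (R := ℚ) hs
    (PowerSeries.map (Nat.castRingHom ℚ) PowerSeries.catalanSeries)
  refine ⟨1 - 2 * u * c, by simp [h0], ?_⟩
  linear_combination 4 * u * hC - hu'

theorem emb_inv (K : Type*) [Field K] [Algebra (MvPowerSeries (Fin 2) ℚ) K]
    {d : MvPowerSeries (Fin 2) ℚ} (h : constantCoeff d ≠ 0) : emb K d⁻¹ = (emb K d)⁻¹ := by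
  refine eq_inv_of_mul_eq_one_left ?_
  rw [← map_mul, MvPowerSeries.inv_mul_cancel _ h, map_one]

theorem map_polyA {R S : Type*} [CommRing R] [CommRing S] (f : R →+* S) (x y : R) :
    f (polyA x y) = polyA (f x) (f y) := by
  simp only [polyA, map_add, map_sub, map_mul, map_pow, map_neg, map_one, map_ofNat]

theorem map_polyB {R S : Type*} [CommRing R] [CommRing S] (f : R →+* S) (x y : R) :
    f (polyB x y) = polyB (f x) (f y) := by
  simp only [polyB, map_add, map_sub, map_mul, map_pow, map_neg, map_one, map_ofNat]

theorem bimodalGF_two_eq (K : Type*) [Field K] [CharZero K] [Algebra (MvPowerSeries (Fin 2) ℚ) K]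
    [IsFractionRing (MvPowerSeries (Fin 2) ℚ) K] {s : MvPowerSeries (Fin 2) ℚ}
    (hs : s ^ 2 = discr (X 0) (X 1)) (hs₁ : constantCoeff s = 1) :
    bimodalGF 2 = -(2 * X 0 ^ 2 * polyA (X 0) (X 1) *
        ((1 - X 0) ^ 3 * ((1 - X 0) ^ 2 - X 1) * s ^ 5)⁻¹ + X 0 ^ 2 * polyB (X 0) (X 1) *
        ((1 - X 0) ^ 5 * ((1 - X 0) ^ 2 - X 1) ^ 3 * discr (X 0) (X 1) ^ 3)⁻¹) := by
  apply emb_injective (K := K)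
  have hf := rise_dec (K := K) hs hs₁
  have hne : ∀ u : MvPowerSeries (Fin 2) ℚ, constantCoeff u ≠ 0 → emb K u ≠ 0 := fun u hu =>
    ((isUnit_of_constantCoeff_ne_zero hu).map (emb K)).ne_zero
  have h1 := hne (1 - X 0) (by simp)
  have h2 := hne ((1 - X 0) ^ 2 - X 1) (by simp)
  have h3 := hne s (by simp [hs₁])
  rw [bimodalGF_two, gf_bimodal, map_mul, map_add]
  rw [riseT, riseT] at hf
  rw [hf, ← hs, map_neg, map_add, map_mul, map_mul _ _ (_)⁻¹, emb_inv, emb_inv]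
  · simp only [map_mul, map_pow, map_sub, map_one, map_polyA, map_polyB, map_ofNat] at h1 h2 ⊢
    field_simp
    ring
  · simp [hs₁]
  · simp [hs₁]

end final

theorem mainTheorem4 (x y : MvPowerSeries (Fin 2) ℚ)
    (hx : x = MvPowerSeries.X 0) (hy : y = MvPowerSeries.X 1) :
    (∀ i j : ℕ, (bimodalConvexPolygons 2 i j).Finite) ∧
    ∃ s : MvPowerSeries (Fin 2) ℚ,
      MvPowerSeries.constantCoeff s = 1 ∧ s ^ 2 = discr x y ∧
      bimodalGF 2 =
        -(2 * x ^ 2 * polyA x y * ((1 - x) ^ 3 * ((1 - x) ^ 2 - y) * s ^ 5)⁻¹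
          + x ^ 2 * polyB x y *
              ((1 - x) ^ 5 * ((1 - x) ^ 2 - y) ^ 3 * discr x y ^ 3)⁻¹) := by
  subst hx hy
  obtain ⟨s, hs₁, hs⟩ := exists_sq_eq_discr
  have := algebraRat.charZero (MvPowerSeries (Fin 2) ℚ)
  have := charZero_of_injective_algebraMap
    (IsFractionRing.injective (MvPowerSeries (Fin 2) ℚ) (FractionRing (MvPowerSeries (Fin 2) ℚ)))
  exact ⟨finite_bimodalConvexPolygons, s, hs₁, hs, bimodalGF_two_eq (FractionRing (MvPowerSeries (Fin 2) ℚ)) hs hs₁⟩
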